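/- Let $\mathbb{F}_q$ be a finite field with $q$ elements, $t$ a variable, $v\in\mathbb{F}_q[t]$ a monic irreducible polynomial, and $K$ a field containing $\mathbb{F}_q$ in which $\mathbb{F}_q$ is algebraically closed. Let $K^{\mathrm{sep}}$ be a separable closure of $K$ and $G_K=\mathrm{Gal}(K^{\mathrm{sep}}/K)$. For a field $k\supseteq\mathbb{F}_q$ put $k[t]_v:=\varprojlim_n k[t]/v^n$ and $k(t)_v:=\mathbb{F}_q(t)\otimes_{\mathbb{F}_q[t]}k[t]_v$. Let $\sigma$ be the endomorphism of $k[t]_v$ and of $k(t)_v$ induced by $\sum a_it^i\mapsto\sum a_i^qt^i$, and let $G_K$ act on $K^{\mathrm{sep}}(t)_v$ through the coefficients. A $\varphi$-module over a commutative ring $A$ with endomorphism $\sigma$ is an $A$-module $M$ with a $\sigma$-semilinear map $\varphi:M\to M$; morphisms are the $A$-linear maps that commute with $\varphi$, and on a tensor product $\varphi$ acts as $\varphi\otimes\varphi$. A $\varphi$-module $M$ over $A=K[t]_v$ is étale if it is finitely generated and the $A$-linear map $A\otimes_{\sigma,A}M\to M$, $a\otimes x\mapsto a\varphi(x)$, is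 bijective. For a $\varphi$-module $M$ over $K(t)_v$ let $V(M):=(K^{\mathrm{sep}}(t)_v\otimes_{K(t)_v}M)^{\varphi}$ be the $\mathbb{F}_q(t)_v$-space of elements fixed by $\sigma\otimes\varphi$, on which $\tau\in G_K$ acts by $\tau\otimes\mathrm{id}$. Call $M$ $K^{\mathrm{sep}}(t)_v$-trivial if it is finite-dimensional over $K(t)_v$ and the natural map $K^{\mathrm{sep}}(t)_v\otimes_{\mathbb{F}_q(t)_v}V(M)\to K^{\mathrm{sep}}(t)_v\otimes_{K(t)_v}M$ is an isomorphism. Let $\mathrm{Rep}(G_K,\mathbb{F}_q(t)_v)$ be the category of finite-dimensional $\mathbb{F}_q(t)_v$-representations of $G_K$ that are continuous for the $v$-adic topology. For a representation $W$ of $G_K$ over $\mathbb{F}_q(t)_v$ let $D(W):=(K^{\mathrm{sep}}(t)_v\otimes_{\mathbb{F}_q(t)_v}W)^{G_K}$, the invariants of the action $\tau\otimes\tau$, with $\varphi$ acting as $\sigma\otimes\mathrm{id}$. Then: (1) A $\varphi$-module $M$ over $K(t)_v$ is $K^{\mathrm{sep}}(t)_v$-trivial if and only if there is a $\varphi$-stable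 $K[t]_v$-submodule $M_0$ of $M$ which is an étale $\varphi$-module over $K[t]_v$ and for which the natural map $K(t)_v\otimes_{K[t]_v}M_0\to M$ is an isomorphism. (2) For every object $W$ of $\mathrm{Rep}(G_K,\mathbb{F}_q(t)_v)$, the $\varphi$-module $D(W)$ is $K^{\mathrm{sep}}(t)_v$-trivial. (3) The $K^{\mathrm{sep}}(t)_v$-trivial $\varphi$-modules, and the objects of $\mathrm{Rep}(G_K,\mathbb{F}_q(t)_v)$, contain the unit object and are stable under tensor products; $V$ maps the former to the latter; and $V$, with the natural isomorphisms $V(M)\otimes V(N)\cong V(M\otimes N)$, is a (symmetric monoidal) tensor equivalence from the category of $K^{\mathrm{sep}}(t)_v$-trivial $\varphi$-modules to $\mathrm{Rep}(G_K,\mathbb{F}_q(t)_v)$, with quasi-inverse $D$. -/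

import Mathlib

open CategoryTheory MonoidalCategory TensorProduct Polynomial

universe u w

/-! ### `φ`-modules -/

/-- A `φ`-module over `(A, σ)`: an `A`-module together with a `σ`-semilinear endomorphism. -/
structure PhiMod {A : Type u} [CommRing A] (σ : A →+* A) where
  carrier : Type u
  [addCommGroup : AddCommGroup carrier]
  [module : Module A carrier]
  φ : carrier →ₛₗ[σ] carrier

namespace PhiMod

variable {A : Type u} [CommRing A] {σ : A →+* A}

instance : CoeSort (PhiMod σ) (Type u) := ⟨PhiMod.carrier⟩

attribute [instance] PhiMod.addCommGroup PhiMod.module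

/-- A morphism of `φ`-modules: a linear map compatible with the `φ`'s. -/
@[ext]
structure Hom (M N : PhiMod σ) where
  lin : M →ₗ[A] N
  comm : ∀ x, lin (M.φ x) = N.φ (lin x)

instance : Category (PhiMod σ) where
  Hom M N := Hom M N
  id M := ⟨LinearMap.id, fun _ => rfl⟩
  comp f g := ⟨g.lin ∘ₗ f.lin, fun x => by simp [f.comm, g.comm]⟩

@[ext]
theorem hom_ext {M N : PhiMod σ} {f g : M ⟶ N} (h : f.lin = g.lin) : f = g := Hom.ext h

@[simp]
theorem id_lin (M : PhiMod σ) : Hom.lin (𝟙 M) = LinearMap.id := rfl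

@[simp]
theorem comp_lin {M N P : PhiMod σ} (f : M ⟶ N) (g : N ⟶ P) :
    Hom.lin (f ≫ g) = g.lin ∘ₗ f.lin := rfl

/-- A `φ`-compatible linear equivalence is an isomorphism of `φ`-modules. -/
def mkIso {M N : PhiMod σ} (e : M ≃ₗ[A] N) (h : ∀ x, e (M.φ x) = N.φ (e x)) : M ≅ N where
  hom := ⟨e.toLinearMap, h⟩
  inv := ⟨e.symm.toLinearMap, fun x => by
    apply e.injective
    simp [h]⟩
  hom_inv_id := by ext; simp
  inv_hom_id := by ext; simp

/-- The forgetful functor to modules. -/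
def forgetMod (σ : A →+* A) : PhiMod σ ⥤ ModuleCat.{u} A where
  obj M := ModuleCat.of A M
  map f := ModuleCat.ofHom f.lin

instance : (forgetMod σ).Faithful where
  map_injective h := by
    ext x
    exact congrArg (fun k => k.hom x) h

/-- The tensor product `M ⊗ N`, with `φ` acting as `φ ⊗ φ`. -/
noncomputable def tensor (M N : PhiMod σ) : PhiMod σ where
  carrier := M ⊗[A] N
  φ := TensorProduct.map M.φ N.φ

/-- The endomorphism `σ`, as a `σ`-semilinear map `A → A`. -/
def selfMap (σ : A →+* A) : A →ₛₗ[σ] A where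
  toFun := σ
  map_add' := map_add σ
  map_smul' a b := by simp

/-- The unit object `(A, σ)`. -/
def unit (σ : A →+* A) : PhiMod σ where
  carrier := A
  φ := selfMap σ

/-- The tensor product of morphisms. -/
noncomputable def tensorMap {M M' N N' : PhiMod σ} (f : M ⟶ M') (g : N ⟶ N') :
    tensor M N ⟶ tensor M' N' where
  lin := TensorProduct.map f.lin g.lin
  comm := fun (x : M ⊗[A] N) => by
    change TensorProduct.map f.lin g.lin (TensorProduct.map M.φ N.φ x) =
      TensorProduct.map M'.φ N'.φ (TensorProduct.map f.lin g.lin x)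
    induction x using TensorProduct.induction_on with
    | zero => simp
    | tmul x y => simp [f.comm, g.comm]
    | add x y hx hy => simp only [map_add, hx, hy]

/-- The associativity isomorphism. -/
noncomputable def assocIso (M N P : PhiMod σ) :
    tensor (tensor M N) P ≅ tensor M (tensor N P) :=
  mkIso (M := tensor (tensor M N) P) (N := tensor M (tensor N P))
    (TensorProduct.assoc A M N P) (fun (x : (M ⊗[A] N) ⊗[A] P) => by
      change TensorProduct.assoc A M N P
        (TensorProduct.map (TensorProduct.map M.φ N.φ) P.φ x) =
        TensorProduct.map M.φ (TensorProduct.map N.φ P.φ) (TensorProduct.assoc A M N P x)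
      induction x using TensorProduct.induction_on with
      | zero => simp
      | add x y hx hy => simp only [map_add, hx, hy]
      | tmul x z =>
        induction x using TensorProduct.induction_on with
        | zero => simp
        | add x y hx hy => simp only [TensorProduct.add_tmul, map_add, hx, hy]
        | tmul x y => simp)

/-- The left unit isomorphism `a ⊗ x ↦ a x`. -/
noncomputable def leftUnitIso (M : PhiMod σ) : tensor (unit σ) M ≅ M :=
  mkIso (M := tensor (unit σ) M) (N := M) (TensorProduct.lid A M) (fun (x : A ⊗[A] M) => by
    change TensorProduct.lid A M (TensorProduct.map (selfMap σ) M.φ x) =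
      M.φ (TensorProduct.lid A M x)
    induction x using TensorProduct.induction_on with
    | zero => simp
    | add x y hx hy => simp only [map_add, hx, hy]
    | tmul a x => exact (M.φ.map_smulₛₗ a x).symm)

/-- The right unit isomorphism `x ⊗ a ↦ a x`. -/
noncomputable def rightUnitIso (M : PhiMod σ) : tensor M (unit σ) ≅ M :=
  mkIso (M := tensor M (unit σ)) (N := M) (TensorProduct.rid A M) (fun (x : M ⊗[A] A) => by
    change TensorProduct.rid A M (TensorProduct.map M.φ (selfMap σ) x) =
      M.φ (TensorProduct.rid A M x)
    induction x using TensorProduct.induction_on with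
    | zero => simp
    | add x y hx hy => simp only [map_add, hx, hy]
    | tmul x a => exact (M.φ.map_smulₛₗ a x).symm)

/-- The symmetry `x ⊗ y ↦ y ⊗ x`. -/
noncomputable def commIso (M N : PhiMod σ) : tensor M N ≅ tensor N M :=
  mkIso (M := tensor M N) (N := tensor N M) (TensorProduct.comm A M N)
    (fun (x : M ⊗[A] N) => by
      change TensorProduct.comm A M N (TensorProduct.map M.φ N.φ x) =
        TensorProduct.map N.φ M.φ (TensorProduct.comm A M N x)
      induction x using TensorProduct.induction_on with
      | zero => simp
      | add x y hx hy => simp only [map_add, hx, hy]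
      | tmul x y => simp)

noncomputable instance : MonoidalCategoryStruct (PhiMod σ) where
  tensorObj := tensor
  whiskerLeft M _ _ f := tensorMap (𝟙 M) f
  whiskerRight f N := tensorMap f (𝟙 N)
  tensorHom f g := tensorMap f g
  tensorUnit := unit σ
  associator := assocIso
  leftUnitor := leftUnitIso
  rightUnitor := rightUnitIso

/-- The forgetful functor to modules preserves the tensor product strictly. -/
noncomputable def forgetInducing (σ : A →+* A) :
    Monoidal.InducingFunctorData (forgetMod σ) where
  μIso := fun _ _ => Iso.refl _
  εIso := Iso.refl _
  whiskerLeft_eq := fun _ _ _ _ => rfl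
  whiskerRight_eq := fun _ _ => rfl
  tensorHom_eq := fun _ _ => rfl
  leftUnitor_eq := fun X => by
    refine ModuleCat.hom_ext (TensorProduct.ext' fun x y => ?_)
    rfl
  rightUnitor_eq := fun X => by
    refine ModuleCat.hom_ext (TensorProduct.ext' fun x y => ?_)
    rfl
  associator_eq := fun X Y Z => by
    refine ModuleCat.hom_ext (TensorProduct.ext_threefold fun x y z => ?_)
    rfl

noncomputable instance : MonoidalCategory (PhiMod σ) :=
  Monoidal.induced (forgetMod σ) (forgetInducing σ)

noncomputable instance : (forgetMod σ).Monoidal :=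
  Monoidal.fromInducedMonoidal (forgetMod σ) (forgetInducing σ)

theorem forgetMod_braided (M N : PhiMod σ) :
    Functor.LaxMonoidal.μ (forgetMod σ) M N ≫ (forgetMod σ).map (commIso M N).hom =
      (β_ ((forgetMod σ).obj M) ((forgetMod σ).obj N)).hom ≫
        Functor.LaxMonoidal.μ (forgetMod σ) N M := by
  refine ModuleCat.hom_ext (TensorProduct.ext' fun x y => ?_)
  rfl

noncomputable instance : BraidedCategory (PhiMod σ) :=
  .ofFaithful (forgetMod σ) commIso forgetMod_braided

noncomputable instance : (forgetMod σ).Braided where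
  braided := forgetMod_braided

noncomputable instance : SymmetricCategory (PhiMod σ) :=
  .ofFaithful (forgetMod σ)

/-- A `φ`-stable submodule, as a `φ`-module over a ring `B` of scalars with endomorphism `τ`. -/
def ofStable {B : Type u} [CommRing B] (τ : B →+* B) (M : PhiMod σ) [Module B M]
    (hτ : ∀ (b : B) (x : M), M.φ (b • x) = τ b • M.φ x)
    (M₀ : Submodule B M) (hM₀ : ∀ x ∈ M₀, M.φ x ∈ M₀) : PhiMod τ where
  carrier := M₀
  φ :=
    { toFun := fun x => ⟨M.φ x, hM₀ x x.2⟩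
      map_add' := fun x y => Subtype.ext (by simp)
      map_smul' := fun b x => Subtype.ext (by simp [hτ]) }

/-- A copy of `A`, regarded as an `A`-algebra through `σ : A → A`. -/
def Twist (_ : A →+* A) : Type u := A

instance (σ : A →+* A) : CommRing (Twist σ) := inferInstanceAs (CommRing A)

instance (σ : A →+* A) : Algebra A (Twist σ) :=
  RingHom.toAlgebra (S := Twist σ) σ

/-- The linearization `φ_σ : A ⊗_{σ, A} M → M`, `a ⊗ x ↦ a φ(x)`. -/
noncomputable def linearization (M : PhiMod σ) : Twist σ ⊗[A] M →+ M :=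
  TensorProduct.liftAddHom
    (show Twist σ →+ M →+ M from (smulAddHom A M).compl₂ M.φ.toAddMonoidHom)
    (fun (r a : A) (x : M) => by
      change (σ r * a) • M.φ x = a • M.φ (r • x)
      rw [LinearMap.map_smulₛₗ, smul_smul, mul_comm])

theorem linearization_tmul (M : PhiMod σ) (a : A) (x : M) :
    M.linearization ((show Twist σ from a) ⊗ₜ x) = a • M.φ x := rfl

/-- A `φ`-module is étale if it is finitely generated and its linearization is bijective. -/
def IsEtale (M : PhiMod σ) : Prop :=
  Module.Finite A M ∧ Function.Bijective M.linearization

/-- For an algebra `E` over `B`, with compatible endomorphisms `τ` of `B` and `σ` of `E`: the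
`φ`-module `M` over `E` has a `φ`-stable `B`-submodule `M₀` which is an étale `φ`-module over `B`,
such that `M = E ⊗_B M₀`. -/
def HasEtaleModel {B E : Type u} [CommRing B] [CommRing E] [Algebra B E] (τ : B →+* B)
    {σ : E →+* E} (h : ∀ b, σ (algebraMap B E b) = algebraMap B E (τ b)) (M : PhiMod σ) : Prop :=
  letI : Module B M := Module.compHom M (algebraMap B E)
  haveI : IsScalarTower B E M := ⟨fun b e x => by
    rw [Algebra.smul_def, mul_smul]
    rfl⟩
  ∃ (M₀ : Submodule B M) (hM₀ : ∀ x ∈ M₀, M.φ x ∈ M₀),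
    (ofStable τ M (fun b x => by
      rw [← algebraMap_smul E b x, LinearMap.map_smulₛₗ, h, algebraMap_smul]) M₀ hM₀).IsEtale ∧
    IsBaseChange E M₀.subtype

end PhiMod

/-! ### The functors `V` and `D` of a triple `F ⊂ E ⊂ L` -/

/-- Rings `F → E → L` with compatible `F`-linear endomorphisms `σ` of `E` and `L`, and an
`E`-linear action of a group `G` on `L` which commutes with `σ`. -/
structure SigmaTriple (F E L : Type u) (G : Type w) [CommRing F] [CommRing E] [CommRing L]
    [Algebra F E] [Algebra E L] [Algebra F L] [IsScalarTower F E L]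
    [Group G] [MulSemiringAction G L] where
  σE : E →ₐ[F] E
  σL : L →ₐ[F] L
  σL_algebraMap : ∀ e : E, σL (algebraMap E L e) = algebraMap E L (σE e)
  smul_algebraMap : ∀ (g : G) (e : E), g • algebraMap E L e = algebraMap E L e
  σL_smul : ∀ (g : G) (a : L), σL (g • a) = g • σL a

namespace SigmaTriple

variable {F E L : Type u} {G : Type w} [CommRing F] [CommRing E] [CommRing L]
  [Algebra F E] [Algebra E L] [Algebra F L] [IsScalarTower F E L]
  [Group G] [MulSemiringAction G L] (T : SigmaTriple F E L G)

/-- `σ` on `E` as a ring endomorphism. -/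
def σ : E →+* E := T.σE.toRingHom

@[simp] theorem σ_apply (e : E) : T.σ e = T.σE e := rfl

/-- `σ` on `L`, semilinear with respect to `σ` on `E`. -/
def σLin : L →ₛₗ[T.σ] L where
  toFun := T.σL
  map_add' := map_add T.σL
  map_smul' e a := by
    simp [Algebra.smul_def, T.σL_algebraMap]

/-- The `E`-linear action of a group element on `L`. -/
def act (g : G) : L →ₗ[E] L where
  toFun a := g • a
  map_add' := smul_add g
  map_smul' e a := by
    simp [Algebra.smul_def, smul_mul', T.smul_algebraMap]

@[simp] theorem σLin_apply (a : L) : T.σLin a = T.σL a := rfl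

@[simp] theorem act_apply (g : G) (a : L) : T.act g a = g • a := rfl

section V

/-- `σ ⊗ φ` on `L ⊗_E M`. -/
noncomputable def phiL (M : PhiMod T.σ) : L ⊗[E] M →ₛₗ[T.σ] L ⊗[E] M :=
  TensorProduct.map T.σLin M.φ

/-- `g ⊗ id` on `L ⊗_E M`. -/
noncomputable def actL (M : PhiMod T.σ) (g : G) : L ⊗[E] M →ₗ[E] L ⊗[E] M :=
  TensorProduct.map (T.act g) LinearMap.id

theorem actL_one (M : PhiMod T.σ) (x : L ⊗[E] M) : T.actL M 1 x = x := by
  induction x using TensorProduct.induction_on with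
  | zero => simp
  | add x y hx hy => simp only [map_add, hx, hy]
  | tmul a m => simp [actL]

theorem actL_mul (M : PhiMod T.σ) (g h : G) (x : L ⊗[E] M) :
    T.actL M (g * h) x = T.actL M g (T.actL M h x) := by
  induction x using TensorProduct.induction_on with
  | zero => simp
  | add x y hx hy => simp only [map_add, hx, hy]
  | tmul a m => simp [actL, mul_smul]

theorem phiL_actL (M : PhiMod T.σ) (g : G) (x : L ⊗[E] M) :
    T.phiL M (T.actL M g x) = T.actL M g (T.phiL M x) := by
  induction x using TensorProduct.induction_on with
  | zero => simp
  | add x y hx hy => simp only [map_add, hx, hy]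
  | tmul a m => simp [actL, phiL, T.σL_smul]

theorem phiL_smul (M : PhiMod T.σ) (c : F) (x : L ⊗[E] M) :
    T.phiL M (c • x) = c • T.phiL M x := by
  rw [← algebraMap_smul E c x, LinearMap.map_smulₛₗ, ← algebraMap_smul E c (T.phiL M x)]
  simp

/-- The underlying space of `V(M) = (L ⊗_E M)^φ`. -/
def fixed (M : PhiMod T.σ) : Submodule F (L ⊗[E] M) where
  carrier := {x | T.phiL M x = x}
  add_mem' {x y} hx hy := by
    change T.phiL M (x + y) = x + y
    rw [map_add]
    exact congrArg₂ (· + ·) hx hy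
  zero_mem' := map_zero _
  smul_mem' c x hx := by
    change T.phiL M (c • x) = c • x
    rw [phiL_smul]
    exact congrArg (c • ·) hx

/-- The action of `G` on `V(M)` by `g ⊗ id`. -/
noncomputable def galoisRep (M : PhiMod T.σ) : Representation F G (T.fixed M) where
  toFun g :=
    { toFun := fun x => ⟨T.actL M g x, by
        change T.phiL M (T.actL M g x) = T.actL M g x
        rw [phiL_actL]
        exact congrArg (T.actL M g) x.2⟩
      map_add' := fun x y => Subtype.ext (map_add (T.actL M g) x.1 y.1)
      map_smul' := fun c x => Subtype.ext ((T.actL M g).map_smul_of_tower c x.1) }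
  map_one' := LinearMap.ext fun x => Subtype.ext (T.actL_one M x)
  map_mul' g h := LinearMap.ext fun x => Subtype.ext (T.actL_mul M g h x)

/-- `id ⊗ f` on `L ⊗_E M`. -/
noncomputable def mapL {M N : PhiMod T.σ} (f : M ⟶ N) : L ⊗[E] M →ₗ[E] L ⊗[E] N :=
  TensorProduct.map LinearMap.id f.lin

theorem phiL_mapL {M N : PhiMod T.σ} (f : M ⟶ N) (x : L ⊗[E] M) :
    T.phiL N (T.mapL f x) = T.mapL f (T.phiL M x) := by
  induction x using TensorProduct.induction_on with
  | zero => simp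
  | add x y hx hy => simp only [map_add, hx, hy]
  | tmul a m => simp [mapL, phiL, f.comm]

theorem actL_mapL {M N : PhiMod T.σ} (f : M ⟶ N) (g : G) (x : L ⊗[E] M) :
    T.actL N g (T.mapL f x) = T.mapL f (T.actL M g x) := by
  induction x using TensorProduct.induction_on with
  | zero => simp
  | add x y hx hy => simp only [map_add, hx, hy]
  | tmul a m => simp [mapL, actL]

/-- The map `V(M) → V(N)` induced by a morphism `M → N`. -/
noncomputable def fixedMap {M N : PhiMod T.σ} (f : M ⟶ N) :
    (T.galoisRep M).IntertwiningMap (T.galoisRep N) where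
  toFun := fun (x : T.fixed M) => ⟨T.mapL f x, by
    change T.phiL N (T.mapL f x) = T.mapL f x
    rw [phiL_mapL]
    exact congrArg (T.mapL f) x.2⟩
  map_add' := fun x y => Subtype.ext (map_add (T.mapL f) x.1 y.1)
  map_smul' := fun c x => Subtype.ext ((T.mapL f).map_smul_of_tower c x.1)
  isIntertwining' := fun g => LinearMap.ext fun x =>
    Subtype.ext (T.actL_mapL f g x.1).symm

/-- The representation `V(M) = (L ⊗_E M)^φ` of `G` over `F`. -/
noncomputable def fixedRep (M : PhiMod T.σ) : Rep.{u} F G :=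
  Rep.of (X := T.fixed M) (T.galoisRep M)

/-- The functor `M ↦ V(M) = (L ⊗_E M)^φ` from `φ`-modules over `E` to representations of `G`
over `F`. -/
noncomputable def V : PhiMod T.σ ⥤ Rep.{u} F G where
  obj M := T.fixedRep M
  map {M N} f := show T.fixedRep M ⟶ T.fixedRep N from Rep.ofHom (T.fixedMap f)
  map_id M := by
    refine Rep.hom_ext (Representation.IntertwiningMap.ext (LinearMap.ext fun x => Subtype.ext ?_))
    change TensorProduct.map LinearMap.id LinearMap.id x.1 = x.1
    rw [TensorProduct.map_id]
    rfl
  map_comp {M N P} f g := by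
    refine Rep.hom_ext (Representation.IntertwiningMap.ext (LinearMap.ext fun x => Subtype.ext ?_))
    change TensorProduct.map (LinearMap.id ∘ₗ LinearMap.id) (g.lin ∘ₗ f.lin) x.1 = _
    rw [TensorProduct.map_comp]
    rfl

/-- The comparison map `ι_M : L ⊗_F V(M) → L ⊗_E M`, `a ⊗ x ↦ a x`. -/
noncomputable def comparison (M : PhiMod T.σ) : L ⊗[F] T.fixed M →ₗ[L] L ⊗[E] M :=
  (T.fixed M).subtype.liftBaseChange L

/-- `L`-trivial `φ`-modules over `E`. -/
def IsTrivial : ObjectProperty (PhiMod T.σ) := fun M =>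
  Module.Finite E M ∧ Function.Bijective (T.comparison M)

end V

section D

/-- `g ⊗ g` on `L ⊗_F W`. -/
noncomputable def diagAct (W : Rep.{u} F G) (g : G) : L ⊗[F] W →ₗ[E] L ⊗[F] W :=
  AlgebraTensorModule.map (T.act g) (W.ρ g)

/-- `σ ⊗ id` on `L ⊗_F W`. -/
noncomputable def sigmaRep (W : Rep.{u} F G) : L ⊗[F] W →ₗ[F] L ⊗[F] W :=
  TensorProduct.map T.σL.toLinearMap LinearMap.id

theorem sigmaRep_smul (W : Rep.{u} F G) (e : E) (x : L ⊗[F] W) :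
    T.sigmaRep W (e • x) = T.σ e • T.sigmaRep W x := by
  induction x using TensorProduct.induction_on with
  | zero => simp
  | add x y hx hy => simp only [map_add, smul_add, hx, hy]
  | tmul a m =>
    simp [sigmaRep, TensorProduct.smul_tmul', Algebra.smul_def, T.σL_algebraMap]

theorem diagAct_sigmaRep (W : Rep.{u} F G) (g : G) (x : L ⊗[F] W) :
    T.diagAct W g (T.sigmaRep W x) = T.sigmaRep W (T.diagAct W g x) := by
  induction x using TensorProduct.induction_on with
  | zero => simp
  | add x y hx hy => simp only [map_add, hx, hy]
  | tmul a m => simp [sigmaRep, diagAct, T.σL_smul]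

/-- The underlying space of `D(W) = (L ⊗_F W)^G`. -/
def invariants (W : Rep.{u} F G) : Submodule E (L ⊗[F] W) where
  carrier := {x | ∀ g, T.diagAct W g x = x}
  add_mem' {x y} hx hy g := by rw [map_add, hx g, hy g]
  zero_mem' g := map_zero _
  smul_mem' c x hx g := by rw [map_smul, hx g]

/-- The `φ`-module `D(W) = (L ⊗_F W)^G`, with `φ` acting as `σ ⊗ id`. -/
noncomputable def invariantsPhi (W : Rep.{u} F G) : PhiMod T.σ where
  carrier := T.invariants W
  φ :=
    { toFun := fun x => ⟨T.sigmaRep W x, fun g => by rw [diagAct_sigmaRep, x.2 g]⟩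
      map_add' := fun x y => Subtype.ext (map_add (T.sigmaRep W) x.1 y.1)
      map_smul' := fun e x => Subtype.ext (T.sigmaRep_smul W e x.1) }

/-- `id ⊗ f` on `L ⊗_F W`. -/
noncomputable def mapRep {W W' : Rep.{u} F G} (f : W ⟶ W') : L ⊗[F] W →ₗ[E] L ⊗[F] W' :=
  AlgebraTensorModule.map LinearMap.id f.hom.toLinearMap

theorem diagAct_mapRep {W W' : Rep.{u} F G} (f : W ⟶ W') (g : G) (x : L ⊗[F] W) :
    T.diagAct W' g (mapRep (E := E) f x) = mapRep (E := E) f (T.diagAct W g x) := by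
  induction x using TensorProduct.induction_on with
  | zero => simp
  | add x y hx hy => simp only [map_add, hx, hy]
  | tmul a m => simp [mapRep, diagAct, Rep.hom_comm_apply]

theorem sigmaRep_mapRep {W W' : Rep.{u} F G} (f : W ⟶ W') (x : L ⊗[F] W) :
    T.sigmaRep W' (mapRep (E := E) f x) = mapRep (E := E) f (T.sigmaRep W x) := by
  induction x using TensorProduct.induction_on with
  | zero => simp
  | add x y hx hy => simp only [map_add, hx, hy]
  | tmul a m => simp [mapRep, sigmaRep]

/-- The functor `W ↦ D(W) = (L ⊗_F W)^G` from representations of `G` over `F` to `φ`-modules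
over `E`. -/
noncomputable def D : Rep.{u} F G ⥤ PhiMod T.σ where
  obj W := T.invariantsPhi W
  map {W W'} f :=
    { lin :=
        { toFun := fun x => ⟨mapRep (E := E) f x.1, fun g => by
            rw [diagAct_mapRep, x.2 g]⟩
          map_add' := fun x y => Subtype.ext (map_add (mapRep (E := E) f) x.1 y.1)
          map_smul' := fun e x => Subtype.ext (map_smul (mapRep (E := E) f) e x.1) }
      comm := fun x => Subtype.ext (T.sigmaRep_mapRep f x.1).symm }
  map_id W := by
    refine PhiMod.hom_ext (LinearMap.ext fun x => Subtype.ext ?_)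
    change AlgebraTensorModule.map LinearMap.id LinearMap.id x.1 = x.1
    rw [AlgebraTensorModule.map_id]
    rfl
  map_comp {W W' W''} f g := by
    refine PhiMod.hom_ext (LinearMap.ext fun x => Subtype.ext ?_)
    change AlgebraTensorModule.map (LinearMap.id ∘ₗ LinearMap.id)
      (g.hom.toLinearMap ∘ₗ f.hom.toLinearMap) x.1 = _
    rw [AlgebraTensorModule.map_comp]
    rfl

end D

/-- A morphism `V(M) ⊗_F V(N) → V(M ⊗ N)` is the natural one if it is induced by the canonical
isomorphism `(L ⊗_E M) ⊗_L (L ⊗_E N) ≅ L ⊗_E (M ⊗_E N)`. -/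
def IsNaturalTensorMap (M N : PhiMod T.σ)
    (m : T.V.obj M ⊗ T.V.obj N ⟶ T.V.obj (M ⊗ N)) : Prop :=
  ∀ (x : T.fixed M) (y : T.fixed N),
    AlgebraTensorModule.distribBaseChange E L M N
      (show T.fixed (M ⊗ N) from m.hom (x ⊗ₜ[F] y)).1 = x.1 ⊗ₜ[L] y.1

/-- `V` as a functor from `L`-trivial `φ`-modules to representations satisfying `P`. -/
noncomputable def VRes (P : ObjectProperty (Rep.{u} F G))
    (hV : ∀ M, T.IsTrivial M → P (T.V.obj M)) :
    T.IsTrivial.FullSubcategory ⥤ P.FullSubcategory :=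
  P.lift (T.IsTrivial.ι ⋙ T.V) (fun M => hV M.obj M.property)

/-- `D` as a functor from representations satisfying `P` to `L`-trivial `φ`-modules. -/
noncomputable def DRes (P : ObjectProperty (Rep.{u} F G))
    (hD : ∀ W, P W → T.IsTrivial (T.D.obj W)) :
    P.FullSubcategory ⥤ T.IsTrivial.FullSubcategory :=
  T.IsTrivial.lift (P.ι ⋙ T.D) (fun W => hD W.obj W.property)

end SigmaTriple

/-! ### The rings `k[t]_v` and `k(t)_v` -/

section Adic

variable {Fq : Type u} [Field Fq] (v : Fq[X])

section

variable (k : Type u) [Field k] [Algebra Fq k]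

/-- The ideal of `k[t]` generated by `v`. -/
noncomputable def vIdeal : Ideal k[X] := Ideal.span {v.map (algebraMap Fq k)}

/-- `k[t]_v`, the projective limit of the rings `k[t] / v ^ n`. -/
def VInt : Type u := AdicCompletion (vIdeal v k) k[X]

noncomputable instance : CommRing (VInt v k) :=
  inferInstanceAs (CommRing (AdicCompletion (vIdeal v k) k[X]))

noncomputable instance : Algebra k[X] (VInt v k) :=
  inferInstanceAs (Algebra k[X] (AdicCompletion (vIdeal v k) k[X]))

/-- `k[t]_v` as an algebra over `F_q[t]`. -/
noncomputable instance VInt.algebraPoly : Algebra Fq[X] (VInt v k) :=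
  ((algebraMap k[X] (VInt v k)).comp (Polynomial.mapRingHom (algebraMap Fq k))).toAlgebra

/-- `k(t)_v = F_q(t) ⊗_{F_q[t]} k[t]_v`. -/
def VRat : Type u := RatFunc Fq ⊗[Fq[X]] VInt v k

noncomputable instance : CommRing (VRat v k) :=
  inferInstanceAs (CommRing (RatFunc Fq ⊗[Fq[X]] VInt v k))

/-- `k(t)_v` as an algebra over `k[t]_v`, by `a ↦ 1 ⊗ a`. -/
noncomputable instance VRat.algebraInt : Algebra (VInt v k) (VRat v k) :=
  RingHom.toAlgebra (S := VRat v k)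
    (Algebra.TensorProduct.includeRight :
      VInt v k →ₐ[Fq[X]] RatFunc Fq ⊗[Fq[X]] VInt v k).toRingHom

/-- The `v`-adic topology on `k(t)_v`: the sets `x + v ^ n k[t]_v` form a basis of neighbourhoods
of `x`. -/
instance : TopologicalSpace (VRat v k) where
  IsOpen U := ∀ x ∈ U, ∃ n : ℕ, ∀ a : VInt v k,
    x + algebraMap (VInt v k) (VRat v k) (algebraMap Fq[X] (VInt v k) (v ^ n) * a) ∈ U
  isOpen_univ _ _ := ⟨0, fun _ => trivial⟩
  isOpen_inter U U' hU hU' x hx := by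
    obtain ⟨n, hn⟩ := hU x hx.1
    obtain ⟨m, hm⟩ := hU' x hx.2
    refine ⟨n + m, fun a => ⟨?_, ?_⟩⟩
    · have := hn (algebraMap Fq[X] (VInt v k) (v ^ m) * a)
      rwa [← mul_assoc, ← map_mul, ← pow_add] at this
    · have := hm (algebraMap Fq[X] (VInt v k) (v ^ n) * a)
      rwa [← mul_assoc, ← map_mul, ← pow_add, add_comm m n] at this
  isOpen_sUnion S hS x hx := by
    obtain ⟨U, hU, hxU⟩ := hx
    obtain ⟨n, hn⟩ := hS U hU x hxU
    exact ⟨n, fun a => ⟨U, hU, hn a⟩⟩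

end

section Map

variable {k k' k'' : Type u} [Field k] [Algebra Fq k] [Field k'] [Algebra Fq k']
  [Field k''] [Algebra Fq k'']

theorem vIdeal_pow_le_comap (f : k →ₐ[Fq] k') (n : ℕ) :
    vIdeal v k ^ n ≤ (vIdeal v k' ^ n).comap (Polynomial.mapRingHom (f : k →+* k')) := by
  rw [vIdeal, vIdeal, Ideal.span_singleton_pow, Ideal.span_singleton_pow,
    Ideal.span_singleton_le_iff_mem, Ideal.mem_comap, map_pow, Polynomial.coe_mapRingHom,
    Polynomial.map_map, f.comp_algebraMap]
  exact Ideal.mem_span_singleton_self _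

/-- The map `k[t] / v ^ n → k'[t] / v ^ n` given by `f` on the coefficients. -/
noncomputable def quotMap (f : k →ₐ[Fq] k') (n : ℕ) :
    k[X] ⧸ vIdeal v k ^ n →+* k'[X] ⧸ vIdeal v k' ^ n :=
  Ideal.quotientMap _ (Polynomial.mapRingHom (f : k →+* k')) (vIdeal_pow_le_comap v f n)

/-- The projection `k[t]_v → k[t] / v ^ n`. -/
noncomputable def VInt.proj (k : Type u) [Field k] [Algebra Fq k] (n : ℕ) :
    VInt v k →+* k[X] ⧸ vIdeal v k ^ n :=
  (AdicCompletion.evalₐ (vIdeal v k) n).toRingHom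

theorem VInt.ext {x y : VInt v k} (h : ∀ n, VInt.proj v k n x = VInt.proj v k n y) : x = y :=
  AdicCompletion.ext_evalₐ (I := vIdeal v k) h

theorem VInt.proj_algebraMap (n : ℕ) (p : k[X]) :
    VInt.proj v k n (algebraMap k[X] (VInt v k) p) = Ideal.Quotient.mk _ p :=
  (AdicCompletion.evalₐ (vIdeal v k) n).commutes p

theorem VInt.factorPow_proj {m n : ℕ} (hle : m ≤ n) (x : VInt v k) :
    Ideal.Quotient.factorPow (vIdeal v k) hle (VInt.proj v k n x) = VInt.proj v k m x := by
  obtain ⟨r, rfl⟩ := AdicCompletion.mk_surjective (vIdeal v k) k[X] x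
  change Ideal.Quotient.factorPow _ hle (AdicCompletion.evalₐ _ n _) =
    AdicCompletion.evalₐ _ m _
  rw [AdicCompletion.evalₐ_mk, AdicCompletion.evalₐ_mk]
  exact (AdicCompletion.Ideal.mk_eq_mk (vIdeal v k) hle r)

theorem quotMap_mk (f : k →ₐ[Fq] k') (n : ℕ) (p : k[X]) :
    quotMap v f n (Ideal.Quotient.mk _ p) =
      Ideal.Quotient.mk _ (p.map (f : k →+* k')) := rfl

theorem VInt.map_compat (f : k →ₐ[Fq] k') {m n : ℕ} (hle : m ≤ n) :
    (Ideal.Quotient.factorPow (vIdeal v k') hle).comp ((quotMap v f n).comp (VInt.proj v k n)) =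
      (quotMap v f m).comp (VInt.proj v k m) := by
  ext x
  simp only [RingHom.comp_apply]
  rw [← VInt.factorPow_proj v hle x]
  obtain ⟨p, hp⟩ := Ideal.Quotient.mk_surjective (VInt.proj v k n x)
  rw [← hp]
  rfl

/-- The ring homomorphism `k[t]_v → k'[t]_v` given by `f` on the coefficients. -/
noncomputable def VInt.mapRing (f : k →ₐ[Fq] k') : VInt v k →+* VInt v k' :=
  AdicCompletion.liftRingHom (vIdeal v k') (fun n => (quotMap v f n).comp (VInt.proj v k n))
    (fun hle => VInt.map_compat v f hle)

theorem VInt.proj_mapRing (f : k →ₐ[Fq] k') (n : ℕ) (x : VInt v k) :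
    VInt.proj v k' n (VInt.mapRing v f x) = quotMap v f n (VInt.proj v k n x) :=
  AdicCompletion.evalₐ_liftRingHom (vIdeal v k') _ _ n x

/-- The same homomorphism, as a homomorphism of `F_q[t]`-algebras. -/
noncomputable def VInt.map (f : k →ₐ[Fq] k') : VInt v k →ₐ[Fq[X]] VInt v k' where
  __ := VInt.mapRing v f
  commutes' p := by
    refine VInt.ext v fun n => ?_
    change VInt.proj v k' n (VInt.mapRing v f (algebraMap k[X] (VInt v k) _)) =
      VInt.proj v k' n (algebraMap k'[X] (VInt v k') _)
    rw [VInt.proj_mapRing, VInt.proj_algebraMap, VInt.proj_algebraMap, quotMap_mk]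
    congr 1
    simp [Polynomial.map_map]

theorem VInt.proj_map (f : k →ₐ[Fq] k') (n : ℕ) (x : VInt v k) :
    VInt.proj v k' n (VInt.map v f x) = quotMap v f n (VInt.proj v k n x) :=
  VInt.proj_mapRing v f n x

theorem VInt.map_id : VInt.map v (AlgHom.id Fq k) = AlgHom.id _ _ := by
  refine AlgHom.ext fun x => VInt.ext v fun n => ?_
  rw [VInt.proj_map]
  obtain ⟨p, hp⟩ := Ideal.Quotient.mk_surjective (VInt.proj v k n x)
  rw [AlgHom.id_apply, ← hp, quotMap_mk]
  congr 1
  exact Polynomial.map_id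

theorem VInt.map_comp (g : k' →ₐ[Fq] k'') (f : k →ₐ[Fq] k') :
    VInt.map v (g.comp f) = (VInt.map v g).comp (VInt.map v f) := by
  refine AlgHom.ext fun x => VInt.ext v fun n => ?_
  rw [AlgHom.comp_apply, VInt.proj_map, VInt.proj_map, VInt.proj_map]
  obtain ⟨p, hp⟩ := Ideal.Quotient.mk_surjective (VInt.proj v k n x)
  rw [← hp, quotMap_mk, quotMap_mk, quotMap_mk, Polynomial.map_map]
  rfl

/-- The ring homomorphism `k(t)_v → k'(t)_v` given by `f` on the coefficients. -/
noncomputable def VRat.map (f : k →ₐ[Fq] k') : VRat v k →+* VRat v k' :=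
  (Algebra.TensorProduct.map (AlgHom.id Fq[X] (RatFunc Fq)) (VInt.map v f) :
    RatFunc Fq ⊗[Fq[X]] VInt v k →ₐ[Fq[X]] RatFunc Fq ⊗[Fq[X]] VInt v k').toRingHom

theorem VRat.map_id : VRat.map v (AlgHom.id Fq k) = RingHom.id _ := by
  refine RingHom.ext fun (x : RatFunc Fq ⊗[Fq[X]] VInt v k) => ?_
  change Algebra.TensorProduct.map (AlgHom.id Fq[X] (RatFunc Fq)) (VInt.map v _) x = x
  rw [VInt.map_id, Algebra.TensorProduct.map_id]
  rfl

theorem VRat.map_comp (g : k' →ₐ[Fq] k'') (f : k →ₐ[Fq] k') :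
    VRat.map v (g.comp f) = (VRat.map v g).comp (VRat.map v f) := by
  refine RingHom.ext fun (x : RatFunc Fq ⊗[Fq[X]] VInt v k) => ?_
  change Algebra.TensorProduct.map ((AlgHom.id Fq[X] (RatFunc Fq)).comp (AlgHom.id _ _))
    (VInt.map v _) x = _
  rw [VInt.map_comp, Algebra.TensorProduct.map_comp]
  rfl

theorem VRat.map_algebraMap (f : k →ₐ[Fq] k') (a : VInt v k) :
    VRat.map v f (algebraMap (VInt v k) (VRat v k) a) =
      algebraMap (VInt v k') (VRat v k') (VInt.map v f a) := by
  change Algebra.TensorProduct.map (AlgHom.id Fq[X] (RatFunc Fq)) (VInt.map v f)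
    ((1 : RatFunc Fq) ⊗ₜ a) = (1 : RatFunc Fq) ⊗ₜ VInt.map v f a
  simp

end Map

section Extension

variable (K Ks : Type u) [Field K] [Algebra Fq K] [Field Ks] [Algebra Fq Ks] [Algebra K Ks]
  [IsScalarTower Fq K Ks]

/-- The inclusion `K(t)_v → K'(t)_v` for a field extension `K'` of `K`. -/
noncomputable instance (priority := low) VRat.algebra : Algebra (VRat v K) (VRat v Ks) :=
  (VRat.map v (IsScalarTower.toAlgHom Fq K Ks)).toAlgebra

theorem VRat.algebraMap_eq : algebraMap (VRat v K) (VRat v Ks) =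
    VRat.map v (IsScalarTower.toAlgHom Fq K Ks) := rfl

instance : IsScalarTower (VRat v Fq) (VRat v K) (VRat v Ks) :=
  IsScalarTower.of_algebraMap_eq' (by
    rw [VRat.algebraMap_eq, VRat.algebraMap_eq, VRat.algebraMap_eq, ← VRat.map_comp]
    congr 1
    exact Subsingleton.elim _ _)

/-- A `K`-automorphism of `K'`, as a homomorphism of `F_q`-algebras. -/
def galHom (τ : Gal(Ks/K)) : Ks →ₐ[Fq] Ks := (τ : Ks →ₐ[K] Ks).restrictScalars Fq

/-- `Gal(K'/K)` acts on `K'(t)_v` through the coefficients. -/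
noncomputable instance : MulSemiringAction Gal(Ks/K) (VRat v Ks) where
  smul τ a := VRat.map v (galHom K Ks τ) a
  one_smul a := RingHom.congr_fun (VRat.map_id v) a
  mul_smul τ τ' a := RingHom.congr_fun (VRat.map_comp v (galHom K Ks τ) (galHom K Ks τ')) a
  smul_zero τ := map_zero (VRat.map v (galHom K Ks τ))
  smul_add τ := map_add (VRat.map v (galHom K Ks τ))
  smul_one τ := map_one (VRat.map v (galHom K Ks τ))
  smul_mul τ := map_mul (VRat.map v (galHom K Ks τ))

end Extension

section Frobenius

variable [Fintype Fq] (K Ks : Type u) [Field K] [Algebra Fq K] [Field Ks] [Algebra Fq Ks]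
  [Algebra K Ks] [IsScalarTower Fq K Ks]

/-- `σ` on `k[t]_v`: raise the coefficients to the power `q`. -/
noncomputable def VInt.sigma : VInt v K →+* VInt v K :=
  (VInt.map v (FiniteField.frobeniusAlgHom Fq K)).toRingHom

/-- `σ` on `k(t)_v`: raise the coefficients to the power `q`. -/
noncomputable def VRat.sigma : VRat v K →ₐ[VRat v Fq] VRat v K where
  __ := VRat.map v (FiniteField.frobeniusAlgHom Fq K)
  commutes' a := by
    change (VRat.map v (FiniteField.frobeniusAlgHom Fq K)) (VRat.map v _ a) = VRat.map v _ a
    rw [← RingHom.comp_apply, ← VRat.map_comp]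
    congr 2
    exact Subsingleton.elim _ _

theorem VRat.sigma_algebraMap (a : VInt v K) :
    (VRat.sigma v K : VRat v K →+* VRat v K) (algebraMap (VInt v K) (VRat v K) a) =
      algebraMap (VInt v K) (VRat v K) (VInt.sigma v K a) :=
  VRat.map_algebraMap v _ a

/-- The triple `F_q(t)_v → K(t)_v → K'(t)_v`, with the action of `Gal(K'/K)`. -/
noncomputable def vTriple :
    SigmaTriple (VRat v Fq) (VRat v K) (VRat v Ks) Gal(Ks/K) where
  σE := VRat.sigma v K
  σL := VRat.sigma v Ks
  σL_algebraMap e := by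
    change (VRat.map v (FiniteField.frobeniusAlgHom Fq Ks)) (VRat.map v _ e) =
      VRat.map v _ (VRat.map v (FiniteField.frobeniusAlgHom Fq K) e)
    rw [← RingHom.comp_apply, ← VRat.map_comp, ← RingHom.comp_apply, ← VRat.map_comp]
    congr 2
    ext x
    simp
  smul_algebraMap τ e := by
    change (VRat.map v (galHom K Ks τ)) (VRat.map v _ e) = VRat.map v _ e
    rw [← RingHom.comp_apply, ← VRat.map_comp]
    congr 2
    ext x
    simp [galHom]
  σL_smul τ a := by
    change (VRat.map v (FiniteField.frobeniusAlgHom Fq Ks)) (VRat.map v (galHom K Ks τ) a) =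
      VRat.map v (galHom K Ks τ) (VRat.map v (FiniteField.frobeniusAlgHom Fq Ks) a)
    rw [← RingHom.comp_apply, ← VRat.map_comp, ← RingHom.comp_apply, ← VRat.map_comp]
    congr 2
    ext x
    simp [galHom]

end Frobenius

/-- Finite-dimensional continuous representations over `F_q(t)_v`: the action `G × W → W` is
continuous for the `v`-adic topology on `W`. -/
def IsContRep (G : Type u) [Group G] [TopologicalSpace G] :
    ObjectProperty (Rep.{u} (VRat v Fq) G) := fun W =>
  Module.Finite (VRat v Fq) W ∧
    letI : TopologicalSpace W := moduleTopology (VRat v Fq) W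
    Continuous fun p : G × W => W.ρ p.1 p.2

end Adic

/-!
Write `F = F_q(t)_v`, `E = K(t)_v`, `L = K^sep(t)_v`. Everything rests on two properties of the
triple `F ⊂ E ⊂ L`, collected in `SigmaTriple.IsRegular`: `F` and `E` are fields, namely the rings
of invariants in `L` of `σ` and of the Galois group `G`, and although `L` need not be a field (`v`
splits over `K^sep`), it has no nontrivial ideals stable under `σ`, and none stable under `G`. The
rings of invariants are computed on coefficients. A stable ideal is reduced modulo `v` to a stable
ideal of `k[t]/v`; it is generated by a polynomial with invariant coefficients which divides `v`,
and `v` is irreducible over `F_q`, hence over `K` because `F_q` is algebraically closed in `K`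
(`isRegular_vTriple`).

In this situation vectors which are fixed by semilinear operators and linearly independent over
the ring of invariants remain linearly independent over `L` (`linearIndependent_of_fixed`). So the
comparison maps `L ⊗ V(M) → L ⊗ M` and `L ⊗ D(W) → L ⊗ W` are always injective; they are bijective
as soon as they are surjective, and then `W ≅ V(D(W))`, `M ≅ D(V(M))` and
`V(M) ⊗ V(N) ≅ V(M ⊗ N)` are obtained by taking invariants of isomorphisms over `L`. What remains
is to produce enough fixed vectors, which is a matter of matrices over the complete rings `k[t]_v`.

* Lang's theorem, `exists_frobenius_fixed_matrix`: over a separably closed field `k`, every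
  invertible matrix `A` over `k[t]_v` is of the form `P σ(P)⁻¹`. Modulo `v` this says that a
  Frobenius-semilinear map with surjective linearization has a basis of fixed vectors
  (`span_fixed_eq_top`), and fixed vectors are lifted by solving `A σ(x) - x = z` step by step.
  Applied to the matrix of `φ` on an étale model, it gives the triviality of `M`
  (`isTrivial_of_hasEtaleModel`).
* Hilbert's theorem 90, `exists_galois_fixed_matrix`: continuous cocycles of `G` with values in
  `GL_n(K^sep[t]_v)` are coboundaries. Modulo powers of `v` this is Galois descent for smooth
  semilinear representations, and the traces used there also lift invariant vectors. A continuous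
  representation of the compact group `G` has a stable lattice
  (`IsContRep.exists_integral_basis`), so it yields an invertible matrix `P` over `K^sep[t]_v`
  whose columns form a basis of invariants of `L ⊗ W` (`IsContRep.exists_basis_invariant`).

The second point gives the triviality of `D(W)`. Applied to `W = V(M)`, which is a continuous
representation since `G` acts continuously on the coordinates of vectors in `L ⊗ M`
(`isContRep_V`), it also gives the étale model of a trivial `M`: the columns of `P` are a basis of
`M`, in which the matrix of `φ` is `P⁻¹ σ(P)`. This matrix is invertible over `K^sep[t]_v` and has
entries in `K(t)_v`, so it is invertible over `K[t]_v` (`hasEtaleModel_of_isTrivial`).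
-/

/-! ### The rings `k[t]_v` -/

section Adic

variable {Fq : Type u} [Field Fq] (v : Fq[X])

section

variable (k : Type u) [Field k] [Algebra Fq k]

/-- The element `v` of `k[t]_v`, a uniformizer if `v` is irreducible over `k`. -/
noncomputable def VInt.unif : VInt v k := algebraMap Fq[X] (VInt v k) v

end

variable {k k' : Type u} [Field k] [Algebra Fq k] [Field k'] [Algebra Fq k']

theorem mem_vIdeal_pow {n : ℕ} {p : k[X]} :
    p ∈ vIdeal v k ^ n ↔ v.map (algebraMap Fq k) ^ n ∣ p := by
  rw [vIdeal, Ideal.span_singleton_pow, Ideal.mem_span_singleton]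

theorem VInt.proj_surjective (n : ℕ) : Function.Surjective (VInt.proj v k n) :=
  AdicCompletion.surjective_evalₐ (vIdeal v k) n

theorem VInt.proj_unif (n : ℕ) : VInt.proj v k n (VInt.unif v k) =
    Ideal.Quotient.mk _ (v.map (algebraMap Fq k)) := VInt.proj_algebraMap v n _

/-- A compatible sequence of polynomials modulo the powers of `v` defines an element of `k[t]_v`. -/
theorem VInt.exists_of_mk_compat (p : ℕ → k[X])
    (h : ∀ n, p (n + 1) - p n ∈ vIdeal v k ^ n) :
    ∃ x : VInt v k, ∀ n, VInt.proj v k n x = Ideal.Quotient.mk _ (p n) := by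
  refine ⟨AdicCompletion.mk (vIdeal v k) k[X] (AdicCompletion.AdicCauchySequence.mk _ _ p
    fun n => ?_), fun n => AdicCompletion.evalₐ_mk _ n _⟩
  rw [SModEq.sub_mem, smul_eq_mul, Ideal.mul_top, ← neg_mem_iff, neg_sub]
  exact h n

theorem VInt.exists_of_compat (y : ∀ n, k[X] ⧸ vIdeal v k ^ n)
    (h : ∀ n, Ideal.Quotient.factorPow (vIdeal v k) n.le_succ (y (n + 1)) = y n) :
    ∃ x : VInt v k, ∀ n, VInt.proj v k n x = y n := by
  choose p hp using fun n => Ideal.Quotient.mk_surjective (y n)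
  obtain ⟨x, hx⟩ := VInt.exists_of_mk_compat v p fun n => by
    rw [← Ideal.Quotient.mk_eq_mk_iff_sub_mem, hp n, ← h n, ← hp (n + 1)]
    rfl
  exact ⟨x, fun n => (hx n).trans (hp n)⟩

/-- The kernel of `k[t]_v → k[t]/v^n` is generated by `v^n`. -/
theorem VInt.proj_eq_zero_iff {n : ℕ} {x : VInt v k} :
    VInt.proj v k n x = 0 ↔ VInt.unif v k ^ n ∣ x := by
  constructor
  · intro h
    have key (I : Ideal k[X]) (hI : I.FG) (n : ℕ) (z : AdicCompletion I k[X])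
        (hz : AdicCompletion.evalₐ I n z = 0) :
        z ∈ (I ^ n • ⊤ : Submodule k[X] (AdicCompletion I k[X])) := by
      rw [AdicCompletion.pow_smul_top_eq_ker_eval hI, LinearMap.mem_ker,
        ← AdicCompletion.factor_evalₐ_eq_eval I z (by simp), hz, map_zero]
    have h1 := key _ ⟨{v.map (algebraMap Fq k)}, by simp [vIdeal]⟩ n x h
    have hI : vIdeal v k ^ n = Ideal.span {v.map (algebraMap Fq k) ^ n} := by
      rw [vIdeal, Ideal.span_singleton_pow]
    replace h1 := (congrArg (fun J : Ideal k[X] => x ∈ (J • ⊤ :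
      Submodule k[X] (AdicCompletion (vIdeal v k) k[X]))) hI).mp h1
    obtain ⟨y, -, hy⟩ := (Submodule.ideal_span_singleton_smul
      (v.map (algebraMap Fq k) ^ n) (⊤ : Submodule k[X] (AdicCompletion (vIdeal v k) k[X]))).le h1
    refine ⟨y, hy.symm.trans ?_⟩
    refine (Algebra.smul_def (A := VInt v k) _ _).trans ?_
    rw [map_pow]
    rfl
  · rintro ⟨y, rfl⟩
    rw [map_mul, map_pow, VInt.proj_unif, ← map_pow,
      Ideal.Quotient.eq_zero_iff_mem.2 ((mem_vIdeal_pow v).2 dvd_rfl), zero_mul]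

theorem VInt.eq_zero_of_forall_dvd {x : VInt v k} (h : ∀ n, VInt.unif v k ^ n ∣ x) : x = 0 :=
  VInt.ext v fun n => by rw [(VInt.proj_eq_zero_iff v).2 (h n), map_zero]

theorem VInt.map_unif (f : k →ₐ[Fq] k') : VInt.map v f (VInt.unif v k) = VInt.unif v k' :=
  (VInt.map v f).commutes v

variable {v}

/-- `v` is not a zero divisor in `k[t]_v`. -/
theorem VInt.unif_mul_eq_zero (hv : v ≠ 0) {x : VInt v k} (h : VInt.unif v k * x = 0) :
    x = 0 := by
  refine VInt.ext v fun n => ?_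
  obtain ⟨p, hp⟩ := Ideal.Quotient.mk_surjective (VInt.proj v k (n + 1) x)
  have h1 := congrArg (VInt.proj v k (n + 1)) h
  rw [map_mul, VInt.proj_unif, ← hp, ← map_mul, map_zero, Ideal.Quotient.eq_zero_iff_mem,
    mem_vIdeal_pow, pow_succ', mul_dvd_mul_iff_left (by simpa using hv)] at h1
  rw [← VInt.factorPow_proj v n.le_succ, ← hp, map_zero]
  exact Ideal.Quotient.eq_zero_iff_mem.2 ((mem_vIdeal_pow v).2 h1)

theorem VInt.unif_pow_mul_cancel (hv : v ≠ 0) (n : ℕ) {x y : VInt v k}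
    (h : VInt.unif v k ^ n * x = VInt.unif v k ^ n * y) : x = y := by
  induction n with
  | zero => simpa using h
  | succ n ih =>
    refine ih (sub_eq_zero.1 (VInt.unif_mul_eq_zero hv ?_))
    rw [mul_sub, ← mul_assoc, ← mul_assoc, ← pow_succ', h, sub_self]

/-- The units of `k[t]_v` are detected modulo `v`, by completeness. -/
theorem VInt.isUnit_iff {x : VInt v k} : IsUnit x ↔ IsUnit (VInt.proj v k 1 x) := by
  refine ⟨fun h => h.map _, fun h => ?_⟩
  obtain ⟨y, hy⟩ := VInt.proj_surjective v (k := k) 1 (h.unit⁻¹ : (k[X] ⧸ vIdeal v k ^ 1)ˣ)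
  have h1 : VInt.proj v k 1 (1 - x * y) = 0 := by
    rw [map_sub, map_one, map_mul, hy, IsUnit.mul_val_inv, sub_self]
  rw [VInt.proj_eq_zero_iff, pow_one] at h1
  obtain ⟨z, hz⟩ := h1
  have hu : ∀ n, IsUnit (VInt.proj v k n (x * y)) := fun n => by
    have : x * y = 1 - VInt.unif v k * z := by rw [← hz]; ring
    rw [this, map_sub, map_one]
    refine IsNilpotent.isUnit_one_sub ⟨n, ?_⟩
    rw [← map_pow, VInt.proj_eq_zero_iff, mul_pow]
    exact dvd_mul_right _ _
  obtain ⟨w, hw⟩ := VInt.exists_of_compat v (k := k) (fun n => ((hu n).unit⁻¹ : (_)ˣ)) fun n => by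
    rw [← Units.mul_right_inj (hu n).unit, Units.mul_inv, IsUnit.unit_spec,
      ← VInt.factorPow_proj v n.le_succ, ← map_mul, IsUnit.mul_val_inv, map_one]
  refine IsUnit.of_mul_eq_one (y * w) (VInt.ext v fun n => ?_)
  rw [← mul_assoc, map_mul, hw, IsUnit.mul_val_inv, map_one]

/-- A nonzero element of `k[t]_v` is a power of `v` times an element which is nonzero modulo `v`.
The second factor need not be a unit, since `v` need not be irreducible over `k`. -/
theorem VInt.exists_eq_unif_pow_mul {x : VInt v k} (hx : x ≠ 0) :
    ∃ (n : ℕ) (y : VInt v k), x = VInt.unif v k ^ n * y ∧ VInt.proj v k 1 y ≠ 0 := by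
  have h : ∃ n, ¬ VInt.unif v k ^ n ∣ x := by
    by_contra! h
    exact hx (VInt.eq_zero_of_forall_dvd v h)
  classical
  obtain ⟨n, hn⟩ : ∃ n, Nat.find h = n + 1 :=
    Nat.exists_eq_succ_of_ne_zero fun h0 => by
      have := Nat.find_spec h
      rw [h0] at this
      simp at this
  obtain ⟨y, hy⟩ := not_not.1 (Nat.find_min h (m := n) (by omega))
  refine ⟨n, y, hy, fun h0 => ?_⟩
  rw [VInt.proj_eq_zero_iff, pow_one] at h0
  obtain ⟨z, rfl⟩ := h0
  apply Nat.find_spec h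
  rw [hn, hy, pow_succ]
  exact ⟨z, (mul_assoc _ _ _).symm⟩

/-! ### `k(t)_v` as the localization of `k[t]_v` -/

theorem VInt.isUnit_algebraMap_of_isCoprime {p : Fq[X]} (h : IsCoprime v p) :
    IsUnit (algebraMap Fq[X] (VInt v k) p) := by
  rw [VInt.isUnit_iff]
  obtain ⟨a, b, hab⟩ := h
  refine IsUnit.of_mul_eq_one (VInt.proj v k 1 (algebraMap Fq[X] (VInt v k) b)) ?_
  rw [← map_mul, ← map_mul, mul_comm p, ← sub_eq_zero, ← map_one (VInt.proj v k 1), ← map_sub,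
    VInt.proj_eq_zero_iff, ← map_one (algebraMap Fq[X] (VInt v k)), ← map_sub, ← hab]
  exact ⟨algebraMap Fq[X] (VInt v k) (-a), by rw [pow_one, VInt.unif, ← map_mul]; congr 1; ring⟩

/-- In `k[t]_v` the nonzero elements of `F_q[t]` are powers of `v` up to units; hence `k(t)_v`
arises from `k[t]_v` by inverting `v`. -/
theorem VInt.exists_algebraMap_eq_unif_pow_mul (hirr : Irreducible v) {p : Fq[X]} (hp : p ≠ 0) :
    ∃ n, ∃ w : VInt v k, IsUnit w ∧ algebraMap Fq[X] (VInt v k) p = VInt.unif v k ^ n * w := by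
  obtain ⟨n, r, hr, rfl⟩ :=
    WfDvdMonoid.max_power_factor hp hirr
  refine ⟨n, algebraMap Fq[X] (VInt v k) r, VInt.isUnit_algebraMap_of_isCoprime ?_, ?_⟩
  · exact (Irreducible.coprime_iff_not_dvd hirr).2 hr
  · rw [map_mul, map_pow]; rfl

instance VRat.isLocalization : IsLocalization
    (Algebra.algebraMapSubmonoid (VInt v k) (nonZeroDivisors Fq[X])) (VRat v k) :=
  IsLocalization.tensorRight (R := Fq[X]) (A := RatFunc Fq) (S := VInt v k) (nonZeroDivisors Fq[X])

variable (v k) in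
/-- The element `v` of `k(t)_v`. -/
noncomputable def VRat.unif : VRat v k := algebraMap (VInt v k) (VRat v k) (VInt.unif v k)

theorem VRat.algebraMap_injective (hirr : Irreducible v) :
    Function.Injective (algebraMap (VInt v k) (VRat v k)) := by
  refine IsLocalization.injective (VRat v k)
    (M := Algebra.algebraMapSubmonoid (VInt v k) (nonZeroDivisors Fq[X])) ?_
  rintro _ ⟨p, hp, rfl⟩
  obtain ⟨n, w, hw, h⟩ :=
    VInt.exists_algebraMap_eq_unif_pow_mul (k := k) hirr (nonZeroDivisors.ne_zero hp)
  rw [h]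
  refine mul_mem (pow_mem ?_ n) hw.mem_nonZeroDivisors
  rw [mem_nonZeroDivisors_iff_right]
  intro x hx
  exact VInt.unif_mul_eq_zero hirr.ne_zero (by rwa [mul_comm])

theorem VRat.isUnit_unif (hv : v ≠ 0) : IsUnit (VRat.unif v k) :=
  IsLocalization.map_units (M := Algebra.algebraMapSubmonoid (VInt v k) (nonZeroDivisors Fq[X]))
    (VRat v k) ⟨VInt.unif v k, v, mem_nonZeroDivisors_of_ne_zero hv, rfl⟩

theorem VRat.exists_unif_pow_mul_eq (hirr : Irreducible v) (x : VRat v k) :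
    ∃ (n : ℕ) (a : VInt v k), VRat.unif v k ^ n * x = algebraMap (VInt v k) (VRat v k) a := by
  obtain ⟨⟨a, ⟨_, p, hp, rfl⟩⟩, h⟩ := IsLocalization.surj
    (Algebra.algebraMapSubmonoid (VInt v k) (nonZeroDivisors Fq[X])) x
  obtain ⟨n, w, hw, h1⟩ :=
    VInt.exists_algebraMap_eq_unif_pow_mul (k := k) hirr (nonZeroDivisors.ne_zero hp)
  refine ⟨n, (hw.unit⁻¹ : (VInt v k)ˣ) * a, ?_⟩
  have h2 : x * algebraMap (VInt v k) (VRat v k) (algebraMap Fq[X] (VInt v k) p) =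
    algebraMap (VInt v k) (VRat v k) a := h
  rw [map_mul, ← h2, h1, map_mul, map_pow]
  have h3 : algebraMap (VInt v k) (VRat v k) w *
      algebraMap _ _ ((hw.unit⁻¹ : (VInt v k)ˣ) : VInt v k) = 1 := by
    rw [← map_mul, IsUnit.mul_val_inv, map_one]
  unfold VRat.unif
  linear_combination (-(x * algebraMap (VInt v k) (VRat v k) (VInt.unif v k) ^ n)) * h3

theorem VRat.map_unif (f : k →ₐ[Fq] k') : VRat.map v f (VRat.unif v k) = VRat.unif v k' := by
  rw [VRat.unif, VRat.map_algebraMap, VInt.map_unif]; rfl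

theorem VRat.unif_pow_mul_cancel (hv : v ≠ 0) (n : ℕ) {x y : VRat v k}
    (h : VRat.unif v k ^ n * x = VRat.unif v k ^ n * y) : x = y :=
  ((VRat.isUnit_unif hv).pow n).mul_left_cancel h

end Adic

section Adic

variable {Fq : Type u} [Field Fq] {v : Fq[X]}

variable {k k' : Type u} [Field k] [Algebra Fq k] [Field k'] [Algebra Fq k']

/-! ### Injectivity and descent of coefficients -/

theorem map_mem_vIdeal_pow (f : k →ₐ[Fq] k') {n : ℕ} {p : k[X]} :
    p.map (f : k →+* k') ∈ vIdeal v k' ^ n ↔ p ∈ vIdeal v k ^ n := by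
  rw [mem_vIdeal_pow, mem_vIdeal_pow, ← f.comp_algebraMap, ← Polynomial.map_map,
    ← Polynomial.map_pow]
  exact Polynomial.map_dvd_map' _

theorem quotMap_injective (f : k →ₐ[Fq] k') (n : ℕ) : Function.Injective (quotMap v f n) := by
  rw [injective_iff_map_eq_zero]
  intro x hx
  obtain ⟨p, rfl⟩ := Ideal.Quotient.mk_surjective x
  rw [quotMap_mk, Ideal.Quotient.eq_zero_iff_mem, map_mem_vIdeal_pow] at hx
  exact Ideal.Quotient.eq_zero_iff_mem.2 hx

/-- The `v`-adic filtration of `k[t]_v` is induced by that of `k'[t]_v`. -/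
theorem VInt.unif_pow_dvd_map_iff (f : k →ₐ[Fq] k') {n : ℕ} {x : VInt v k} :
    VInt.unif v k' ^ n ∣ VInt.map v f x ↔ VInt.unif v k ^ n ∣ x := by
  rw [← VInt.proj_eq_zero_iff, ← VInt.proj_eq_zero_iff, VInt.proj_map,
    map_eq_zero_iff _ (quotMap_injective f n)]

/-- An element of `k(t)_v` which is integral over a larger field of coefficients is integral. -/
theorem VRat.mem_range_of_map_mem_range (hirr : Irreducible v) (f : k →ₐ[Fq] k') {x : VRat v k}
    {a : VInt v k'} (h : VRat.map v f x = algebraMap _ _ a) :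
    ∃ b : VInt v k, algebraMap _ _ b = x ∧ VInt.map v f b = a := by
  obtain ⟨n, c, hc⟩ := VRat.exists_unif_pow_mul_eq hirr x
  have h1 := congrArg (VRat.map v f) hc
  rw [map_mul, map_pow, VRat.map_unif, h, VRat.map_algebraMap, VRat.unif, ← map_pow,
    ← map_mul] at h1
  replace h1 := VRat.algebraMap_injective hirr h1
  obtain ⟨b, rfl⟩ := (VInt.unif_pow_dvd_map_iff f).1 ⟨a, h1.symm⟩
  rw [map_mul, map_pow, VInt.map_unif] at h1
  refine ⟨b, VRat.unif_pow_mul_cancel hirr.ne_zero n ?_,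
    (VInt.unif_pow_mul_cancel hirr.ne_zero n h1).symm⟩
  rw [hc, map_mul, map_pow]
  rfl

/-! ### Rings of invariants and stable ideals -/

section Fixed

-- In what follows `f` is a family of endomorphisms of `k`, and the hypothesis `hf` says that its
-- fixed field is contained in `k₀`.
variable {k₀ : Type u} [Field k₀] [Algebra Fq k₀] [Algebra k₀ k] [IsScalarTower Fq k₀ k]
  {ι : Type w} (f : ι → k →ₐ[Fq] k)

omit [Algebra Fq k₀] [IsScalarTower Fq k₀ k] in
theorem Polynomial.exists_map_eq_of_fixed
    (hf : ∀ x, (∀ i, f i x = x) → x ∈ Set.range (algebraMap k₀ k)) {p : k[X]}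
    (hp : ∀ i, p.map (f i : k →+* k) = p) : ∃ r : k₀[X], r.map (algebraMap k₀ k) = p := by
  refine (Polynomial.mem_lifts p).1
    ((Polynomial.lifts_iff_coeff_lifts p).2 fun n => hf _ fun i => ?_)
  conv_rhs => rw [← hp i, Polynomial.coeff_map]
  rfl

variable {f}

omit [Algebra Fq k₀] [IsScalarTower Fq k₀ k] in
/-- The elements of `k[t]/v^n` with invariant coefficients come from polynomials over `k₀`. -/
theorem quot_exists_map_eq_of_fixed (hmonic : v.Monic)
    (hf : ∀ x, (∀ i, f i x = x) → x ∈ Set.range (algebraMap k₀ k)) {n : ℕ}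
    {x : k[X] ⧸ vIdeal v k ^ n} (hx : ∀ i, quotMap v (f i) n x = x) :
    ∃ r : k₀[X], Ideal.Quotient.mk _ (r.map (algebraMap k₀ k)) = x := by
  have hm : (v.map (algebraMap Fq k) ^ n).Monic := (hmonic.map _).pow n
  -- the representative of least degree is unique, so it has fixed coefficients
  obtain ⟨p, hp, hp'⟩ : ∃ p : k[X], Ideal.Quotient.mk _ p = x ∧
      p %ₘ (v.map (algebraMap Fq k) ^ n) = p := by
    obtain ⟨p, hp⟩ := Ideal.Quotient.mk_surjective x
    refine ⟨p %ₘ (v.map (algebraMap Fq k) ^ n), ?_, ?_⟩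
    · rw [← hp, Ideal.Quotient.mk_eq_mk_iff_sub_mem, mem_vIdeal_pow]
      exact ⟨-(p /ₘ (v.map (algebraMap Fq k) ^ n)), by
        linear_combination Polynomial.modByMonic_add_div p (v.map (algebraMap Fq k) ^ n)⟩
    · rw [Polynomial.modByMonic_eq_self_iff hm]
      exact Polynomial.degree_modByMonic_lt _ hm
  obtain ⟨r, rfl⟩ : ∃ r : k₀[X], r.map (algebraMap k₀ k) = p := by
    refine Polynomial.exists_map_eq_of_fixed f hf fun i => ?_
    have h3 : (v.map (algebraMap Fq k) ^ n) ∣ (p.map (f i : k →+* k) - p) := by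
      rw [← mem_vIdeal_pow, ← Ideal.Quotient.mk_eq_mk_iff_sub_mem, ← quotMap_mk, hp, hx]
    have h4 : (v.map (algebraMap Fq k) ^ n).map (f i : k →+* k) = v.map (algebraMap Fq k) ^ n := by
      rw [Polynomial.map_pow, Polynomial.map_map, (f i).comp_algebraMap]
    rw [← Polynomial.modByMonic_eq_zero_iff_dvd hm, Polynomial.sub_modByMonic, hp',
      sub_eq_zero] at h3
    have h5 := Polynomial.map_modByMonic (f i : k →+* k) hm (p := p)
    rwa [hp', h4, h3] at h5
  exact ⟨r, hp⟩

theorem VInt.exists_map_eq_of_fixed (hmonic : v.Monic)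
    (hf : ∀ x, (∀ i, f i x = x) → x ∈ Set.range (algebraMap k₀ k)) {x : VInt v k}
    (hx : ∀ i, VInt.map v (f i) x = x) :
    ∃ y : VInt v k₀, VInt.map v (IsScalarTower.toAlgHom Fq k₀ k) y = x := by
  choose r hr using fun n => quot_exists_map_eq_of_fixed hmonic hf (x := VInt.proj v k n x)
    fun i => by rw [← VInt.proj_map, hx]
  obtain ⟨y, hy⟩ := VInt.exists_of_mk_compat v (k := k₀) r fun n => by
    rw [← map_mem_vIdeal_pow (IsScalarTower.toAlgHom Fq k₀ k)]
    change (r (n + 1) - r n).map (algebraMap k₀ k) ∈ _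
    rw [Polynomial.map_sub, ← Ideal.Quotient.mk_eq_mk_iff_sub_mem, hr n,
      ← VInt.factorPow_proj v n.le_succ, ← hr (n + 1)]
    rfl
  refine ⟨y, VInt.ext v fun n => ?_⟩
  rw [VInt.proj_map, hy, quotMap_mk]
  exact hr n

theorem VRat.exists_map_eq_of_fixed (hmonic : v.Monic) (hirr : Irreducible v)
    (hf : ∀ x, (∀ i, f i x = x) → x ∈ Set.range (algebraMap k₀ k)) {x : VRat v k}
    (hx : ∀ i, VRat.map v (f i) x = x) :
    x ∈ Set.range (algebraMap (VRat v k₀) (VRat v k)) := by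
  obtain ⟨n, a, ha⟩ := VRat.exists_unif_pow_mul_eq hirr x
  obtain ⟨b, rfl⟩ := VInt.exists_map_eq_of_fixed hmonic hf (x := a) fun i =>
    VRat.algebraMap_injective hirr <| by
      rw [← VRat.map_algebraMap, ← ha, map_mul, map_pow, VRat.map_unif, hx]
  obtain ⟨e, he⟩ := (VRat.isUnit_unif (k := k₀) hirr.ne_zero).pow n
  refine ⟨(e⁻¹ : (VRat v k₀)ˣ) * algebraMap _ _ b, VRat.unif_pow_mul_cancel hirr.ne_zero n ?_⟩
  rw [VRat.algebraMap_eq, ha, ← VRat.map_unif (IsScalarTower.toAlgHom Fq k₀ k), ← map_pow,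
    ← map_mul, ← mul_assoc, ← he, Units.mul_inv, one_mul, VRat.map_algebraMap]

/-- The residue ring `k[t] / v` has no stable ideals: the monic generator of the preimage of such
an ideal in `k[t]` is a divisor of `v` with coefficients in the fixed field `k₀`. -/
theorem quot_eq_bot_or_eq_top (hmonic : v.Monic)
    (hf : ∀ x, (∀ i, f i x = x) → x ∈ Set.range (algebraMap k₀ k))
    (hk₀ : Irreducible (v.map (algebraMap Fq k₀)))
    (I : Ideal (k[X] ⧸ vIdeal v k ^ 1))
    (hI : ∀ i, ∀ x ∈ I, quotMap v (f i) 1 x ∈ I) : I = ⊥ ∨ I = ⊤ := by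
  set J := I.comap (Ideal.Quotient.mk (vIdeal v k ^ 1)) with hJ
  have hvJ : v.map (algebraMap Fq k) ∈ J := by
    rw [hJ, Ideal.mem_comap, Ideal.Quotient.eq_zero_iff_mem.2 ((mem_vIdeal_pow v).2 (by simp))]
    exact I.zero_mem
  obtain ⟨g, hg⟩ := (inferInstance : J.IsPrincipal)
  replace hg : J = Ideal.span {g} := hg
  have hg0 : g ≠ 0 := by
    rintro rfl
    rw [hg, Ideal.mem_span_singleton, zero_dvd_iff] at hvJ
    exact (hmonic.map (algebraMap Fq k)).ne_zero hvJ
  obtain ⟨g, hg, hgm⟩ : ∃ g, J = Ideal.span {g} ∧ g.Monic := by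
    refine ⟨g * C g.leadingCoeff⁻¹, ?_, Polynomial.monic_mul_leadingCoeff_inv hg0⟩
    rw [hg, Ideal.span_singleton_mul_right_unit]
    exact (Polynomial.isUnit_C).2 (by simpa using hg0)
  have hfix (i : ι) : g.map (f i : k →+* k) = g := by
    have h1 : g.map (f i : k →+* k) ∈ J := by
      rw [hJ, Ideal.mem_comap, ← quotMap_mk]
      refine hI i _ (Ideal.mem_comap.1 (?_ : g ∈ J))
      rw [hg]
      exact Ideal.mem_span_singleton_self g
    rw [hg, Ideal.mem_span_singleton] at h1
    exact Polynomial.eq_of_monic_of_dvd_of_natDegree_le hgm (hgm.map _) h1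
      Polynomial.natDegree_map_le
  obtain ⟨r, rfl⟩ := Polynomial.exists_map_eq_of_fixed f hf hfix
  rw [hg, Ideal.mem_span_singleton, IsScalarTower.algebraMap_eq Fq k₀ k, ← Polynomial.map_map,
    Polynomial.map_dvd_map'] at hvJ
  rcases hk₀.dvd_iff.1 hvJ with h | h
  · right
    refine Ideal.comap_injective_of_surjective _ Ideal.Quotient.mk_surjective ?_
    rw [Ideal.comap_top, ← hJ, hg]
    exact Ideal.span_singleton_eq_top.2 (h.map (Polynomial.mapRingHom (algebraMap k₀ k)))
  · left
    rw [eq_bot_iff]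
    intro x hx
    obtain ⟨p, rfl⟩ := Ideal.Quotient.mk_surjective x
    have h2 : p ∈ J := hx
    rw [hg, Ideal.mem_span_singleton] at h2
    refine Ideal.Quotient.eq_zero_iff_mem.2 ((mem_vIdeal_pow v).2 ?_)
    rw [pow_one, IsScalarTower.algebraMap_eq Fq k₀ k, ← Polynomial.map_map]
    exact (Polynomial.map_dvd _ h.dvd).trans h2

/-- `k(t)_v` has no stable ideals, since this holds modulo `v`. -/
theorem VRat.eq_bot_or_eq_top (hmonic : v.Monic) (hirr : Irreducible v)
    (hf : ∀ x, (∀ i, f i x = x) → x ∈ Set.range (algebraMap k₀ k))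
    (hk₀ : Irreducible (v.map (algebraMap Fq k₀)))
    (I : Ideal (VRat v k)) (hI : ∀ i, ∀ x ∈ I, VRat.map v (f i) x ∈ I) : I = ⊥ ∨ I = ⊤ := by
  by_contra! h
  obtain ⟨x, hx, hx0⟩ := Submodule.exists_mem_ne_zero_of_ne_bot h.1
  obtain ⟨n, a, ha⟩ := VRat.exists_unif_pow_mul_eq hirr x
  have ha0 : a ≠ 0 := by
    rintro rfl
    exact hx0 (VRat.unif_pow_mul_cancel hirr.ne_zero n (by rw [ha, map_zero, mul_zero]))
  obtain ⟨m, b, rfl, hb⟩ := VInt.exists_eq_unif_pow_mul ha0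
  set J := I.comap (algebraMap (VInt v k) (VRat v k)) with hJ
  have hbJ : b ∈ J := by
    rw [hJ, Ideal.mem_comap, ← Ideal.unit_mul_mem_iff_mem I
      ((VRat.isUnit_unif (k := k) hirr.ne_zero).pow m)]
    have h1 : VRat.unif v k ^ m * algebraMap (VInt v k) (VRat v k) b = VRat.unif v k ^ n * x := by
      rw [ha, map_mul, map_pow]; rfl
    rw [h1]
    exact I.mul_mem_left _ hx
  rcases quot_eq_bot_or_eq_top hmonic hf hk₀ (J.map (VInt.proj v k 1)) (fun i y hy => by
    obtain ⟨z, hz, rfl⟩ := (Ideal.mem_map_iff_of_surjective _ (VInt.proj_surjective v 1)).1 hy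
    rw [← VInt.proj_map]
    refine Ideal.mem_map_of_mem _ ?_
    rw [hJ, Ideal.mem_comap, ← VRat.map_algebraMap]
    exact hI i _ hz) with h2 | h2
  · apply hb
    have := Ideal.mem_map_of_mem (VInt.proj v k 1) hbJ
    rwa [h2] at this
  · obtain ⟨c, hc, hc1⟩ := (Ideal.mem_map_iff_of_surjective _ (VInt.proj_surjective v 1)).1
      (h2 ▸ Submodule.mem_top : (1 : k[X] ⧸ vIdeal v k ^ 1) ∈ J.map (VInt.proj v k 1))
    have hu : IsUnit c := VInt.isUnit_iff.2 (hc1 ▸ isUnit_one)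
    exact h.2 (I.eq_top_of_isUnit_mem hc (hu.map _))

end Fixed

theorem quot_nontrivial (hirr : Irreducible v) :
    Nontrivial (k[X] ⧸ vIdeal v k ^ 1) := by
  rw [Ideal.Quotient.nontrivial_iff, pow_one, vIdeal, Ne, Ideal.span_singleton_eq_top]
  intro h
  have := Polynomial.degree_eq_zero_of_isUnit h
  rw [Polynomial.degree_map] at this
  exact hirr.not_isUnit (Polynomial.isUnit_iff_degree_eq_zero.2 this)

theorem VInt.nontrivial (hirr : Irreducible v) : Nontrivial (VInt v k) :=
  have := quot_nontrivial (k := k) hirr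
  (VInt.proj v k 1).domain_nontrivial

theorem VRat.nontrivial (hirr : Irreducible v) : Nontrivial (VRat v k) :=
  have := VInt.nontrivial (k := k) hirr
  (VRat.algebraMap_injective (k := k) hirr).nontrivial

/-- If `v` stays irreducible over `k`, then `k(t)_v` is a field. -/
theorem VRat.isField (hmonic : v.Monic) (hirr : Irreducible v)
    (hk : Irreducible (v.map (algebraMap Fq k))) : IsField (VRat v k) := by
  have := VRat.nontrivial (k := k) hirr
  refine ⟨exists_pair_ne _, mul_comm, fun {a} ha => ?_⟩
  have h := VRat.eq_bot_or_eq_top (k := k) (k₀ := k) (ι := PEmpty.{1}) (f := PEmpty.elim) hmonic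
    hirr (fun x _ => ⟨x, rfl⟩) hk (Ideal.span {a}) (fun i => i.elim)
  rw [Ideal.span_singleton_eq_bot, Ideal.span_singleton_eq_top] at h
  exact (h.resolve_left ha).exists_right_inv

/-- If `v` stays irreducible over `k`, then `k[t]_v` is a discrete valuation ring. -/
theorem VInt.isDiscreteValuationRing (hmonic : v.Monic) (hirr : Irreducible v)
    (hk : Irreducible (v.map (algebraMap Fq k))) :
    ∃ _ : IsDomain (VInt v k), IsDiscreteValuationRing (VInt v k) := by
  have hdom : IsDomain (VInt v k) := by
    let := (VRat.isField hmonic hirr hk).toField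
    exact (VRat.algebraMap_injective (k := k) hirr).isDomain
      (algebraMap (VInt v k) (VRat v k))
  have hunit (y : VInt v k) (hy : VInt.proj v k 1 y ≠ 0) : IsUnit y := by
    have h := quot_eq_bot_or_eq_top (k := k) (k₀ := k) (ι := PEmpty.{1}) (f := PEmpty.elim) hmonic
      (fun x _ => ⟨x, rfl⟩) hk (Ideal.span {VInt.proj v k 1 y}) (fun i => i.elim)
    rw [Ideal.span_singleton_eq_bot, Ideal.span_singleton_eq_top] at h
    exact VInt.isUnit_iff.2 (h.resolve_left hy)
  refine ⟨hdom, IsDiscreteValuationRing.ofHasUnitMulPowIrreducibleFactorization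
    ⟨VInt.unif v k, ?_, fun {x} hx => ?_⟩⟩
  · have := quot_nontrivial (k := k) hirr
    have h0 : VInt.proj v k 1 (VInt.unif v k) = 0 := by
      rw [VInt.proj_eq_zero_iff, pow_one]
    refine ⟨fun h => ?_, fun a b hab => ?_⟩
    · have := (VInt.isUnit_iff.1 h).ne_zero
      exact this h0
    · by_contra! h
      have ha : VInt.proj v k 1 a = 0 := by_contra fun h' => h.1 (hunit a h')
      have hb : VInt.proj v k 1 b = 0 := by_contra fun h' => h.2 (hunit b h')
      rw [VInt.proj_eq_zero_iff, pow_one] at ha hb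
      obtain ⟨a, rfl⟩ := ha
      obtain ⟨b, rfl⟩ := hb
      have h1 : VInt.unif v k ^ 1 * (1 : VInt v k) =
          VInt.unif v k ^ 1 * (VInt.unif v k * (a * b)) := by
        rw [pow_one, mul_one]
        linear_combination hab
      have h2 := congrArg (VInt.proj v k 1) (VInt.unif_pow_mul_cancel hirr.ne_zero 1 h1)
      rw [map_one, map_mul, h0, zero_mul] at h2
      exact one_ne_zero h2
  · obtain ⟨n, y, rfl, hy⟩ := VInt.exists_eq_unif_pow_mul hx
    exact ⟨n, associated_mul_unit_right _ _ (hunit y hy)⟩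

end Adic

/-! ### Linear independence of fixed vectors -/

/-- Let `s i` be endomorphisms of a ring `L` with invariants in the image of `F`, for which `L` has
no nontrivial stable ideals. Then common fixed vectors of `s i`-semilinear operators `Φ i` which are
linearly independent over `F` are linearly independent over `L`.

As in Artin's lemma, the stable ideal of the possible coefficients of one vector in the relations
among given vectors allows one to normalize a relation so that it has a coefficient `1`; by
minimality its coefficients are then invariant. -/
theorem linearIndependent_of_fixed {F L N α : Type*} {ι : Type*} [CommRing F] [CommRing L]
    [Algebra F L] [AddCommGroup N] [Module L N] [Module F N] [IsScalarTower F L N]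
    (s : ι → L →+* L) (Φ : ι → N →+ N) (hΦ : ∀ i (l : L) (x : N), Φ i (l • x) = s i l • Φ i x)
    (hfix : ∀ l, (∀ i, s i l = l) → l ∈ Set.range (algebraMap F L))
    (hsimple : ∀ I : Ideal L, (∀ i, ∀ x ∈ I, s i x ∈ I) → I = ⊥ ∨ I = ⊤) [Nontrivial F]
    {x : α → N} (hx : ∀ i j, Φ i (x j) = x j) (hli : LinearIndependent F x) :
    LinearIndependent L x := by
  classical
  rw [linearIndependent_iff']
  intro t
  induction t using Finset.induction_on with
  | empty => simp
  | insert a t ha ih =>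
    -- the ideal of all coefficients of `x a` in relations supported on `insert a t`
    let I : Ideal L :=
      { carrier := {c | ∃ l : α → L, c • x a + ∑ j ∈ t, l j • x j = 0}
        zero_mem' := ⟨0, by simp⟩
        add_mem' := by
          rintro c c' ⟨l, hl⟩ ⟨l', hl'⟩
          refine ⟨l + l', ?_⟩
          simp only [Pi.add_apply, add_smul, Finset.sum_add_distrib]
          rw [add_add_add_comm, hl, hl', add_zero]
        smul_mem' := by
          rintro b c ⟨l, hl⟩
          refine ⟨b • l, ?_⟩
          simp only [Pi.smul_apply, smul_eq_mul, mul_smul, ← Finset.smul_sum]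
          rw [← smul_add, hl, smul_zero] }
    have hmap (i : ι) (c : L) (l : α → L) (h : c • x a + ∑ j ∈ t, l j • x j = 0) :
        s i c • x a + ∑ j ∈ t, s i (l j) • x j = 0 := by
      have := congrArg (Φ i) h
      simpa only [map_add, map_sum, hΦ, hx, map_zero] using this
    rcases hsimple I (by
      rintro i c ⟨l, hl⟩
      exact ⟨fun j => s i (l j), hmap i c l hl⟩) with hI | hI
    · intro l hl
      rw [Finset.sum_insert ha] at hl
      have h0 : l a = 0 := by
        have : l a ∈ I := ⟨l, hl⟩
        rwa [hI, Ideal.mem_bot] at this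
      rw [h0, zero_smul, zero_add] at hl
      intro j hj
      rcases Finset.mem_insert.1 hj with rfl | hj
      · exact h0
      · exact ih l hl j hj
    · exfalso
      obtain ⟨l, hl⟩ : (1 : L) ∈ I := hI ▸ Submodule.mem_top
      have hl' : ∀ j, ∃ c : F, j ∈ t → algebraMap F L c = l j := fun j => by
        by_cases hj : j ∈ t
        · obtain ⟨c, hc⟩ := hfix (l j) fun i => by
            have h1 := hmap i 1 l hl
            rw [map_one] at h1
            have h2 : ∑ j ∈ t, (s i (l j) - l j) • x j = 0 := by
              simp only [sub_smul, Finset.sum_sub_distrib]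
              rw [← add_sub_add_left_eq_sub _ _ ((1 : L) • x a), h1, hl, sub_zero]
            exact sub_eq_zero.1 (ih _ h2 j hj)
          exact ⟨c, fun _ => hc⟩
        · exact ⟨0, fun h => absurd h hj⟩
      choose c hc using hl'
      have h3 : ∑ j ∈ insert a t, (if j = a then 1 else c j) • x j = 0 := by
        rw [Finset.sum_insert ha, if_pos rfl, ← hl, one_smul, one_smul]
        congr 1
        refine Finset.sum_congr rfl fun j hj => ?_
        rw [if_neg (by rintro rfl; exact ha hj), ← hc j hj, algebraMap_smul]
      have h4 := linearIndependent_iff'.1 hli _ _ h3 a (Finset.mem_insert_self a t)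
      rw [if_pos rfl] at h4
      exact one_ne_zero h4

/-! ### Frobenius-semilinear maps over a separably closed field -/

section Frobenius

variable (Fq : Type*) [Field Fq] [Fintype Fq] {k : Type*} [Field k] [Algebra Fq k]

local notation "q" => Fintype.card Fq

theorem cast_card_eq_zero_of_algebra : (q : k) = 0 := by
  rw [← map_natCast (algebraMap Fq k), FiniteField.cast_card_eq_zero, map_zero]

/-- The Artin–Schreier equation. -/
theorem exists_pow_card_sub_self_eq [IsSepClosed k] (c : k) : ∃ y : k, y ^ q - y = c := by
  have h2 : 1 < q := Fintype.one_lt_card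
  have hdeg : ((X ^ q - X - C c : k[X])).natDegree = q := by
    rw [sub_sub, Polynomial.natDegree_sub_eq_left_of_natDegree_lt, Polynomial.natDegree_X_pow]
    rw [Polynomial.natDegree_X_pow, Polynomial.natDegree_X_add_C]
    exact h2
  obtain ⟨y, hy⟩ := IsSepClosed.exists_root (X ^ q - X - C c : k[X])
    (fun h => by
      rw [Polynomial.natDegree_eq_zero_iff_degree_le_zero.2 h.le] at hdeg
      omega)
    (by
      rw [Polynomial.separable_def]
      refine ⟨0, -1, ?_⟩
      simp [Polynomial.derivative_X_pow, cast_card_eq_zero_of_algebra Fq])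
  refine ⟨y, ?_⟩
  rw [Polynomial.IsRoot.def] at hy
  simpa [sub_eq_zero] using hy

variable {V : Type*} [AddCommGroup V] [Module k V]

/-- Let `Φ` be a Frobenius-semilinear map with `Φ (e i) = e (i + 1)` for `i < m` and
`Φ (e m) = ∑ i ≤ m, a i • e i`. The vector `∑ i ≤ m, y i • e i` is fixed by `Φ` if each `y i` is the
value of `cyclicPoly a i` at `y m`; for `i = m` this is an equation for `y m`. -/
noncomputable def cyclicPoly (a : ℕ → k) : ℕ → k[X]
  | 0 => C (a 0) * X ^ q
  | n + 1 => cyclicPoly a n ^ q + C (a (n + 1)) * X ^ q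

omit [Algebra Fq k] in
theorem X_pow_dvd_cyclicPoly (a : ℕ → k) (n : ℕ) : X ^ q ∣ cyclicPoly Fq a n := by
  induction n with
  | zero => exact dvd_mul_left _ _
  | succ n ih => exact dvd_add (ih.trans (dvd_pow_self _ Fintype.card_ne_zero)) (dvd_mul_left _ _)

theorem derivative_cyclicPoly (a : ℕ → k) (n : ℕ) : derivative (cyclicPoly Fq a n) = 0 := by
  cases n <;> simp [cyclicPoly, Polynomial.derivative_pow, cast_card_eq_zero_of_algebra Fq]

omit [Algebra Fq k] in
theorem cyclicPoly_ne_zero {a : ℕ → k} {n : ℕ} (h : ∃ i ≤ n, a i ≠ 0) :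
    cyclicPoly Fq a n ≠ 0 := by
  have h2 : 1 < q := Fintype.one_lt_card
  induction n with
  | zero =>
    obtain ⟨i, hi, h⟩ := h
    obtain rfl : i = 0 := by omega
    simpa [cyclicPoly] using h
  | succ n ih =>
    intro h0
    rw [cyclicPoly] at h0
    by_cases hn : cyclicPoly Fq a n = 0
    · obtain ⟨i, hi, h⟩ := h
      rcases Nat.le_succ_iff.1 hi with hi | rfl
      · exact ih ⟨i, hi, h⟩ hn
      · rw [hn, zero_pow Fintype.card_ne_zero] at h0
        simp [h] at h0
    · have h1 : q ≤ (cyclicPoly Fq a n).natDegree := by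
        have := Polynomial.natDegree_le_of_dvd (X_pow_dvd_cyclicPoly Fq a n) hn
        rwa [Polynomial.natDegree_X_pow] at this
      have h3 := congrArg Polynomial.natDegree (eq_neg_of_add_eq_zero_left h0)
      rw [Polynomial.natDegree_pow, Polynomial.natDegree_neg] at h3
      have h4 := Polynomial.natDegree_C_mul_X_pow_le (a (n + 1)) q
      rw [← h3] at h4
      nlinarith

/-- If the coefficients `a 0, …, a n` do not all vanish, then `cyclicPoly Fq a n - X` is a separable
polynomial of degree at least `q`, so that it has a nonzero root. -/
theorem exists_root_cyclicPoly [IsSepClosed k] {a : ℕ → k} {n : ℕ} (h : ∃ i ≤ n, a i ≠ 0) :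
    ∃ x : k, x ≠ 0 ∧ (cyclicPoly Fq a n).eval x = x := by
  have h2 : 1 < q := Fintype.one_lt_card
  obtain ⟨Q, hQ⟩ : X ∣ cyclicPoly Fq a n - X :=
    dvd_sub ((dvd_pow_self _ Fintype.card_ne_zero).trans (X_pow_dvd_cyclicPoly Fq a n)) dvd_rfl
  have hsep : (cyclicPoly Fq a n - X).Separable := by
    rw [Polynomial.separable_def]
    exact ⟨0, -1, by simp [derivative_cyclicPoly]⟩
  have h1 : q ≤ (cyclicPoly Fq a n).natDegree := by
    have := Polynomial.natDegree_le_of_dvd (X_pow_dvd_cyclicPoly Fq a n) (cyclicPoly_ne_zero Fq h)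
    rwa [Polynomial.natDegree_X_pow] at this
  have hdeg : (cyclicPoly Fq a n - X).natDegree = (cyclicPoly Fq a n).natDegree := by
    rw [Polynomial.natDegree_sub_eq_left_of_natDegree_lt]
    rw [Polynomial.natDegree_X]
    omega
  have hQ0 : Q ≠ 0 := by
    rintro rfl
    rw [hQ, mul_zero, Polynomial.natDegree_zero] at hdeg
    omega
  obtain ⟨x, hx⟩ := IsSepClosed.exists_root Q (fun h => by
    rw [hQ, Polynomial.natDegree_X_mul hQ0,
      Polynomial.natDegree_eq_zero_iff_degree_le_zero.2 h.le] at hdeg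
    omega) (hsep.of_dvd ⟨X, by rw [hQ, mul_comm]⟩)
  refine ⟨x, ?_, ?_⟩
  · rintro rfl
    -- the root `0` of `cyclicPoly - X` is simple
    have h3 := congrArg (fun p => (derivative p).eval 0) hQ
    simp [derivative_cyclicPoly, Polynomial.IsRoot.def.1 hx] at h3
  · have h3 := congrArg (Polynomial.eval x) hQ
    rw [Polynomial.eval_mul, Polynomial.IsRoot.def.1 hx, mul_zero, Polynomial.eval_sub,
      Polynomial.eval_X] at h3
    exact sub_eq_zero.1 h3

variable {Fq}

omit [Field Fq] [Algebra Fq k] in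
/-- If the linearization of a Frobenius-semilinear map is surjective, then the map is injective. -/
theorem semilinear_injective [Module.Finite k V] (Φ : V →+ V)
    (hΦ : ∀ (a : k) x, Φ (a • x) = a ^ q • Φ x)
    (hspan : Submodule.span k (Set.range Φ) = ⊤) {x : V} (hx : Φ x = 0) : x = 0 := by
  let b := Module.finBasis k V
  have h1 : ∀ y, Φ y = ∑ i, (b.repr y i) ^ q • Φ (b i) := fun y => by
    conv_lhs => rw [← b.sum_repr y, map_sum]
    simp only [hΦ]
  have h2 : ⊤ ≤ Submodule.span k (Set.range (fun i => Φ (b i))) := by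
    rw [← hspan, Submodule.span_le]
    rintro _ ⟨y, rfl⟩
    rw [h1]
    exact Submodule.sum_mem _ fun i _ => Submodule.smul_mem _ _ (Submodule.subset_span ⟨i, rfl⟩)
  have h3 := linearIndependent_of_top_le_span_of_card_eq_finrank h2 (by simp)
  rw [h1] at hx
  have h4 := Fintype.linearIndependent_iff.1 h3 _ hx
  refine b.ext_elem fun i => ?_
  rw [map_zero, Finsupp.zero_apply]
  exact eq_zero_of_pow_eq_zero (h4 i)

/-- A Frobenius-semilinear map with surjective linearization has a nonzero fixed vector in every
nonzero space; it is found in the cyclic subspace generated by any `x ≠ 0`. -/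
theorem exists_fixed_ne_zero [IsSepClosed k] [Module.Finite k V] (Φ : V →+ V)
    (hΦ : ∀ (a : k) x, Φ (a • x) = a ^ q • Φ x)
    (hspan : Submodule.span k (Set.range Φ) = ⊤) {x : V} (hx : x ≠ 0) :
    ∃ y, y ≠ 0 ∧ Φ y = y := by
  classical
  set e : ℕ → V := fun n => Φ^[n] x with he
  have he1 (n : ℕ) : Φ (e n) = e (n + 1) := (Function.iterate_succ_apply' _ _ _).symm
  have he0 (n : ℕ) : e n ≠ 0 := by
    induction n with
    | zero => exact hx
    | succ n ih => exact fun h => ih (semilinear_injective Φ hΦ hspan (by rw [he1, h]))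
  -- the first linear dependence among the iterates of `x`
  have hex : ∃ m, e m ∈ Submodule.span k (e '' Set.Iio m) := by
    by_contra! h
    have : LinearIndependent k e := by
      rw [linearIndependent_iff']
      intro t
      induction t using Finset.induction_on_max with
      | empty => simp
      | insert a t ha ih =>
        intro g hg
        have hat : a ∉ t := fun h => (ha a h).false
        rw [Finset.sum_insert hat] at hg
        have hga : g a = 0 := by
          by_contra hga
          apply h a
          have h1 : e a = (g a)⁻¹ • -∑ i ∈ t, g i • e i := by
            rw [← eq_neg_of_add_eq_zero_left hg, smul_smul, inv_mul_cancel₀ hga, one_smul]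
          rw [h1]
          exact Submodule.smul_mem _ _ (Submodule.neg_mem _ (Submodule.sum_mem _ fun i hi =>
            Submodule.smul_mem _ _ (Submodule.subset_span ⟨i, ha i hi, rfl⟩)))
        rw [hga, zero_smul, zero_add] at hg
        intro i hi
        rcases Finset.mem_insert.1 hi with rfl | hi
        · exact hga
        · exact ih g hg i hi
    exact Module.Finite.not_linearIndependent_of_infinite e this
  obtain ⟨m, hm⟩ : ∃ m, Nat.find hex = m + 1 := Nat.exists_eq_succ_of_ne_zero fun h0 => by
    have := Nat.find_spec hex
    rw [h0] at this
    simp [he0] at this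
  have hmem := Nat.find_spec hex
  have hmin : e m ∉ Submodule.span k (e '' Set.Iio m) := Nat.find_min hex (by omega)
  rw [hm] at hmem
  obtain ⟨a, ha⟩ : ∃ a : ℕ → k, e (m + 1) = ∑ i ∈ Finset.range (m + 1), a i • e i := by
    rw [Finsupp.mem_span_image_iff_linearCombination] at hmem
    obtain ⟨l, hl, hl'⟩ := hmem
    refine ⟨l, ?_⟩
    rw [← hl', Finsupp.linearCombination_apply]
    refine Finsupp.sum_of_support_subset _ (fun i hi => ?_) _ (by simp)
    simpa using (Finsupp.mem_supported _ _).1 hl hi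
  obtain ⟨c, hc0, hc⟩ := exists_root_cyclicPoly Fq (a := a) (n := m) (by
    by_contra! h
    apply he0 (m + 1)
    rw [ha]
    refine Finset.sum_eq_zero fun i hi => ?_
    rw [h i (by simpa [Nat.lt_succ_iff] using hi), zero_smul])
  set y : ℕ → k := fun i => (cyclicPoly Fq a i).eval c with hy
  have hym : y m = c := hc
  refine ⟨∑ i ∈ Finset.range (m + 1), y i • e i, fun h0 => hmin ?_, ?_⟩
  · rw [Finset.sum_range_succ, hym, add_comm] at h0
    have h1 : e m = c⁻¹ • -∑ i ∈ Finset.range m, y i • e i := by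
      rw [← eq_neg_of_add_eq_zero_left h0, smul_smul, inv_mul_cancel₀ hc0, one_smul]
    rw [h1]
    exact Submodule.smul_mem _ _ (Submodule.neg_mem _ (Submodule.sum_mem _ fun i hi =>
      Submodule.smul_mem _ _ (Submodule.subset_span ⟨i, by simpa using hi, rfl⟩)))
  · simp only [map_sum, hΦ, he1]
    rw [Finset.sum_range_succ, hym, ha, Finset.smul_sum, Finset.sum_range_succ' _ m,
      Finset.sum_range_succ' _ m, ← add_assoc, ← Finset.sum_add_distrib]
    congr 1
    · refine Finset.sum_congr rfl fun i _ => ?_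
      rw [smul_smul, ← add_smul]
      congr 1
      simp only [hy, cyclicPoly, Polynomial.eval_add, Polynomial.eval_pow, Polynomial.eval_mul,
        Polynomial.eval_C, Polynomial.eval_X]
      ring
    · rw [smul_smul]
      congr 1
      simp only [hy, cyclicPoly, Polynomial.eval_pow, Polynomial.eval_mul,
        Polynomial.eval_C, Polynomial.eval_X]
      ring

/-- On the span of the fixed vectors `Φ - 1` is surjective, by the Artin–Schreier equation. -/
theorem exists_sub_self_eq_of_mem_span_fixed [IsSepClosed k] (Φ : V →+ V)
    (hΦ : ∀ (a : k) x, Φ (a • x) = a ^ q • Φ x) {z : V}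
    (hz : z ∈ Submodule.span k {x | Φ x = x}) :
    ∃ y ∈ Submodule.span k {x | Φ x = x}, Φ y - y = z := by
  induction hz using Submodule.closure_induction with
  | zero => exact ⟨0, zero_mem _, by simp⟩
  | add z z' _ _ h h' =>
    obtain ⟨y, hy, rfl⟩ := h
    obtain ⟨y', hy', rfl⟩ := h'
    exact ⟨y + y', add_mem hy hy', by rw [map_add]; abel⟩
  | smul_mem c x hx =>
    obtain ⟨b, hb⟩ := exists_pow_card_sub_self_eq Fq c
    refine ⟨b • x, Submodule.smul_mem _ _ (Submodule.subset_span hx), ?_⟩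
    rw [hΦ, show Φ x = x from hx, ← sub_smul, hb]

/-- Lang's theorem: a Frobenius-semilinear map over a separably closed field, whose linearization
is surjective, has enough fixed vectors. -/
theorem span_fixed_eq_top [IsSepClosed k] [Module.Finite k V] (Φ : V →+ V)
    (hΦ : ∀ (a : k) x, Φ (a • x) = a ^ q • Φ x)
    (hspan : Submodule.span k (Set.range Φ) = ⊤) :
    Submodule.span k {x | Φ x = x} = ⊤ := by
  set U := Submodule.span k {x | Φ x = x} with hU
  by_contra hne
  have hUΦ : ∀ x ∈ U, Φ x ∈ U := fun x hx => by
    induction hx using Submodule.closure_induction with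
    | zero => rw [map_zero]; exact zero_mem _
    | add z z' _ _ h h' => rw [map_add]; exact add_mem h h'
    | smul_mem c x hx =>
      rw [hΦ, show Φ x = x from hx]
      exact Submodule.smul_mem _ _ (Submodule.subset_span hx)
  -- a nonzero fixed vector of the quotient by the span lifts to a fixed vector
  let Ψ : V ⧸ U →+ V ⧸ U := QuotientAddGroup.map U.toAddSubgroup U.toAddSubgroup Φ hUΦ
  have hΨ (x : V) : Ψ (U.mkQ x) = U.mkQ (Φ x) := rfl
  obtain ⟨x, hx⟩ : ∃ x, x ∉ U := by
    by_contra! h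
    exact hne (eq_top_iff.2 fun x _ => h x)
  obtain ⟨y, hy0, hy⟩ := exists_fixed_ne_zero (Fq := Fq) (k := k) Ψ (fun a x => by
      obtain ⟨x, rfl⟩ := U.mkQ_surjective x
      rw [← map_smul, hΨ, hΨ, hΦ, map_smul]) (by
      rw [eq_top_iff, ← U.range_mkQ, LinearMap.range_eq_map, ← hspan, Submodule.map_span]
      refine Submodule.span_mono ?_
      rintro _ ⟨_, ⟨x, rfl⟩, rfl⟩
      exact ⟨U.mkQ x, rfl⟩) (x := U.mkQ x) (by simpa using hx)
  obtain ⟨y, rfl⟩ := U.mkQ_surjective y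
  rw [hΨ, ← sub_eq_zero, ← map_sub, Submodule.mkQ_apply, Submodule.Quotient.mk_eq_zero] at hy
  obtain ⟨z, hz, h⟩ := exists_sub_self_eq_of_mem_span_fixed Φ hΦ hy
  apply hy0
  rw [Submodule.mkQ_apply, Submodule.Quotient.mk_eq_zero, ← sub_add_cancel y z]
  refine add_mem (Submodule.subset_span ?_) hz
  change Φ (y - z) = y - z
  rw [map_sub, sub_eq_sub_iff_sub_eq_sub, h]

end Frobenius

/-! ### Galois descent -/

section Descent

variable {K Ks : Type*} [Field K] [Field Ks] [Algebra K Ks] [IsGalois K Ks]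
  {V V' : Type*} [AddCommGroup V] [Module Ks V] [AddCommGroup V'] [Module Ks V']
  (ρ : Gal(Ks/K) → V →+ V) (ρ' : Gal(Ks/K) → V' →+ V')

/-- If `x` is fixed by the Galois group of `Ks` over a finite normal extension `E` of `K`, then the
traces `∑ τ, τ(a) • ρ(τ) x` over `Gal(E/K)`, for `a` in `E`, are well-defined and invariant. -/
theorem exists_twisted_trace (hone : ∀ x, ρ 1 x = x)
    (hmul : ∀ g h x, ρ (g * h) x = ρ g (ρ h x))
    (hsmul : ∀ g (a : Ks) x, ρ g (a • x) = g a • ρ g x)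
    {x : V} (hx : {g | ρ g x = x} ∈ nhds (1 : Gal(Ks/K))) :
    ∃ (E : IntermediateField K Ks) (_ : FiniteDimensional K E) (_ : Normal K E)
      (s : Gal(E/K) → Gal(Ks/K)), (∀ τ (a : E), s τ a = τ a) ∧ (ρ (s 1) x = x) ∧
      ∀ (a : E) g, ρ g (∑ τ : Gal(E/K), (τ a : Ks) • ρ (s τ) x) =
        ∑ τ : Gal(E/K), (τ a : Ks) • ρ (s τ) x := by
  obtain ⟨E, hE, hN, hEx⟩ := (krullTopology_mem_nhds_one_iff_of_normal K Ks _).1 hx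
  let s := Function.surjInv (AlgEquiv.restrictNormalHom_surjective (F := K) (K₁ := E) Ks)
  have hs (τ : Gal(E/K)) : AlgEquiv.restrictNormalHom E (s τ) = τ := Function.surjInv_eq _ τ
  have hs' (g : Gal(Ks/K)) (a : E) : (AlgEquiv.restrictNormalHom E g a : Ks) = g a :=
    AlgEquiv.restrictNormal_commutes g E a
  have key (g h : Gal(Ks/K)) (hgh : AlgEquiv.restrictNormalHom E g =
      AlgEquiv.restrictNormalHom E h) : ρ g x = ρ h x := by
    have h1 : h⁻¹ * g ∈ E.fixingSubgroup := by
      rw [← IntermediateField.restrictNormalHom_ker, MonoidHom.mem_ker, map_mul, map_inv, hgh,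
        inv_mul_cancel]
    have h2 : ρ (h⁻¹ * g) x = x := hEx h1
    conv_rhs => rw [← h2, ← hmul, mul_inv_cancel_left]
  refine ⟨E, hE, hN, s, fun τ a => ?_, ?_, fun a g => ?_⟩
  · rw [← hs', hs]
  · rw [key (s 1) 1 (by rw [hs, map_one]), hone]
  · rw [map_sum]
    conv_rhs => rw [← Equiv.sum_comp (Equiv.mulLeft (AlgEquiv.restrictNormalHom E g))]
    refine Finset.sum_congr rfl fun τ _ => ?_
    rw [hsmul, ← hmul, Equiv.coe_mulLeft, AlgEquiv.mul_apply, hs']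
    congr 1
    refine key _ _ ?_
    rw [map_mul, hs, hs]

/-- Galois descent: a smooth semilinear representation is spanned by its invariants. -/
theorem span_invariants_eq_top (hone : ∀ x, ρ 1 x = x)
    (hmul : ∀ g h x, ρ (g * h) x = ρ g (ρ h x))
    (hsmul : ∀ g (a : Ks) x, ρ g (a • x) = g a • ρ g x)
    (hsmooth : ∀ x, {g | ρ g x = x} ∈ nhds (1 : Gal(Ks/K))) :
    Submodule.span Ks {x | ∀ g, ρ g x = x} = ⊤ := by
  rw [eq_top_iff]
  intro x _
  by_contra hx
  obtain ⟨ℓ, hℓ, hker⟩ := Submodule.exists_le_ker_of_notMem hx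
  obtain ⟨E, _, _, s, -, h1, hfix⟩ := exists_twisted_trace ρ hone hmul hsmul (hsmooth x)
  -- a linear form which vanishes on all traces of `x` vanishes at `x`, by Dedekind independence of
  -- the embeddings of `E`
  have hli : LinearIndependent Ks (fun τ : Gal(E/K) => (fun a : E => ((τ a : E) : Ks))) := by
    have := (linearIndependent_monoidHom E Ks).comp
      (fun τ : Gal(E/K) => ((algebraMap E Ks).comp (τ : E →+* E) : E →* Ks)) (fun τ τ' h => by
        ext a
        exact DFunLike.congr_fun h a)
    exact this
  have h2 := Fintype.linearIndependent_iff.1 hli (fun τ => ℓ (ρ (s τ) x)) (by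
    funext a
    have h3 : ℓ (∑ τ : Gal(E/K), (τ a : Ks) • ρ (s τ) x) = 0 :=
      hker (Submodule.subset_span (hfix a))
    rw [map_sum] at h3
    simpa [mul_comm] using h3) 1
  rw [h1] at h2
  exact hℓ h2

/-- Taking invariants of smooth semilinear representations is exact. -/
theorem exists_invariant_lift (hone : ∀ x, ρ 1 x = x)
    (hmul : ∀ g h x, ρ (g * h) x = ρ g (ρ h x))
    (hsmul : ∀ g (a : Ks) x, ρ g (a • x) = g a • ρ g x)
    (hsmooth : ∀ x, {g | ρ g x = x} ∈ nhds (1 : Gal(Ks/K)))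
    (π : V →ₗ[Ks] V') (hπ : ∀ g x, π (ρ g x) = ρ' g (π x)) (x : V)
    (hx : ∀ g, ρ' g (π x) = π x) : ∃ y, (∀ g, ρ g y = y) ∧ π y = π x := by
  obtain ⟨E, _, _, s, -, -, hfix⟩ := exists_twisted_trace ρ hone hmul hsmul (hsmooth x)
  have : Algebra.IsSeparable K E := Algebra.isSeparable_tower_bot_of_isSeparable K E Ks
  have : IsGalois K E := ⟨⟩
  -- the trace of `x` with respect to an element `a` of trace `1` has the same image as `x`
  obtain ⟨a, ha⟩ := Algebra.trace_surjective K E 1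
  refine ⟨_, hfix a, ?_⟩
  have h1 := congrArg (algebraMap E Ks) (trace_eq_sum_automorphisms (K := K) a)
  rw [ha, map_one, map_one, map_sum] at h1
  rw [map_sum]
  simp only [map_smul, hπ, hx]
  rw [← Finset.sum_smul]
  exact (congrArg (· • π x) h1.symm).trans (one_smul _ _)

end Descent

/-! ### Semilinear operators in coordinates -/

section SemiOp

variable {n S S' : Type*} [Fintype n] [CommRing S] [CommRing S']

/-- The semilinear operator `x ↦ A s(x)` on column vectors. -/
def Matrix.semiOp (s : S →+* S) (A : Matrix n n S) : (n → S) →+ (n → S) where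
  toFun x := A.mulVec (s ∘ x)
  map_zero' := by
    rw [show s ∘ (0 : n → S) = 0 from funext fun _ => map_zero s, Matrix.mulVec_zero]
  map_add' x y := by
    rw [show s ∘ (x + y) = s ∘ x + s ∘ y from funext fun _ => map_add s _ _, Matrix.mulVec_add]

theorem Matrix.semiOp_apply (s : S →+* S) (A : Matrix n n S) (x : n → S) :
    A.semiOp s x = A.mulVec (s ∘ x) := rfl

theorem Matrix.semiOp_smul (s : S →+* S) (A : Matrix n n S) (l : S) (x : n → S) :
    A.semiOp s (l • x) = s l • A.semiOp s x := by
  rw [semiOp_apply, semiOp_apply, ← Matrix.mulVec_smul]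
  congr 1
  exact funext fun i => map_mul s _ _

theorem Matrix.map_semiOp (s : S →+* S) (s' : S' →+* S') (π : S →+* S')
    (h : ∀ x, π (s x) = s' (π x)) (A : Matrix n n S) (x : n → S) :
    π ∘ (A.semiOp s x) = (A.map π).semiOp s' (π ∘ x) := by
  funext i
  simp [semiOp_apply, Matrix.mulVec, dotProduct, h]

theorem Matrix.semiOp_mul (s s' : S →+* S) (A B : Matrix n n S) (x : n → S) :
    A.semiOp s (B.semiOp s' x) = (A * B.map s).semiOp (s.comp s') x := by
  have h : s ∘ (B.mulVec (s' ∘ x)) = (B.map s).mulVec (s ∘ (s' ∘ x)) := by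
    funext i
    simp [Matrix.mulVec, dotProduct]
  rw [semiOp_apply, semiOp_apply, semiOp_apply, h, Matrix.mulVec_mulVec]
  rfl

end SemiOp

section Adic

variable {Fq : Type u} [Field Fq] {v : Fq[X]} {k : Type u} [Field k] [Algebra Fq k]

theorem VInt.isUnit_matrix_iff {n : Type*} [Fintype n] [DecidableEq n]
    {P : Matrix n n (VInt v k)} (h : IsUnit (P.map (VInt.proj v k 1))) : IsUnit P := by
  rw [Matrix.isUnit_iff_isUnit_det] at h ⊢
  rw [VInt.isUnit_iff, RingHom.map_det]
  exact h

theorem VInt.exists_limit {n : Type*} (X : ℕ → n → VInt v k)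
    (hX : ∀ m, VInt.proj v k m ∘ X (m + 1) = VInt.proj v k m ∘ X m) :
    ∃ x : n → VInt v k, ∀ m, VInt.proj v k m ∘ x = VInt.proj v k m ∘ X m := by
  choose x hx using fun i => VInt.exists_of_compat v (k := k) (fun m => VInt.proj v k m (X m i))
    fun m => by rw [VInt.factorPow_proj]; exact congrFun (hX m) i
  exact ⟨x, fun m => funext fun i => hx i m⟩

theorem VInt.funext_proj {n : Type*} {x y : n → VInt v k}
    (h : ∀ m, VInt.proj v k m ∘ x = VInt.proj v k m ∘ y) : x = y :=
  funext fun i => VInt.ext v fun m => congrFun (h m) i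

/-- If the fixed vectors of a family of semilinear operators on `k[t]_v ^ n` span modulo `v`, then
there is a basis of fixed vectors, namely the columns of `P`. -/
theorem exists_fixed_matrix {k₀ : Type u} [Field k₀] [Algebra Fq k₀] [Algebra k₀ k]
    [IsScalarTower Fq k₀ k] {ι : Type w} {f : ι → k →ₐ[Fq] k}
    (hmonic : v.Monic) (hirr : Irreducible v)
    (hf : ∀ x, (∀ i, f i x = x) → x ∈ Set.range (algebraMap k₀ k))
    (hk₀ : Irreducible (v.map (algebraMap Fq k₀)))
    {n : Type*} [Fintype n] [DecidableEq n] (A : ι → Matrix n n (VInt v k))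
    (hspan : Submodule.span (k[X] ⧸ vIdeal v k ^ 1)
      {y : n → k[X] ⧸ vIdeal v k ^ 1 | ∃ x : n → VInt v k,
        (∀ i, (A i).semiOp (VInt.mapRing v (f i)) x = x) ∧ VInt.proj v k 1 ∘ x = y} = ⊤) :
    ∃ P : Matrix n n (VInt v k), IsUnit P ∧ ∀ i, A i * P.map (VInt.mapRing v (f i)) = P := by
  classical
  set S := {y : n → k[X] ⧸ vIdeal v k ^ 1 | ∃ x : n → VInt v k,
        (∀ i, (A i).semiOp (VInt.mapRing v (f i)) x = x) ∧ VInt.proj v k 1 ∘ x = y} with hS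
  have hmax : (vIdeal v k₀ ^ 1).IsMaximal := by
    rw [pow_one, vIdeal]
    exact PrincipalIdealRing.isMaximal_of_irreducible hk₀
  let := Ideal.Quotient.field (vIdeal v k₀ ^ 1)
  let _ : Algebra (k₀[X] ⧸ vIdeal v k₀ ^ 1) (k[X] ⧸ vIdeal v k ^ 1) :=
    (quotMap v (IsScalarTower.toAlgHom Fq k₀ k) 1).toAlgebra
  have := quot_nontrivial (k := k) hirr
  -- a basis over the fixed field of the residue ring remains independent over the residue ring
  obtain ⟨b, hbS, hbspan, hb⟩ := exists_linearIndependent (k₀[X] ⧸ vIdeal v k₀ ^ 1) S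
  have hproj (i : ι) (x : VInt v k) : VInt.proj v k 1 (VInt.mapRing v (f i) x) =
      quotMap v (f i) 1 (VInt.proj v k 1 x) := VInt.proj_mapRing v _ _ _
  have hb' : LinearIndependent (k[X] ⧸ vIdeal v k ^ 1) ((↑) : b → n → k[X] ⧸ vIdeal v k ^ 1) := by
    refine linearIndependent_of_fixed (fun i => quotMap v (f i) 1)
      (fun i => ((A i).map (VInt.proj v k 1)).semiOp (quotMap v (f i) 1))
      (fun i l x => Matrix.semiOp_smul _ _ _ _) (fun l hl => ?_)
      (quot_eq_bot_or_eq_top hmonic hf hk₀) (fun i j => ?_) hb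
    · obtain ⟨r, hr⟩ := quot_exists_map_eq_of_fixed hmonic hf hl
      exact ⟨Ideal.Quotient.mk _ r, hr⟩
    · obtain ⟨x, hx, hxj⟩ := hbS j.2
      rw [← hxj, ← Matrix.map_semiOp _ _ _ (hproj i), hx]
  have hb'' : ⊤ ≤ Submodule.span (k[X] ⧸ vIdeal v k ^ 1)
      (Set.range ((↑) : b → n → k[X] ⧸ vIdeal v k ^ 1)) := by
    rw [← hspan, Submodule.span_le, Subtype.range_coe]
    intro y hy
    have h1 : y ∈ Submodule.span (k₀[X] ⧸ vIdeal v k₀ ^ 1) b :=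
      hbspan ▸ Submodule.subset_span hy
    exact Submodule.span_subset_span (k₀[X] ⧸ vIdeal v k₀ ^ 1) (k[X] ⧸ vIdeal v k ^ 1) _ h1
  let B := Module.Basis.mk hb' hb''
  let e := B.indexEquiv (Pi.basisFun (k[X] ⧸ vIdeal v k ^ 1) n)
  let B' := B.reindex e
  have hBmem (j : n) : B' j ∈ S := by
    rw [Module.Basis.reindex_apply, Module.Basis.mk_apply]
    exact hbS (e.symm j).2
  choose x hx hxB using hBmem
  refine ⟨Matrix.of fun i j => x j i, VInt.isUnit_matrix_iff ?_, fun i => ?_⟩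
  · have h1 : (Matrix.of fun i j => x j i).map (VInt.proj v k 1) =
        (Pi.basisFun (k[X] ⧸ vIdeal v k ^ 1) n).toMatrix B' := by
      ext i j
      rw [Module.Basis.toMatrix_apply, ← hxB j]
      rfl
    rw [h1]
    exact @isUnit_of_invertible _ _ _ ((Pi.basisFun _ n).invertibleToMatrix B')
  · ext a j
    exact congrFun (hx j i) a

end Adic

/-! ### Lang's theorem over `k[t]_v` -/

section Quot

variable {Fq : Type u} [Field Fq] {v : Fq[X]} {k : Type u} [Field k] [Algebra Fq k]

theorem quot_finite (hmonic : v.Monic) (n : ℕ) : Module.Finite k (k[X] ⧸ vIdeal v k ^ n) := by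
  rw [vIdeal, Ideal.span_singleton_pow]
  exact ((hmonic.map (algebraMap Fq k)).pow n).finite_quotient

theorem quot_smul_mk (n : ℕ) (a : k) (p : k[X]) :
    a • (Ideal.Quotient.mk (vIdeal v k ^ n) p) = Ideal.Quotient.mk _ (C a * p) := by
  rw [← Polynomial.smul_eq_C_mul]
  rfl

theorem quotMap_smul (f : k →ₐ[Fq] k) (n : ℕ) (a : k) (x : k[X] ⧸ vIdeal v k ^ n) :
    quotMap v f n (a • x) = f a • quotMap v f n x := by
  obtain ⟨p, rfl⟩ := Ideal.Quotient.mk_surjective x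
  rw [quot_smul_mk, quotMap_mk, quotMap_mk, quot_smul_mk, Polynomial.map_mul, Polynomial.map_C]
  rfl

theorem semiOp_quotMap_smul {n : Type*} [Fintype n] (f : k →ₐ[Fq] k) (m : ℕ)
    (A : Matrix n n (k[X] ⧸ vIdeal v k ^ m)) (a : k) (x : n → k[X] ⧸ vIdeal v k ^ m) :
    A.semiOp (quotMap v f m) (a • x) = f a • A.semiOp (quotMap v f m) x := by
  rw [Matrix.semiOp_apply, Matrix.semiOp_apply, ← Matrix.mulVec_smul]
  congr 1
  exact funext fun i => quotMap_smul f m a (x i)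

/-- The values of a coefficient map span, since they contain the powers of `t`. -/
theorem span_range_quotMap (f : k →ₐ[Fq] k) (m : ℕ) {n : Type*} [Finite n] :
    Submodule.span k (Set.range
      (fun x : n → k[X] ⧸ vIdeal v k ^ m => quotMap v f m ∘ x)) = ⊤ := by
  classical
  have := Fintype.ofFinite n
  rw [eq_top_iff]
  intro x _
  rw [← Finset.univ_sum_single x]
  refine Submodule.sum_mem _ fun i _ => ?_
  obtain ⟨p, hp⟩ := Ideal.Quotient.mk_surjective (x i)
  rw [← hp]
  clear hp
  induction p using Polynomial.induction_on' with
  | add p p' h h' =>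
    rw [map_add, Pi.single_add]
    exact add_mem h h'
  | monomial d a =>
    rw [← Polynomial.C_mul_X_pow_eq_monomial, ← quot_smul_mk, Pi.single_smul]
    refine Submodule.smul_mem _ _ (Submodule.subset_span
      ⟨Pi.single i (Ideal.Quotient.mk _ (X ^ d)), ?_⟩)
    funext j
    by_cases hj : j = i
    · subst hj
      simp [quotMap_mk]
    · simp [hj]

theorem VInt.exists_unif_pow_smul_eq {n : Type*} {m : ℕ} {x : n → VInt v k}
    (h : VInt.proj v k m ∘ x = 0) : ∃ y : n → VInt v k, x = VInt.unif v k ^ m • y := by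
  choose y hy using fun i => (VInt.proj_eq_zero_iff v).1 (congrFun h i)
  exact ⟨y, funext hy⟩

theorem VInt.proj_comp_unif_pow_smul {n : Type*} (m : ℕ) (y : n → VInt v k) :
    VInt.proj v k m ∘ (VInt.unif v k ^ m • y) = 0 :=
  funext fun _ => (VInt.proj_eq_zero_iff v).2 (dvd_mul_right _ _)

end Quot

section Lang

variable {Fq : Type u} [Field Fq] [Fintype Fq] {v : Fq[X]} {k : Type u} [Field k] [Algebra Fq k]

omit [Fintype Fq] in
theorem comp_map_add {n S S' : Type*} [CommRing S] [CommRing S'] (π : S →+* S') (x y : n → S) :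
    π ∘ (x + y) = π ∘ x + π ∘ y := funext fun _ => map_add π _ _

omit [Fintype Fq] in
theorem comp_map_sub {n S S' : Type*} [CommRing S] [CommRing S'] (π : S →+* S') (x y : n → S) :
    π ∘ (x - y) = π ∘ x - π ∘ y := funext fun _ => map_sub π _ _

/-- `F_q` is the fixed field of the `q`-power map on `k`. -/
theorem mem_range_algebraMap_of_pow_card_eq_self {x : k} (hx : x ^ Fintype.card Fq = x) :
    x ∈ Set.range (algebraMap Fq k) := by
  have h1 : (∏ a : Fq, (X - C a)) = X ^ Fintype.card Fq - X := by
    have h2 : 1 < Fintype.card Fq := Fintype.one_lt_card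
    have h := Polynomial.prod_multiset_X_sub_C_of_monic_of_roots_card_eq
      (p := (X ^ Fintype.card Fq - X : Fq[X])) ?_ ?_
    · rwa [FiniteField.roots_X_pow_card_sub_X] at h
    · refine (Polynomial.monic_X_pow _).sub_of_left ?_
      rw [Polynomial.degree_X_pow, Polynomial.degree_X]
      exact_mod_cast h2
    · rw [FiniteField.roots_X_pow_card_sub_X, FiniteField.X_pow_card_sub_X_natDegree_eq _ h2]
      rfl
  have h2 := congrArg (Polynomial.aeval x) h1
  simp only [map_prod, map_sub, map_pow, Polynomial.aeval_X, Polynomial.aeval_C, hx, sub_self,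
    Finset.prod_eq_zero_iff, Finset.mem_univ, true_and, sub_eq_zero] at h2
  obtain ⟨a, ha⟩ := h2
  exact ⟨a, ha.symm⟩

/-- Lang's theorem over `k[t]_v`, for a separably closed field `k`. -/
theorem exists_frobenius_fixed_matrix [IsSepClosed k] (hmonic : v.Monic) (hirr : Irreducible v)
    {n : Type*} [Fintype n] [DecidableEq n] (A : Matrix n n (VInt v k)) (hA : IsUnit A) :
    ∃ P : Matrix n n (VInt v k), IsUnit P ∧ A * P.map (VInt.sigma v k) = P := by
  set σ := VInt.mapRing v (FiniteField.frobeniusAlgHom Fq k) with hσ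
  set s := fun m => quotMap v (FiniteField.frobeniusAlgHom Fq k) m with hs
  have hproj (m : ℕ) (x : VInt v k) : VInt.proj v k m (σ x) = s m (VInt.proj v k m x) :=
    VInt.proj_mapRing v _ _ _
  have hσv (m : ℕ) : σ (VInt.unif v k ^ m) = VInt.unif v k ^ m := by
    rw [map_pow]
    exact congrArg (· ^ m) (VInt.map_unif v _)
  have hfin := quot_finite (k := k) hmonic 1
  let Ψ := (A.map (VInt.proj v k 1)).semiOp (s 1)
  have hΨ (a : k) (x : n → k[X] ⧸ vIdeal v k ^ 1) :
      Ψ (a • x) = a ^ Fintype.card Fq • Ψ x := semiOp_quotMap_smul _ _ _ _ _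
  have hspan : Submodule.span k {x | Ψ x = x} = ⊤ := by
    refine span_fixed_eq_top (Fq := Fq) Ψ hΨ ?_
    let ℓ := (Matrix.mulVecLin (A.map (VInt.proj v k 1))).restrictScalars k
    have h1 : Set.range Ψ = ℓ '' (Set.range
        (fun x : n → k[X] ⧸ vIdeal v k ^ 1 => s 1 ∘ x)) := by
      rw [← Set.range_comp]
      rfl
    rw [h1, ← Submodule.map_span, span_range_quotMap, Submodule.map_top, LinearMap.range_eq_top]
    exact Matrix.mulVec_surjective_iff_isUnit.2 (hA.map (VInt.proj v k 1).mapMatrix)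
  -- `A σ - 1` is surjective modulo `v`, hence surjective by completeness
  have hsurj₁ (z : n → VInt v k) : ∃ w z' : n → VInt v k,
      A.semiOp σ w - w + VInt.unif v k • z' = z := by
    obtain ⟨y, -, hy⟩ := exists_sub_self_eq_of_mem_span_fixed (Fq := Fq) Ψ hΨ
      (z := VInt.proj v k 1 ∘ z) (hspan ▸ Submodule.mem_top)
    choose w hw using fun i => VInt.proj_surjective v 1 (y i)
    replace hw : VInt.proj v k 1 ∘ w = y := funext hw
    obtain ⟨z', hz'⟩ := VInt.exists_unif_pow_smul_eq (v := v) (m := 1)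
      (x := z - (A.semiOp σ w - w)) (by
        rw [comp_map_sub, comp_map_sub, Matrix.map_semiOp _ _ _ (hproj 1), hw, ← hy, sub_self])
    exact ⟨w, z', by rw [pow_one] at hz'; rw [← hz']; abel⟩
  have hsurj (z : n → VInt v k) : ∃ x, A.semiOp σ x - x = z := by
    choose w z' hz' using hsurj₁
    let Z : ℕ → n → VInt v k := fun m => Nat.rec z (fun _ y => z' y) m
    let X : ℕ → n → VInt v k := fun m => ∑ i ∈ Finset.range m, VInt.unif v k ^ i • w (Z i)
    have hX1 (m : ℕ) : X (m + 1) = X m + VInt.unif v k ^ m • w (Z m) := Finset.sum_range_succ _ _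
    have hX (m : ℕ) : A.semiOp σ (X m) - X m + VInt.unif v k ^ m • Z m = z := by
      induction m with
      | zero =>
        rw [show X 0 = 0 from rfl, map_zero, sub_zero, zero_add, pow_zero, one_smul]
        rfl
      | succ m ih =>
        have h1 : Z m = A.semiOp σ (w (Z m)) - w (Z m) + VInt.unif v k • Z (m + 1) :=
          (hz' (Z m)).symm
        rw [hX1, map_add, Matrix.semiOp_smul, hσv, pow_succ, mul_smul]
        conv_rhs => rw [← ih, h1]
        rw [smul_add, smul_sub]
        abel
    obtain ⟨x, hx⟩ := VInt.exists_limit X fun m => by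
      rw [hX1, comp_map_add, VInt.proj_comp_unif_pow_smul, add_zero]
    refine ⟨x, VInt.funext_proj fun m => ?_⟩
    rw [comp_map_sub, Matrix.map_semiOp _ _ _ (hproj m), hx, ← Matrix.map_semiOp _ _ _ (hproj m),
      ← comp_map_sub, ← hX m, comp_map_add, VInt.proj_comp_unif_pow_smul, add_zero]
  -- a fixed vector modulo `v` is lifted to some `w`, which is then corrected by a multiple of `v`
  obtain ⟨P, hP, h⟩ := exists_fixed_matrix (k₀ := Fq) (ι := Unit)
    (f := fun _ => FiniteField.frobeniusAlgHom Fq k) hmonic hirr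
    (fun x hx => mem_range_algebraMap_of_pow_card_eq_self (hx ()))
    (by rwa [Algebra.algebraMap_self, Polynomial.map_id]) (fun _ => A) (by
      rw [eq_top_iff]
      intro y _
      refine Submodule.span_subset_span k _ _ (Submodule.span_mono ?_
        (hspan ▸ Submodule.mem_top : y ∈ Submodule.span k {x | Ψ x = x}))
      intro y hy
      choose w hw using fun i => VInt.proj_surjective v 1 (y i)
      replace hw : VInt.proj v k 1 ∘ w = y := funext hw
      obtain ⟨t, ht⟩ := VInt.exists_unif_pow_smul_eq (v := v) (m := 1)
        (x := A.semiOp σ w - w) (by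
          rw [comp_map_sub, Matrix.map_semiOp _ _ _ (hproj 1), hw]
          exact sub_eq_zero.2 hy)
      obtain ⟨x, rfl⟩ := hsurj t
      refine ⟨w - VInt.unif v k ^ 1 • x, fun _ => ?_, ?_⟩
      · rw [map_sub, Matrix.semiOp_smul, hσv, sub_eq_sub_iff_sub_eq_sub, ht, smul_sub]
      · rw [comp_map_sub, VInt.proj_comp_unif_pow_smul, sub_zero, hw])
  exact ⟨P, hP, h ()⟩

end Lang

/-! ### Hilbert 90 over `k[t]_v` -/

section Hilbert

variable {Fq : Type u} [Field Fq] {v : Fq[X]} {K Ks : Type u} [Field K] [Algebra Fq K]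
  [Field Ks] [Algebra Fq Ks] [Algebra K Ks] [IsScalarTower Fq K Ks] [IsGalois K Ks]

omit [IsGalois K Ks] in
theorem setOf_smul_eq_mem_nhds_one [Algebra.IsIntegral K Ks] (a : Ks) :
    {g : Gal(Ks/K) | g a = a} ∈ nhds 1 := by
  rw [krullTopology_mem_nhds_one_iff]
  refine ⟨IntermediateField.adjoin K {a},
    IntermediateField.adjoin.finiteDimensional (Algebra.IsIntegral.isIntegral a),
    fun g hg => ?_⟩
  exact hg ⟨a, IntermediateField.mem_adjoin_simple_self K a⟩

omit [IsGalois K Ks] in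
/-- The Galois group acts smoothly on `Ks[t]/v^m`. -/
theorem setOf_quotMap_eq_mem_nhds_one [Algebra.IsIntegral K Ks] {m : ℕ}
    (x : Ks[X] ⧸ vIdeal v Ks ^ m) :
    {g : Gal(Ks/K) | quotMap v (galHom K Ks g : Ks →ₐ[Fq] Ks) m x = x} ∈ nhds 1 := by
  obtain ⟨p, rfl⟩ := Ideal.Quotient.mk_surjective x
  have h : (⋂ i ∈ p.support, {g : Gal(Ks/K) | g (p.coeff i) = p.coeff i}) ∈ nhds 1 :=
    (Filter.biInter_finset_mem _).2 fun i _ => setOf_smul_eq_mem_nhds_one _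
  filter_upwards [h] with g hg
  rw [quotMap_mk]
  congr 1
  ext i
  rw [Polynomial.coeff_map]
  by_cases hi : i ∈ p.support
  · exact Set.mem_iInter₂.1 hg i hi
  · rw [Polynomial.notMem_support_iff.1 hi, map_zero]

-- Unification through the quotient rings `Ks[t]/v^m` and their coefficient maps is slow.
set_option maxHeartbeats 1600000 in
/-- Hilbert's theorem 90 over `Ks[t]_v`: a continuous cocycle of the Galois group with values in
`GL_n(Ks[t]_v)` is a coboundary. -/
theorem exists_galois_fixed_matrix (hmonic : v.Monic) (hirr : Irreducible v)
    (hK : Irreducible (v.map (algebraMap Fq K)))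
    {n : Type*} [Fintype n] [DecidableEq n] (A : Gal(Ks/K) → Matrix n n (VInt v Ks))
    (hone : A 1 = 1)
    (hmul : ∀ g h, A (g * h) = A g * (A h).map (VInt.mapRing v (galHom K Ks g)))
    (hcont : ∀ m, {g | (A g).map (VInt.proj v Ks m) = 1} ∈ nhds (1 : Gal(Ks/K))) :
    ∃ P : Matrix n n (VInt v Ks), IsUnit P ∧
      ∀ g, A g * P.map (VInt.mapRing v (galHom K Ks g)) = P := by
  set s : Gal(Ks/K) → VInt v Ks →+* VInt v Ks := fun g => VInt.mapRing v (galHom K Ks g) with hs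
  set t : Gal(Ks/K) → ∀ m, (Ks[X] ⧸ vIdeal v Ks ^ m) →+* (Ks[X] ⧸ vIdeal v Ks ^ m) :=
    fun g m => quotMap v (galHom K Ks g) m with ht
  have hproj (g : Gal(Ks/K)) (m : ℕ) (x : VInt v Ks) :
      VInt.proj v Ks m (s g x) = t g m (VInt.proj v Ks m x) := VInt.proj_mapRing v _ _ _
  let ρ : ∀ m, Gal(Ks/K) → (n → Ks[X] ⧸ vIdeal v Ks ^ m) →+ (n → Ks[X] ⧸ vIdeal v Ks ^ m) :=
    fun m g => ((A g).map (VInt.proj v Ks m)).semiOp (t g m)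
  have ht1 (m : ℕ) : t 1 m = RingHom.id _ := by
    refine RingHom.ext fun x => ?_
    obtain ⟨p, rfl⟩ := Ideal.Quotient.mk_surjective x
    exact (quotMap_mk v _ m p).trans (congrArg _ Polynomial.map_id)
  have htmul (g h : Gal(Ks/K)) (m : ℕ) : t (g * h) m = (t g m).comp (t h m) := by
    refine RingHom.ext fun x => ?_
    obtain ⟨p, rfl⟩ := Ideal.Quotient.mk_surjective x
    rw [RingHom.comp_apply, ht]
    simp only
    rw [quotMap_mk, quotMap_mk, quotMap_mk, Polynomial.map_map]
    rfl
  have hρ1 (m : ℕ) (x) : ρ m 1 x = x := by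
    change Matrix.mulVec _ _ = x
    rw [hone, Matrix.map_one _ (map_zero _) (map_one _), Matrix.one_mulVec, ht1]
    rfl
  have hρmul (m : ℕ) (g h x) : ρ m (g * h) x = ρ m g (ρ m h x) := by
    have h1 : ((A h).map (s g)).map (VInt.proj v Ks m) =
        ((A h).map (VInt.proj v Ks m)).map (t g m) := by
      rw [Matrix.map_map, Matrix.map_map]
      exact congrArg (A h).map (funext (hproj g m))
    change Matrix.semiOp _ _ _ = Matrix.semiOp _ _ (Matrix.semiOp _ _ _)
    rw [Matrix.semiOp_mul, ← htmul, ← h1, hmul, Matrix.map_mul]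
  have hρsmul (m : ℕ) (g : Gal(Ks/K)) (a : Ks) (x) : ρ m g (a • x) = g a • ρ m g x :=
    semiOp_quotMap_smul _ _ _ _ _
  have hρsmooth (m : ℕ) (x) : {g | ρ m g x = x} ∈ nhds (1 : Gal(Ks/K)) := by
    filter_upwards [hcont m, (Filter.iInter_mem).2
      fun i => setOf_quotMap_eq_mem_nhds_one (K := K) (v := v) (x i)] with g hg hg'
    change Matrix.mulVec _ _ = x
    rw [hg, Matrix.one_mulVec]
    exact funext fun i => Set.mem_iInter.1 hg' i
  -- an invariant vector modulo `v^m` lifts to an invariant vector modulo `v^(m+1)`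
  have hstep (m : ℕ) (x : n → VInt v Ks)
      (hx : ∀ g, ρ m g (VInt.proj v Ks m ∘ x) = VInt.proj v Ks m ∘ x) :
      ∃ x', (∀ g, ρ (m + 1) g (VInt.proj v Ks (m + 1) ∘ x') = VInt.proj v Ks (m + 1) ∘ x') ∧
        VInt.proj v Ks m ∘ x' = VInt.proj v Ks m ∘ x := by
    let π : (n → Ks[X] ⧸ vIdeal v Ks ^ (m + 1)) →ₗ[Ks] (n → Ks[X] ⧸ vIdeal v Ks ^ m) :=
      { toFun := fun x => Ideal.Quotient.factorPow (vIdeal v Ks) m.le_succ ∘ x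
        map_add' := fun x y => comp_map_add _ x y
        map_smul' := fun a x => funext fun i => by
          obtain ⟨p, hp⟩ := Ideal.Quotient.mk_surjective (x i)
          simp only [Function.comp_apply, Pi.smul_apply, ← hp, quot_smul_mk]
          exact (quot_smul_mk m a p).symm }
    have hπ (z : n → VInt v Ks) : π (VInt.proj v Ks (m + 1) ∘ z) = VInt.proj v Ks m ∘ z :=
      funext fun i => VInt.factorPow_proj v m.le_succ (z i)
    obtain ⟨y, hy, hyx⟩ := exists_invariant_lift (ρ (m + 1)) (ρ m) (hρ1 (m + 1)) (hρmul (m + 1))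
      (hρsmul (m + 1)) (hρsmooth (m + 1)) π (fun g z => by
        have h1 : ((A g).map (VInt.proj v Ks (m + 1))).map
            (Ideal.Quotient.factorPow (vIdeal v Ks) m.le_succ) = (A g).map (VInt.proj v Ks m) := by
          rw [Matrix.map_map]
          exact congrArg (A g).map (funext fun x => VInt.factorPow_proj v m.le_succ x)
        refine (Matrix.map_semiOp _ (t g m) (Ideal.Quotient.factorPow (vIdeal v Ks) m.le_succ)
          (fun x => ?_) _ _).trans ?_
        · obtain ⟨p, rfl⟩ := Ideal.Quotient.mk_surjective x
          rfl
        · rw [h1]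
          rfl) (VInt.proj v Ks (m + 1) ∘ x) (by rwa [hπ])
    choose x' hx' using fun i => VInt.proj_surjective v (m + 1) (y i)
    replace hx' : VInt.proj v Ks (m + 1) ∘ x' = y := funext hx'
    exact ⟨x', by rwa [hx'], by rw [← hπ, hx', hyx, hπ]⟩
  refine exists_fixed_matrix (k₀ := K) (f := fun g => galHom K Ks g) hmonic hirr
    (fun x hx => ?_) hK A ?_
  · exact (InfiniteGalois.mem_range_algebraMap_iff_fixed x).2 hx
  · rw [eq_top_iff]
    intro y _
    refine Submodule.span_subset_span Ks _ _ (Submodule.span_mono ?_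
        (span_invariants_eq_top (ρ 1) (hρ1 1) (hρmul 1) (hρsmul 1) (hρsmooth 1) ▸
          Submodule.mem_top : y ∈ Submodule.span Ks {x | ∀ g, ρ 1 g x = x}))
    intro y hy
    choose w hw using fun i => VInt.proj_surjective v 1 (y i)
    replace hw : VInt.proj v Ks 1 ∘ w = y := funext hw
    have hred {m : ℕ} {a b : n → VInt v Ks}
        (h : VInt.proj v Ks (m + 1) ∘ a = VInt.proj v Ks (m + 1) ∘ b) :
        VInt.proj v Ks m ∘ a = VInt.proj v Ks m ∘ b := funext fun i => by
      have := congrFun h i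
      exact (VInt.factorPow_proj v m.le_succ (a i)).symm.trans
        ((congrArg _ this).trans (VInt.factorPow_proj v m.le_succ (b i)))
    -- the terms `X m` of the approximating sequence are invariant modulo `v^(m+1)`
    choose! F hF hF' using hstep
    let X : ℕ → n → VInt v Ks := fun m => Nat.rec w (fun i x => F (i + 1) x) m
    have hX (m : ℕ) (g : Gal(Ks/K)) : ρ (m + 1) g (VInt.proj v Ks (m + 1) ∘ X m) =
        VInt.proj v Ks (m + 1) ∘ X m := by
      induction m generalizing g with
      | zero =>
        rw [show X 0 = w from rfl, hw]
        exact hy g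
      | succ m ih => exact hF (m + 1) (X m) ih g
    have hX' (m : ℕ) : VInt.proj v Ks (m + 1) ∘ X (m + 1) = VInt.proj v Ks (m + 1) ∘ X m :=
      hF' (m + 1) (X m) (hX m)
    obtain ⟨x, hx⟩ := VInt.exists_limit X fun m => hred (hX' m)
    refine ⟨x, fun g => VInt.funext_proj fun m => ?_, ?_⟩
    · rw [Matrix.map_semiOp _ _ _ (hproj g m), hx, ← Matrix.map_semiOp _ _ _ (hproj g m)]
      refine hred ?_
      rw [Matrix.map_semiOp _ _ _ (hproj g (m + 1))]
      exact hX m g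
    · exact (hx 1).trans ((hX' 0).trans hw)

end Hilbert

/-! ### The `v`-adic topology -/

section Topology

variable {Fq : Type u} [Field Fq] {v : Fq[X]} {k k' : Type u} [Field k] [Algebra Fq k]
  [Field k'] [Algebra Fq k']

open Topology

theorem VRat.algebraMap_pow_mul (n : ℕ) (a : VInt v k) :
    algebraMap (VInt v k) (VRat v k) (algebraMap Fq[X] (VInt v k) (v ^ n) * a) =
      VRat.unif v k ^ n * algebraMap _ _ a := by
  rw [map_mul, map_pow, map_pow]
  rfl

/-- The basic neighbourhoods `x + v ^ n k[t]_v` of `x`. -/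
def VRat.nbhd (x : VRat v k) (n : ℕ) : Set (VRat v k) :=
  {y | ∃ a : VInt v k, x + VRat.unif v k ^ n * algebraMap _ _ a = y}

theorem VRat.isOpen_iff {U : Set (VRat v k)} :
    IsOpen U ↔ ∀ x ∈ U, ∃ n, VRat.nbhd x n ⊆ U := by
  change (∀ x ∈ U, ∃ n : ℕ, ∀ a : VInt v k,
    x + algebraMap (VInt v k) (VRat v k) (algebraMap Fq[X] (VInt v k) (v ^ n) * a) ∈ U) ↔ _
  simp only [VRat.algebraMap_pow_mul]
  refine forall₂_congr fun x _ => exists_congr fun n => ⟨?_, fun h a => h ⟨a, rfl⟩⟩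
  rintro h _ ⟨a, rfl⟩
  exact h a

theorem VRat.isOpen_nbhd (x : VRat v k) (n : ℕ) : IsOpen (VRat.nbhd x n) := by
  rw [VRat.isOpen_iff]
  rintro _ ⟨a, rfl⟩
  refine ⟨n, ?_⟩
  rintro _ ⟨b, rfl⟩
  exact ⟨a + b, by rw [map_add]; ring⟩

theorem VRat.hasBasis_nhds (x : VRat v k) :
    (𝓝 x).HasBasis (fun _ => True) (VRat.nbhd x) := by
  refine ⟨fun U => ?_⟩
  simp only [true_and]
  rw [mem_nhds_iff]
  constructor
  · rintro ⟨U', hU', hopen, hx⟩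
    obtain ⟨n, hn⟩ := VRat.isOpen_iff.1 hopen x hx
    exact ⟨n, hn.trans hU'⟩
  · rintro ⟨n, hn⟩
    exact ⟨_, hn, VRat.isOpen_nbhd x n, 0, by rw [map_zero, mul_zero, add_zero]⟩

theorem VRat.isTopologicalRing (hirr : Irreducible v) : IsTopologicalRing (VRat v k) where
  continuous_add := by
    rw [continuous_iff_continuousAt]
    rintro ⟨x, y⟩
    rw [ContinuousAt, nhds_prod_eq, ((VRat.hasBasis_nhds x).prod (VRat.hasBasis_nhds y)).tendsto_iff
      (VRat.hasBasis_nhds _)]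
    rintro n -
    refine ⟨⟨n, n⟩, ⟨trivial, trivial⟩, ?_⟩
    rintro ⟨_, _⟩ ⟨⟨a, rfl⟩, ⟨b, rfl⟩⟩
    exact ⟨a + b, by rw [map_add]; ring⟩
  continuous_mul := by
    rw [continuous_iff_continuousAt]
    rintro ⟨x, y⟩
    rw [ContinuousAt, nhds_prod_eq, ((VRat.hasBasis_nhds x).prod (VRat.hasBasis_nhds y)).tendsto_iff
      (VRat.hasBasis_nhds _)]
    rintro n -
    obtain ⟨m, c, hc⟩ := VRat.exists_unif_pow_mul_eq hirr x
    obtain ⟨l, d, hd⟩ := VRat.exists_unif_pow_mul_eq hirr y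
    refine ⟨⟨n + l, n + m⟩, ⟨trivial, trivial⟩, ?_⟩
    rintro ⟨_, _⟩ ⟨⟨a, rfl⟩, ⟨b, rfl⟩⟩
    refine ⟨a * d + b * c + VInt.unif v k ^ (l + n + m) * (a * b), ?_⟩
    simp only [map_add, map_mul, map_pow, ← hc, ← hd]
    change _ + VRat.unif v k ^ n * (_ + VRat.unif v k ^ (l + n + m) * _) = _
    ring
  continuous_neg := by
    rw [continuous_iff_continuousAt]
    intro x
    rw [ContinuousAt, (VRat.hasBasis_nhds x).tendsto_iff (VRat.hasBasis_nhds _)]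
    rintro n -
    refine ⟨n, trivial, ?_⟩
    rintro _ ⟨a, rfl⟩
    exact ⟨-a, by rw [map_neg]; ring⟩

/-- The topology of `k(t)_v` is induced by that of `k'(t)_v`. -/
theorem VRat.isInducing_map (hirr : Irreducible v) (f : k →ₐ[Fq] k') :
    IsInducing (VRat.map v f) := by
  rw [isInducing_iff_nhds]
  intro x
  refine (VRat.hasBasis_nhds x).eq_of_same_basis ?_
  refine ((VRat.hasBasis_nhds _).comap (VRat.map v f)).congr (by simp) ?_
  rintro n -
  ext y
  constructor
  · rintro ⟨a, ha⟩
    have h1 : VRat.map v f (y - x) = algebraMap _ _ (VInt.unif v k' ^ n * a) := by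
      rw [map_sub, ← ha, map_mul, map_pow]
      exact add_sub_cancel_left _ _
    obtain ⟨b, hb, hb'⟩ := VRat.mem_range_of_map_mem_range hirr f h1
    obtain ⟨c, rfl⟩ := (VInt.unif_pow_dvd_map_iff f).1 ⟨a, hb'⟩
    refine ⟨c, ?_⟩
    rw [map_mul, map_pow] at hb
    rw [VRat.unif, hb]
    exact add_sub_cancel _ _
  · rintro ⟨a, rfl⟩
    refine ⟨VInt.map v f a, ?_⟩
    rw [map_add, map_mul, map_pow, VRat.map_unif, VRat.map_algebraMap]

theorem VRat.isOpen_range_algebraMap (n : ℕ) :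
    IsOpen {x : VRat v k | ∃ a, algebraMap (VInt v k) (VRat v k) (VInt.unif v k ^ n * a) = x} := by
  convert VRat.isOpen_nbhd (v := v) (0 : VRat v k) n using 1
  ext x
  simp only [VRat.nbhd, zero_add, map_mul, map_pow]
  rfl

end Topology

section Galois

variable {Fq : Type u} [Field Fq] {v : Fq[X]} {K Ks : Type u} [Field K] [Algebra Fq K]
  [Field Ks] [Algebra Fq Ks] [Algebra K Ks] [IsScalarTower Fq K Ks]

theorem VRat.smul_def (g : Gal(Ks/K)) (x : VRat v Ks) : g • x = VRat.map v (galHom K Ks g) x := rfl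

/-- The orbit maps of the Galois group on `Ks(t)_v` are continuous. -/
theorem VRat.continuous_smul_const [Algebra.IsIntegral K Ks] (hirr : Irreducible v)
    (x : VRat v Ks) : Continuous fun g : Gal(Ks/K) => g • x := by
  rw [continuous_iff_continuousAt]
  intro g
  rw [ContinuousAt, (VRat.hasBasis_nhds _).tendsto_right_iff]
  rintro n -
  -- as `x` is integral up to `v^m`, its translates are compared modulo `v^(n+m)`
  obtain ⟨m, a, ha⟩ := VRat.exists_unif_pow_mul_eq hirr x
  have h := setOf_quotMap_eq_mem_nhds_one (K := K) (VInt.proj v Ks (n + m) a)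
  have h2 : Filter.Tendsto (fun h : Gal(Ks/K) => g⁻¹ * h) (nhds g) (nhds 1) := by
    have := (continuous_const_mul g⁻¹).tendsto g
    rwa [inv_mul_cancel] at this
  filter_upwards [h2 h] with h hh
  have h3 : VInt.proj v Ks (n + m) (VInt.map v (galHom K Ks (g⁻¹ * h)) a - a) = 0 := by
    rw [map_sub, VInt.proj_map, sub_eq_zero]
    exact hh
  rw [VInt.proj_eq_zero_iff] at h3
  obtain ⟨b, hb⟩ := h3
  have h4 : (g⁻¹ * h) • x - x = VRat.unif v Ks ^ n * algebraMap _ _ b := by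
    refine VRat.unif_pow_mul_cancel hirr.ne_zero m ?_
    have h5 := congrArg (algebraMap (VInt v Ks) (VRat v Ks)) hb
    rw [map_sub, ← VRat.map_algebraMap, ← ha, map_mul, map_mul, map_pow, map_pow, VRat.map_unif,
      ← VRat.smul_def] at h5
    rw [mul_sub, h5, VRat.unif]
    ring
  refine ⟨VInt.map v (galHom K Ks g) b, ?_⟩
  have h6 := congrArg (g • ·) h4
  simp only [smul_sub, smul_smul, mul_inv_cancel_left, smul_mul'] at h6
  rw [← sub_add_cancel (h • x) (g • x), h6, add_comm]
  congr 2
  rw [VRat.smul_def, map_pow, VRat.map_unif]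

end Galois

/-! ### Continuous representations in coordinates -/

section ContRep

variable {Fq : Type u} [Field Fq] {v : Fq[X]} {G : Type u} [Group G] [TopologicalSpace G]

/-- A representation is continuous if its matrix coefficients in some basis are continuous. -/
theorem isContRep_of_continuous_repr (hirr : Irreducible v) {W : Rep.{u} (VRat v Fq) G}
    {ι : Type*} [Finite ι] (b : Module.Basis ι (VRat v Fq) W)
    (h : ∀ i j, Continuous fun g : G => b.repr (W.ρ g (b j)) i) : IsContRep v G W := by
  have := VRat.isTopologicalRing (k := Fq) hirr
  have := Fintype.ofFinite ι
  refine ⟨Module.Finite.of_basis b, ?_⟩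
  let _ : TopologicalSpace W := moduleTopology (VRat v Fq) W
  have : IsModuleTopology (VRat v Fq) W := ⟨rfl⟩
  have : ContinuousAdd W := IsModuleTopology.toContinuousAdd (VRat v Fq) W
  have : ContinuousSMul (VRat v Fq) W := IsModuleTopology.toContinuousSMul (VRat v Fq) W
  change Continuous fun p : G × W => W.ρ p.1 p.2
  have h1 : (fun p : G × W => W.ρ p.1 p.2) = fun p : G × W =>
      ∑ j, b.repr p.2 j • ∑ i, b.repr (W.ρ p.1 (b j)) i • b i := by
    funext p
    conv_lhs => rw [← b.sum_repr p.2, map_sum]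
    exact Finset.sum_congr rfl fun j _ => by rw [map_smul, b.sum_repr]
  rw [h1]
  refine continuous_finsetSum _ fun j _ => Continuous.smul ?_
    (continuous_finsetSum _ fun i _ => Continuous.smul ((h i j).comp continuous_fst)
      continuous_const)
  exact (IsModuleTopology.continuous_of_linearMap (b.coord j)).comp continuous_snd

theorem IsContRep.continuous_repr (hirr : Irreducible v) {W : Rep.{u} (VRat v Fq) G}
    (hW : IsContRep v G W) {ι : Type*} (b : Module.Basis ι (VRat v Fq) W) (i : ι) (w : W) :
    Continuous fun g : G => b.repr (W.ρ g w) i := by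
  have := VRat.isTopologicalRing (k := Fq) hirr
  obtain ⟨_, hc⟩ := hW
  let _ : TopologicalSpace W := moduleTopology (VRat v Fq) W
  have : IsModuleTopology (VRat v Fq) W := ⟨rfl⟩
  have hc' : Continuous fun p : G × W => W.ρ p.1 p.2 := hc
  exact (IsModuleTopology.continuous_of_linearMap (b.coord i)).comp
    (hc'.comp (Continuous.prodMk_left w))

end ContRep

/-! ### Stable lattices -/

section Lattice

variable {Fq : Type u} [Field Fq] {v : Fq[X]}

theorem Module.free_of_isField {R M : Type*} [CommRing R] [AddCommMonoid M] [Module R M]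
    (hR : IsField R) : Module.Free R M := by
  let _ : AddCommGroup M := Module.addCommMonoidToAddCommGroup R
  let _ : Field R := hR.toField
  exact Module.Free.of_divisionRing R M

/-- A finitely generated `k[t]_v`-submodule of a vector space over `k(t)_v` is free. -/
theorem VInt.exists_basis_submodule {k : Type u} [Field k] [Algebra Fq k] (hmonic : v.Monic)
    (hirr : Irreducible v) (hk : Irreducible (v.map (algebraMap Fq k)))
    {M : Type*} [AddCommGroup M] [Module (VRat v k) M] [Module (VInt v k) M]
    [IsScalarTower (VInt v k) (VRat v k) M] (M₀ : Submodule (VInt v k) M)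
    (hM₀ : Module.Finite (VInt v k) M₀) : ∃ r, Nonempty (Module.Basis (Fin r) (VInt v k) M₀) := by
  obtain ⟨_, _⟩ := VInt.isDiscreteValuationRing hmonic hirr hk
  have hF := VRat.isField hmonic hirr hk
  have : Module.IsTorsionFree (VInt v k) M := .of_smul_eq_zero fun a x h => by
    by_cases ha : a = 0
    · exact Or.inl ha
    · right
      have ha' : algebraMap (VInt v k) (VRat v k) a ≠ 0 := fun h0 =>
        ha (VRat.algebraMap_injective hirr (by rw [h0, map_zero]))
      obtain ⟨b, hb⟩ := hF.mul_inv_cancel ha'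
      rw [← one_smul (VRat v k) x, ← hb, mul_comm, mul_smul, algebraMap_smul, h, smul_zero]
  obtain ⟨r, b⟩ := Module.basisOfFiniteTypeTorsionFree' (R := VInt v k) (M := M₀)
  exact ⟨r, ⟨b⟩⟩

/-- A compact group is covered by finitely many translates of any neighbourhood of `1`. -/
theorem exists_finset_cover_of_mem_nhds_one {G : Type*} [Group G] [TopologicalSpace G]
    [IsTopologicalGroup G] [CompactSpace G] {U : Set G} (hU : U ∈ nhds 1) :
    ∃ t : Finset G, ∀ g : G, ∃ h ∈ t, h⁻¹ * g ∈ U := by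
  obtain ⟨t, -, ht⟩ := isCompact_univ.elim_nhds_subcover (fun h : G => (fun g => h⁻¹ * g) ⁻¹' U)
    fun h _ => (continuous_const_mul h⁻¹).continuousAt.preimage_mem_nhds (by simpa using hU)
  refine ⟨t, fun g => ?_⟩
  obtain ⟨h, hh, hg⟩ := Set.mem_iUnion₂.1 (ht (Set.mem_univ g))
  exact ⟨h, hh, hg⟩

/-- A continuous representation of a compact group has a stable lattice: in a basis of such a
lattice, the action is given by matrices over `F_q[t]_v`. -/
theorem IsContRep.exists_integral_basis (hmonic : v.Monic) (hirr : Irreducible v) {G : Type u}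
    [Group G] [TopologicalSpace G] [IsTopologicalGroup G] [CompactSpace G]
    {W : Rep.{u} (VRat v Fq) G} (hW : IsContRep v G W) :
    ∃ (r : ℕ) (b : Module.Basis (Fin r) (VRat v Fq) W) (A : G → Matrix (Fin r) (Fin r) (VInt v Fq)),
      ∀ g j, W.ρ g (b j) = ∑ i, algebraMap (VInt v Fq) (VRat v Fq) (A g i j) • b i := by
  have hirr' : Irreducible (v.map (algebraMap Fq Fq)) := by
    rwa [Algebra.algebraMap_self, Polynomial.map_id]
  have hF := VRat.isField hmonic hirr hirr'
  have := Module.free_of_isField (M := W) hF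
  have := VRat.nontrivial (k := Fq) hirr
  have := hW.1
  let e := Module.finBasis (VRat v Fq) W
  let _ : Module (VInt v Fq) W := Module.compHom W (algebraMap (VInt v Fq) (VRat v Fq))
  have : IsScalarTower (VInt v Fq) (VRat v Fq) W := ⟨fun b e x => by
    rw [Algebra.smul_def, mul_smul]
    rfl⟩
  have hlin (g : G) (a : VInt v Fq) (x : W) : W.ρ g (a • x) = a • W.ρ g x :=
    (W.ρ g).map_smul (algebraMap (VInt v Fq) (VRat v Fq) a) x
  -- the elements which preserve the lattice of `e` form a neighbourhood of `1`
  let U : Set G := {g | ∀ i j, ∃ a : VInt v Fq, algebraMap _ (VRat v Fq) a = e.repr (W.ρ g (e j)) i}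
  have hU : U ∈ nhds 1 := by
    have h1 (i j) : {g : G | ∃ a : VInt v Fq, algebraMap _ (VRat v Fq) a =
        e.repr (W.ρ g (e j)) i} ∈ nhds 1 := by
      have h2 := (VRat.isOpen_range_algebraMap (v := v) (k := Fq) 0).preimage
        (hW.continuous_repr hirr e i (e j))
      simp only [pow_zero, one_mul] at h2
      refine h2.mem_nhds ?_
      change ∃ a, _ = e.repr (W.ρ 1 (e j)) i
      rw [map_one, Module.End.one_apply, e.repr_self]
      by_cases hij : j = i
      · exact ⟨1, by simp [hij]⟩
      · exact ⟨0, by simp [hij]⟩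
    have h3 : (⋂ i, ⋂ j, {g : G | ∃ a : VInt v Fq, algebraMap _ (VRat v Fq) a =
        e.repr (W.ρ g (e j)) i}) ∈ nhds 1 :=
      Filter.iInter_mem.2 fun i => Filter.iInter_mem.2 fun j => h1 i j
    filter_upwards [h3] with g hg i j
    exact Set.mem_iInter₂.1 hg i j
  obtain ⟨t, ht⟩ := exists_finset_cover_of_mem_nhds_one hU
  -- the sum of all translates of the lattice of `e` is a sum of finitely many of them
  let Λ : Submodule (VInt v Fq) W := Submodule.span _ (Set.range fun p : G × _ => W.ρ p.1 (e p.2))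
  have hΛ : Λ.FG := by
    classical
    refine ⟨(t ×ˢ Finset.univ).image fun p : G × _ => W.ρ p.1 (e p.2), le_antisymm
      (Submodule.span_mono ?_) (Submodule.span_le.2 ?_)⟩
    · rintro x hx
      obtain ⟨p, -, rfl⟩ := Finset.mem_image.1 hx
      exact ⟨p, rfl⟩
    · rintro _ ⟨⟨g, j⟩, rfl⟩
      obtain ⟨h, hh, hg⟩ := ht g
      choose a ha using hg
      have h1 : W.ρ g (e j) = ∑ i, a i j • W.ρ h (e i) := by
        have h2 : W.ρ (h⁻¹ * g) (e j) = ∑ i, a i j • e i := by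
          rw [← e.sum_repr (W.ρ (h⁻¹ * g) (e j))]
          exact Finset.sum_congr rfl fun i _ => by rw [← ha i j, algebraMap_smul]
        have h3 := congrArg (W.ρ h) h2
        rw [← Module.End.mul_apply, ← map_mul, mul_inv_cancel_left, map_sum] at h3
        rw [h3]
        exact Finset.sum_congr rfl fun i _ => hlin _ _ _
      simp only [h1]
      refine Submodule.sum_mem _ fun i _ => Submodule.smul_mem _ _ (Submodule.subset_span ?_)
      rw [Finset.mem_coe, Finset.mem_image]
      exact ⟨⟨h, i⟩, by simp [hh], rfl⟩
  have hΛρ (g : G) {x : W} (hx : x ∈ Λ) : W.ρ g x ∈ Λ := by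
    induction hx using Submodule.span_induction with
    | mem x hx =>
      obtain ⟨⟨h, j⟩, rfl⟩ := hx
      refine Submodule.subset_span ⟨⟨g * h, j⟩, ?_⟩
      simp only [map_mul, Module.End.mul_apply]
    | zero => rw [map_zero]; exact zero_mem _
    | add x y _ _ hx hy => rw [map_add]; exact add_mem hx hy
    | smul a x _ hx => rw [hlin]; exact Submodule.smul_mem _ _ hx
  obtain ⟨r, ⟨c⟩⟩ := VInt.exists_basis_submodule hmonic hirr hirr' Λ
    (Module.Finite.iff_fg.2 hΛ)
  have hli : LinearIndependent (VRat v Fq) fun i => (c i : W) := by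
    refine LinearIndependent.localization (VRat v Fq)
      (Algebra.algebraMapSubmonoid (VInt v Fq) (nonZeroDivisors Fq[X])) ?_
    exact c.linearIndependent.map' Λ.subtype (Submodule.ker_subtype _)
  have hmem {x : W} (hx : x ∈ Λ) : x = ∑ i, c.repr ⟨x, hx⟩ i • (c i : W) := by
    have h := congrArg Λ.subtype (c.sum_repr ⟨x, hx⟩)
    rw [map_sum] at h
    exact h.symm
  have hspan : ⊤ ≤ Submodule.span (VRat v Fq) (Set.range fun i => (c i : W)) := by
    rw [← e.span_eq, Submodule.span_le]
    rintro _ ⟨j, rfl⟩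
    have h1 : e j ∈ Λ := Submodule.subset_span ⟨⟨1, j⟩, by simp⟩
    rw [hmem h1]
    refine Submodule.sum_mem _ fun i _ => ?_
    rw [← algebraMap_smul (VRat v Fq)]
    exact Submodule.smul_mem _ _ (Submodule.subset_span ⟨i, rfl⟩)
  refine ⟨r, Module.Basis.mk hli hspan, fun g => Matrix.of fun i j =>
    c.repr ⟨W.ρ g (c j), hΛρ g (c j).2⟩ i, fun g j => ?_⟩
  simp only [Module.Basis.mk_apply, Matrix.of_apply, algebraMap_smul]
  exact hmem _

end Lattice

/-! ### Descent along a ring of invariants -/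

section Invariants

variable {R L N : Type*} {ι : Type*} [CommRing R] [CommRing L] [Algebra R L] [AddCommGroup N]
  [Module L N] [Module R N] [IsScalarTower R L N]

theorem liftBaseChange_injective_of_linearIndependent {U κ : Type*} [AddCommMonoid U] [Module R U]
    (f : U →ₗ[R] N) (b : Module.Basis κ R U) (h : LinearIndependent L fun i => f (b i)) :
    Function.Injective (f.liftBaseChange L) := by
  let _ : AddCommGroup U := Module.addCommMonoidToAddCommGroup R
  refine LinearMap.ker_eq_bot.1 (LinearMap.ker_eq_bot'.2 fun x hx => ?_)
  rw [← (b.baseChange L).linearCombination_repr x, Finsupp.apply_linearCombination] at hx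
  have h1 : (f.liftBaseChange L ∘ (b.baseChange L)) = fun i => f (b i) := by
    funext i
    simp
  rw [h1] at hx
  have h2 := (linearIndependent_iff.1 h) _ hx
  exact (b.baseChange L).repr.map_eq_zero_iff.1 h2

theorem range_liftBaseChange {U : Type*} [AddCommMonoid U] [Module R U] (f : U →ₗ[R] N) :
    LinearMap.range (f.liftBaseChange L) = Submodule.span L (Set.range f) := by
  refine le_antisymm ?_ (Submodule.span_le.2 ?_)
  · rintro _ ⟨x, rfl⟩
    induction x using TensorProduct.induction_on with
    | zero => rw [map_zero]; exact zero_mem _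
    | add x y hx hy => rw [map_add]; exact add_mem hx hy
    | tmul a x =>
      rw [LinearMap.liftBaseChange_tmul]
      exact Submodule.smul_mem _ _ (Submodule.subset_span ⟨x, rfl⟩)
  · rintro _ ⟨x, rfl⟩
    exact ⟨1 ⊗ₜ x, by rw [LinearMap.liftBaseChange_tmul, one_smul]⟩

theorem finite_of_baseChange_finite {U : Type*} [AddCommMonoid U] [Module R U] [Module.Free R U]
    [Nontrivial L] (h : Module.Finite L (L ⊗[R] U)) : Module.Finite R U := by
  let b := Module.Free.chooseBasis R U
  have := Module.Finite.finite_basis (b.baseChange L)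
  exact Module.Finite.of_basis b

/-- If `N = L ⊗ W` through `f : W → N`, then `f` is injective. -/
theorem injective_of_liftBaseChange_bijective [Nontrivial L] {W : Type*} [AddCommMonoid W]
    [Module R W] (hR : IsField R) (f : W →ₗ[R] N) (hf : Function.Bijective (f.liftBaseChange L)) :
    Function.Injective f := by
  let _ : AddCommGroup W := Module.addCommMonoidToAddCommGroup R
  have := Module.free_of_isField (M := W) hR
  let _ := hR.toField
  have h1 : Function.Injective (TensorProduct.mk R L W 1) := by
    let b := Module.Free.chooseBasis R W
    refine LinearMap.ker_eq_bot.1 (LinearMap.ker_eq_bot'.2 fun x hx => ?_)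
    refine b.ext_elem fun i => ?_
    have h2 := congrArg (fun y => (b.baseChange L).repr y i) hx
    simp only [TensorProduct.mk_apply, Module.Basis.baseChange_repr_tmul, map_zero,
      Finsupp.zero_apply] at h2
    rw [map_zero, Finsupp.zero_apply]
    refine (algebraMap R L).injective ?_
    rw [map_zero, ← h2, Algebra.smul_def, mul_one]
  have h3 : (f : W → N) = f.liftBaseChange L ∘ TensorProduct.mk R L W 1 := by
    funext w
    simp
  rw [h3]
  exact hf.injective.comp h1

/-- The data of a semilinear family of operators `Φ i` on an `L`-module, over endomorphisms `s i`
of `L` which have the field `R` as ring of invariants and which admit no stable ideals. -/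
structure DescentDatum (R L N ι : Type*) [CommRing R] [CommRing L] [Algebra R L] [AddCommGroup N]
    [Module L N] where
  s : ι → L →+* L
  Φ : ι → N →+ N
  Φ_smul : ∀ i (l : L) (x : N), Φ i (l • x) = s i l • Φ i x
  mem_range : ∀ l, (∀ i, s i l = l) → l ∈ Set.range (algebraMap R L)
  eq_bot_or_eq_top : ∀ I : Ideal L, (∀ i, ∀ x ∈ I, s i x ∈ I) → I = ⊥ ∨ I = ⊤

namespace DescentDatum

variable (T : DescentDatum R L N ι)

/-- The comparison map of a space of invariants is injective. -/
theorem injective (hR : IsField R) {U : Submodule R N} (hU : ∀ x ∈ U, ∀ i, T.Φ i x = x) :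
    Function.Injective (U.subtype.liftBaseChange L) := by
  have := Module.free_of_isField (M := U) hR
  have := hR.nontrivial
  let b := Module.Free.chooseBasis R U
  refine liftBaseChange_injective_of_linearIndependent _ b ?_
  exact linearIndependent_of_fixed T.s T.Φ T.Φ_smul T.mem_range T.eq_bot_or_eq_top
    (fun i j => hU _ (b j).2 i) (b.linearIndependent.map' U.subtype U.ker_subtype)

/-- The comparison map of a space of invariants is bijective as soon as the invariants span. -/
theorem bijective (hR : IsField R) {U : Submodule R N} (hU : ∀ x ∈ U, ∀ i, T.Φ i x = x)
    (hspan : Submodule.span L (U : Set N) = ⊤) :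
    Function.Bijective (U.subtype.liftBaseChange L) := by
  refine ⟨T.injective hR hU, LinearMap.range_eq_top.1 ?_⟩
  rw [range_liftBaseChange, U.coe_subtype, Subtype.range_coe_subtype]
  exact hspan

/-- If `N = L ⊗ W` for a space `W` of invariants, then `W` is the space of all invariants. -/
theorem exists_eq_of_fixed {W : Type*} [AddCommMonoid W] [Module R W] (hR : IsField R)
    (f : W →ₗ[R] N) (hf : Function.Bijective (f.liftBaseChange L)) (hfix : ∀ w i, T.Φ i (f w) = f w)
    {x : N} (hx : ∀ i, T.Φ i x = x) : ∃ w, f w = x := by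
  have := Module.free_of_isField (M := W) hR
  let b := Module.Free.chooseBasis R W
  let B := (b.baseChange L).map (LinearEquiv.ofBijective _ hf)
  have hB (i) : B i = f (b i) := by
    simp [B]
  -- the coordinates of `x` in a basis of fixed vectors are invariant, hence belong to `R`
  have hΦ (i : ι) : (B.repr x).mapRange (T.s i) (map_zero _) = B.repr x := by
    apply B.repr.symm.injective
    rw [LinearEquiv.symm_apply_apply, B.repr_symm_apply]
    conv_rhs => rw [← hx i, ← B.linearCombination_repr x, Finsupp.linearCombination_apply,
      Finsupp.sum, map_sum]
    rw [Finsupp.linearCombination_apply, Finsupp.sum_mapRange_index (by simp), Finsupp.sum]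
    refine Finset.sum_congr rfl fun j _ => ?_
    rw [T.Φ_smul, hB, hfix]
  choose c hc using fun j => T.mem_range (B.repr x j) fun i => DFunLike.congr_fun (hΦ i) j
  refine ⟨∑ j ∈ (B.repr x).support, c j • b j, ?_⟩
  conv_rhs => rw [← B.linearCombination_repr x, Finsupp.linearCombination_apply, Finsupp.sum]
  rw [map_sum]
  refine Finset.sum_congr rfl fun j _ => ?_
  rw [map_smul, hB, ← hc j, algebraMap_smul]

end DescentDatum

end Invariants

/-! ### Regular triples -/

namespace SigmaTriple

variable {F E L : Type u} {G : Type w} [CommRing F] [CommRing E] [CommRing L]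
  [Algebra F E] [Algebra E L] [Algebra F L] [IsScalarTower F E L]
  [Group G] [MulSemiringAction G L] (T : SigmaTriple F E L G)

/-- A triple is regular if `F` and `E` are fields, namely the rings of invariants of `σ` and of `G`
in `L`, and if `L` has no nontrivial ideals stable under `σ` or under `G`. -/
structure IsRegular : Prop where
  nontrivial : Nontrivial L
  isField_left : IsField F
  isField_mid : IsField E
  mem_range_of_σ : ∀ l, T.σL l = l → l ∈ Set.range (algebraMap F L)
  mem_range_of_smul : ∀ l : L, (∀ g : G, g • l = l) → l ∈ Set.range (algebraMap E L)
  simple_σ : ∀ I : Ideal L, (∀ x ∈ I, T.σL x ∈ I) → I = ⊥ ∨ I = ⊤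
  simple_smul : ∀ I : Ideal L, (∀ g : G, ∀ x ∈ I, g • x ∈ I) → I = ⊥ ∨ I = ⊤

theorem phiL_smul_left (M : PhiMod T.σ) (l : L) (x : L ⊗[E] M) :
    T.phiL M (l • x) = T.σL l • T.phiL M x := by
  induction x using TensorProduct.induction_on with
  | zero => simp
  | add x y hx hy => simp only [map_add, smul_add, hx, hy]
  | tmul a m => simp [phiL, TensorProduct.smul_tmul']

theorem actL_smul_left (M : PhiMod T.σ) (g : G) (l : L) (x : L ⊗[E] M) :
    T.actL M g (l • x) = (g • l) • T.actL M g x := by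
  induction x using TensorProduct.induction_on with
  | zero => simp
  | add x y hx hy => simp only [map_add, smul_add, hx, hy]
  | tmul a m => simp [actL, TensorProduct.smul_tmul', smul_mul']

theorem sigmaRep_smul_left (W : Rep.{u} F G) (l : L) (x : L ⊗[F] W) :
    T.sigmaRep W (l • x) = T.σL l • T.sigmaRep W x := by
  induction x using TensorProduct.induction_on with
  | zero => simp
  | add x y hx hy => simp only [map_add, smul_add, hx, hy]
  | tmul a m => simp [sigmaRep, TensorProduct.smul_tmul']

theorem diagAct_smul_left (W : Rep.{u} F G) (g : G) (l : L) (x : L ⊗[F] W) :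
    T.diagAct W g (l • x) = (g • l) • T.diagAct W g x := by
  induction x using TensorProduct.induction_on with
  | zero => simp
  | add x y hx hy => simp only [map_add, smul_add, hx, hy]
  | tmul a m => simp [diagAct, TensorProduct.smul_tmul', smul_mul']

variable {T}

/-- The operator `σ ⊗ φ` on `L ⊗_E M`. -/
noncomputable def IsRegular.datumV (hT : T.IsRegular) (M : PhiMod T.σ) :
    DescentDatum F L (L ⊗[E] M) Unit where
  s _ := T.σL
  Φ _ := (T.phiL M).toAddMonoidHom
  Φ_smul _ := T.phiL_smul_left M
  mem_range l hl := hT.mem_range_of_σ l (hl ())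
  eq_bot_or_eq_top I hI := hT.simple_σ I (hI ())

/-- The operators `g ⊗ g` on `L ⊗_F W`. -/
noncomputable def IsRegular.datumD (hT : T.IsRegular) (W : Rep.{u} F G) :
    DescentDatum E L (L ⊗[F] W) G where
  s g := MulSemiringAction.toRingHom G L g
  Φ g := (T.diagAct W g).toAddMonoidHom
  Φ_smul g := T.diagAct_smul_left W g
  mem_range l hl := hT.mem_range_of_smul l hl
  eq_bot_or_eq_top I hI := hT.simple_smul I hI

theorem IsRegular.isTrivial_of_span (hT : T.IsRegular) {M : PhiMod T.σ} (hM : Module.Finite E M)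
    (hspan : Submodule.span L (T.fixed M : Set (L ⊗[E] M)) = ⊤) : T.IsTrivial M :=
  ⟨hM, (hT.datumV M).bijective hT.isField_left (fun _ hx _ => hx) hspan⟩

/-- The comparison isomorphism `L ⊗_F V(M) ≃ L ⊗_E M` of an `L`-trivial `φ`-module. -/
noncomputable def IsTrivial.equiv {M : PhiMod T.σ} (hM : T.IsTrivial M) :
    L ⊗[F] T.fixed M ≃ₗ[L] L ⊗[E] M :=
  LinearEquiv.ofBijective (T.comparison M) hM.2

theorem IsTrivial.equiv_tmul {M : PhiMod T.σ} (hM : T.IsTrivial M) (a : L) (x : T.fixed M) :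
    hM.equiv (a ⊗ₜ x) = a • (x : L ⊗[E] M) := LinearMap.liftBaseChange_tmul _ _ _ _

variable (T) in
/-- A representation is admissible if it is finite-dimensional and if `L ⊗_F W` is spanned by its
invariants. -/
def IsAdmissible (W : Rep.{u} F G) : Prop :=
  Module.Finite F W ∧ Submodule.span L (T.invariants W : Set (L ⊗[F] W)) = ⊤

/-- The comparison isomorphism `L ⊗_E D(W) ≃ L ⊗_F W` of an admissible representation. -/
noncomputable def IsAdmissible.equiv {W : Rep.{u} F G} (hW : T.IsAdmissible W)
    (hT : T.IsRegular) : L ⊗[E] T.invariants W ≃ₗ[L] L ⊗[F] W :=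
  LinearEquiv.ofBijective ((T.invariants W).subtype.liftBaseChange L)
    ((hT.datumD W).bijective hT.isField_mid (fun _ hx => hx) hW.2)

theorem IsAdmissible.equiv_tmul {W : Rep.{u} F G} (hW : T.IsAdmissible W)
    (hT : T.IsRegular) (a : L) (x : T.invariants W) :
    hW.equiv hT (a ⊗ₜ x) = a • (x : L ⊗[F] W) := LinearMap.liftBaseChange_tmul _ _ _ _

/-! ### The isomorphism `W ≅ V(D(W))` -/

section VD

variable {W W' : Rep.{u} F G} (hW : T.IsAdmissible W) (hW' : T.IsAdmissible W') (hT : T.IsRegular)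

theorem IsAdmissible.equiv_phiL (x : L ⊗[E] T.invariants W) :
    hW.equiv hT (T.phiL (T.D.obj W) x) = T.sigmaRep W (hW.equiv hT x) := by
  induction x using TensorProduct.induction_on with
  | zero =>
    exact (congrArg (hW.equiv hT) (map_zero (T.phiL (T.D.obj W)))).trans
      ((map_zero (hW.equiv hT)).trans (by simp only [map_zero]))
  | add x y hx hy =>
    refine (congrArg (hW.equiv hT) (map_add (T.phiL (T.D.obj W)) x y)).trans ?_
    exact ((map_add (hW.equiv hT) _ _).trans (congrArg₂ (· + ·) hx hy)).trans
      (by simp only [map_add])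
  | tmul a m =>
    rw [IsAdmissible.equiv_tmul, sigmaRep_smul_left]
    exact hW.equiv_tmul hT _ _

theorem IsAdmissible.equiv_actL (g : G) (x : L ⊗[E] T.invariants W) :
    hW.equiv hT (T.actL (T.D.obj W) g x) = T.diagAct W g (hW.equiv hT x) := by
  induction x using TensorProduct.induction_on with
  | zero =>
    exact (congrArg (hW.equiv hT) (map_zero (T.actL (T.D.obj W) g))).trans
      ((map_zero (hW.equiv hT)).trans (by simp only [map_zero]))
  | add x y hx hy =>
    refine (congrArg (hW.equiv hT) (map_add (T.actL (T.D.obj W) g) x y)).trans ?_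
    exact ((map_add (hW.equiv hT) _ _).trans (congrArg₂ (· + ·) hx hy)).trans
      (by simp only [map_add])
  | tmul a m =>
    rw [IsAdmissible.equiv_tmul, diagAct_smul_left, m.2 g]
    exact hW.equiv_tmul hT _ _

theorem IsAdmissible.equiv_mapL (f : W ⟶ W') (x : L ⊗[E] T.invariants W) :
    hW'.equiv hT (T.mapL (T.D.map f) x) = mapRep (E := E) f (hW.equiv hT x) := by
  induction x using TensorProduct.induction_on with
  | zero =>
    exact (congrArg (hW'.equiv hT) (map_zero (T.mapL (T.D.map f)))).trans
      ((map_zero (hW'.equiv hT)).trans (by simp only [map_zero]))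
  | add x y hx hy =>
    refine (congrArg (hW'.equiv hT) (map_add (T.mapL (T.D.map f)) x y)).trans ?_
    exact ((map_add (hW'.equiv hT) _ _).trans (congrArg₂ (· + ·) hx hy)).trans
      (by simp only [map_add])
  | tmul a m =>
    rw [IsAdmissible.equiv_tmul]
    refine (hW'.equiv_tmul hT _ _).trans ?_
    change a • mapRep (E := E) f m.1 = _
    generalize m.1 = y
    induction y using TensorProduct.induction_on with
    | zero => simp
    | add x y hx hy => simp only [map_add, smul_add, hx, hy]
    | tmul b w => simp [mapRep, TensorProduct.smul_tmul']

/-- The map `W → L ⊗_E D(W)` which corresponds to `w ↦ 1 ⊗ w` in `L ⊗_F W`. -/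
noncomputable def IsAdmissible.toVDLin : W →ₗ[F] L ⊗[E] T.invariants W :=
  ((hW.equiv hT).symm.toLinearMap.restrictScalars F) ∘ₗ TensorProduct.mk F L W 1

theorem IsAdmissible.equiv_toVDLin (w : W) : hW.equiv hT (hW.toVDLin hT w) = 1 ⊗ₜ w :=
  (hW.equiv hT).apply_symm_apply _

/-- The extension of `W → L ⊗_E D(W)` to `L ⊗_F W` is the inverse of the comparison isomorphism. -/
theorem IsAdmissible.toVDLin_bijective :
    Function.Bijective ((hW.toVDLin hT).liftBaseChange L) := by
  have : (hW.toVDLin hT).liftBaseChange L = (hW.equiv hT).symm.toLinearMap := by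
    refine TensorProduct.AlgebraTensorModule.ext fun a w => ?_
    rw [LinearMap.liftBaseChange_tmul]
    apply (hW.equiv hT).injective
    rw [map_smul, hW.equiv_toVDLin, LinearEquiv.coe_coe, LinearEquiv.apply_symm_apply,
      TensorProduct.smul_tmul', smul_eq_mul, mul_one]
  rw [this]
  exact (hW.equiv hT).symm.bijective

theorem IsAdmissible.phiL_toVDLin (w : W) :
    T.phiL (T.D.obj W) (hW.toVDLin hT w) = hW.toVDLin hT w := by
  apply (hW.equiv hT).injective
  rw [IsAdmissible.equiv_phiL, IsAdmissible.equiv_toVDLin]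
  simp [sigmaRep]

include hW hT in
/-- `D(W)` is trivial: `L ⊗_E D(W) = L ⊗_F W` is spanned by the elements `1 ⊗ w`, which are fixed
by `σ ⊗ id`. -/
theorem IsAdmissible.isTrivial_D : T.IsTrivial (T.D.obj W) := by
  have := hT.nontrivial
  refine hT.isTrivial_of_span ?_ ?_
  · have := hW.1
    have h1 := Module.Finite.equiv (hW.equiv hT).symm
    have := Module.free_of_isField (M := T.invariants W) hT.isField_mid
    have h2 : Module.Finite E (T.invariants W) := finite_of_baseChange_finite h1
    exact h2
  · change Submodule.span L ({x | T.phiL (T.D.obj W) x = x} : Set (L ⊗[E] T.invariants W)) = ⊤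
    rw [eq_top_iff, ← LinearMap.range_eq_top.2 (hW.toVDLin_bijective hT).surjective,
      range_liftBaseChange]
    refine Submodule.span_mono ?_
    rintro _ ⟨w, rfl⟩
    exact hW.phiL_toVDLin hT w

/-- `W` is the space `V(D(W))`. -/
noncomputable def IsAdmissible.linVD {W : Rep.{u} F G} (hW : T.IsAdmissible W) (hT : T.IsRegular) :
    W ≃ₗ[F] T.fixed (T.D.obj W) :=
  LinearEquiv.ofBijective
    ((hW.toVDLin hT).codRestrict (T.fixed (T.D.obj W)) (hW.phiL_toVDLin hT)) <| by
    have := hT.nontrivial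
    refine ⟨fun x y hxy => injective_of_liftBaseChange_bijective hT.isField_left (hW.toVDLin hT)
      (hW.toVDLin_bijective hT) (congrArg Subtype.val hxy), fun x => ?_⟩
    let d : DescentDatum F L (L ⊗[E] T.invariants W) Unit := hT.datumV (T.D.obj W)
    obtain ⟨w, hw⟩ := d.exists_eq_of_fixed hT.isField_left
      (hW.toVDLin hT) (hW.toVDLin_bijective hT) (fun w _ => hW.phiL_toVDLin hT w)
      (x := x.1) (fun _ => x.2)
    exact ⟨w, Subtype.ext hw⟩

/-- `W` and `V(D(W))` are equivalent representations. -/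
noncomputable def IsAdmissible.equivVD {W : Rep.{u} F G} (hW : T.IsAdmissible W)
    (hT : T.IsRegular) : W.ρ.Equiv (T.galoisRep (T.D.obj W)) :=
  Representation.Equiv.mk (hW.linVD hT) fun g =>
    LinearMap.ext fun w => Subtype.ext (by
      apply (hW.equiv hT).injective
      change hW.equiv hT (hW.toVDLin hT (W.ρ g w)) =
        hW.equiv hT (T.actL (T.D.obj W) g (hW.toVDLin hT w))
      rw [hW.equiv_actL, hW.equiv_toVDLin, hW.equiv_toVDLin]
      simp [diagAct])

/-- The natural isomorphism `W ≅ V(D(W))` of an admissible representation. -/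
noncomputable def IsAdmissible.isoVD {W : Rep.{u} F G} (hW : T.IsAdmissible W)
    (hT : T.IsRegular) : W ≅ T.V.obj (T.D.obj W) :=
  Rep.mkIso (hW.equivVD hT)

theorem IsAdmissible.isoVD_naturality (f : W ⟶ W') :
    f ≫ (hW'.isoVD hT).hom = (hW.isoVD hT).hom ≫ T.V.map (T.D.map f) := by
  refine Rep.hom_ext (Representation.IntertwiningMap.ext (LinearMap.ext fun w => Subtype.ext ?_))
  apply (hW'.equiv hT).injective
  change hW'.equiv hT (hW'.toVDLin hT (f.hom w)) =
    hW'.equiv hT (T.mapL (T.D.map f) (hW.toVDLin hT w))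
  rw [hW.equiv_mapL hW', hW.equiv_toVDLin, hW'.equiv_toVDLin]
  rfl

end VD

/-! ### The isomorphism `M ≅ D(V(M))` -/

section DV

variable {M M' : PhiMod T.σ} (hM : T.IsTrivial M) (hM' : T.IsTrivial M') (hT : T.IsRegular)

theorem IsTrivial.equiv_diagAct (g : G) (x : L ⊗[F] T.fixed M) :
    hM.equiv (T.diagAct (T.V.obj M) g x) = T.actL M g (hM.equiv x) := by
  induction x using TensorProduct.induction_on with
  | zero =>
    exact (congrArg (hM.equiv) (map_zero (T.diagAct (T.V.obj M) g))).trans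
      ((map_zero (hM.equiv)).trans (by simp only [map_zero]))
  | add x y hx hy =>
    refine (congrArg (hM.equiv) (map_add (T.diagAct (T.V.obj M) g) x y)).trans ?_
    exact ((map_add (hM.equiv) _ _).trans (congrArg₂ (· + ·) hx hy)).trans
      (by simp only [map_add])
  | tmul a m =>
    rw [hM.equiv_tmul, actL_smul_left]
    exact hM.equiv_tmul _ _

theorem IsTrivial.equiv_sigmaRep (x : L ⊗[F] T.fixed M) :
    hM.equiv (T.sigmaRep (T.V.obj M) x) = T.phiL M (hM.equiv x) := by
  induction x using TensorProduct.induction_on with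
  | zero =>
    exact (congrArg (hM.equiv) (map_zero (T.sigmaRep (T.V.obj M)))).trans
      ((map_zero (hM.equiv)).trans (by simp only [map_zero]))
  | add x y hx hy =>
    refine (congrArg (hM.equiv) (map_add (T.sigmaRep (T.V.obj M)) x y)).trans ?_
    exact ((map_add (hM.equiv) _ _).trans (congrArg₂ (· + ·) hx hy)).trans
      (by simp only [map_add])
  | tmul a m =>
    rw [hM.equiv_tmul, phiL_smul_left, show T.phiL M m = m from m.2]
    exact hM.equiv_tmul _ _

theorem IsTrivial.equiv_mapRep (f : M ⟶ M') (x : L ⊗[F] T.fixed M) :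
    hM'.equiv (mapRep (E := E) (T.V.map f) x) = T.mapL f (hM.equiv x) := by
  induction x using TensorProduct.induction_on with
  | zero =>
    exact (congrArg (hM'.equiv) (map_zero (mapRep (E := E) (T.V.map f)))).trans
      ((map_zero (hM'.equiv)).trans (by simp only [map_zero]))
  | add x y hx hy =>
    refine (congrArg (hM'.equiv) (map_add (mapRep (E := E) (T.V.map f)) x y)).trans ?_
    exact ((map_add (hM'.equiv) _ _).trans (congrArg₂ (· + ·) hx hy)).trans
      (by simp only [map_add])
  | tmul a m =>
    rw [hM.equiv_tmul]
    refine (hM'.equiv_tmul _ _).trans ?_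
    change a • T.mapL f m.1 = _
    generalize m.1 = y
    induction y using TensorProduct.induction_on with
    | zero => simp
    | add x y hx hy => simp only [map_add, smul_add, hx, hy]
    | tmul b w => simp [mapL, TensorProduct.smul_tmul']

/-- The map `M → L ⊗_F V(M)` which corresponds to `m ↦ 1 ⊗ m` in `L ⊗_E M`. -/
noncomputable def IsTrivial.toDVLin : M →ₗ[E] L ⊗[F] T.fixed M :=
  (hM.equiv.symm.toLinearMap.restrictScalars E) ∘ₗ TensorProduct.mk E L M 1

theorem IsTrivial.equiv_toDVLin (m : M) : hM.equiv (hM.toDVLin m) = 1 ⊗ₜ m :=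
  hM.equiv.apply_symm_apply _

/-- The extension of `M → L ⊗_F V(M)` to `L ⊗_E M` is the inverse of the comparison isomorphism. -/
theorem IsTrivial.toDVLin_bijective :
    Function.Bijective (hM.toDVLin.liftBaseChange L) := by
  have : hM.toDVLin.liftBaseChange L = hM.equiv.symm.toLinearMap := by
    refine TensorProduct.AlgebraTensorModule.ext fun a m => ?_
    rw [LinearMap.liftBaseChange_tmul]
    apply hM.equiv.injective
    rw [map_smul, hM.equiv_toDVLin, LinearEquiv.coe_coe, LinearEquiv.apply_symm_apply,
      TensorProduct.smul_tmul', smul_eq_mul, mul_one]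
  rw [this]
  exact hM.equiv.symm.bijective

theorem IsTrivial.diagAct_toDVLin (m : M) (g : G) :
    T.diagAct (T.V.obj M) g (hM.toDVLin m) = hM.toDVLin m := by
  apply hM.equiv.injective
  rw [hM.equiv_diagAct, hM.equiv_toDVLin]
  simp [actL]

include hM hT in
theorem IsTrivial.finite_fixed : Module.Finite F (T.fixed M) := by
  have := hT.nontrivial
  have := hM.1
  have := Module.free_of_isField (M := T.fixed M) hT.isField_left
  have h1 : Module.Finite L (L ⊗[F] T.fixed M) := Module.Finite.equiv hM.equiv.symm
  exact finite_of_baseChange_finite h1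

/-- The isomorphism of `M` with `D(V(M))`. -/
noncomputable def IsTrivial.linDV {M : PhiMod T.σ} (hM : T.IsTrivial M) (hT : T.IsRegular) :
    M ≃ₗ[E] T.invariants (T.V.obj M) :=
  LinearEquiv.ofBijective
    (hM.toDVLin.codRestrict (T.invariants (T.V.obj M)) hM.diagAct_toDVLin) <| by
    have := hT.nontrivial
    refine ⟨fun x y hxy => injective_of_liftBaseChange_bijective hT.isField_mid hM.toDVLin
      hM.toDVLin_bijective (congrArg Subtype.val hxy), fun x => ?_⟩
    let d : DescentDatum E L (L ⊗[F] T.fixed M) G := hT.datumD (T.V.obj M)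
    obtain ⟨w, hw⟩ := d.exists_eq_of_fixed hT.isField_mid
      hM.toDVLin hM.toDVLin_bijective hM.diagAct_toDVLin (x := x.1) x.2
    exact ⟨w, Subtype.ext hw⟩

/-- The natural isomorphism `M ≅ D(V(M))` of an `L`-trivial `φ`-module. -/
noncomputable def IsTrivial.isoDV {M : PhiMod T.σ} (hM : T.IsTrivial M) (hT : T.IsRegular) :
    M ≅ T.D.obj (T.V.obj M) :=
  PhiMod.mkIso (M := M) (N := T.D.obj (T.V.obj M)) (hM.linDV hT) fun m => Subtype.ext (by
    apply hM.equiv.injective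
    change hM.equiv (hM.toDVLin (M.φ m)) = hM.equiv (T.sigmaRep (T.V.obj M) (hM.toDVLin m))
    rw [hM.equiv_sigmaRep, hM.equiv_toDVLin, hM.equiv_toDVLin]
    simp [phiL])

theorem IsTrivial.isoDV_naturality (f : M ⟶ M') :
    f ≫ (hM'.isoDV hT).hom = (hM.isoDV hT).hom ≫ T.D.map (T.V.map f) := by
  refine PhiMod.hom_ext (LinearMap.ext fun w => Subtype.ext ?_)
  apply hM'.equiv.injective
  change hM'.equiv (hM'.toDVLin (f.lin w)) =
    hM'.equiv (mapRep (E := E) (T.V.map f) (hM.toDVLin w))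
  rw [hM.equiv_mapRep hM', hM.equiv_toDVLin, hM'.equiv_toDVLin]
  simp [mapL]

end DV

/-- `V` and `D` are quasi-inverse equivalences between `L`-trivial `φ`-modules and a class of
admissible representations which contains the essential image of `V`. -/
theorem IsRegular.exists_equivalence (hT : T.IsRegular) (P : ObjectProperty (Rep.{u} F G))
    (hP : ∀ W, P W → T.IsAdmissible W) (hV : ∀ M, T.IsTrivial M → P (T.V.obj M))
    (hD : ∀ W, P W → T.IsTrivial (T.D.obj W)) :
    ∃ e : T.IsTrivial.FullSubcategory ≌ P.FullSubcategory,
      e.functor = T.VRes P hV ∧ e.inverse = T.DRes P hD := by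
  let η : 𝟭 T.IsTrivial.FullSubcategory ≅ T.VRes P hV ⋙ T.DRes P hD :=
    NatIso.ofComponents (fun M => T.IsTrivial.isoMk (IsTrivial.isoDV M.property hT)) fun {M M'} f =>
      ObjectProperty.hom_ext _ (IsTrivial.isoDV_naturality M.property M'.property hT f.hom)
  let ε : 𝟭 P.FullSubcategory ≅ T.DRes P hD ⋙ T.VRes P hV :=
    NatIso.ofComponents (fun W => P.isoMk (IsAdmissible.isoVD (hP _ W.property) hT))
      fun {W W'} f => ObjectProperty.hom_ext _
        (IsAdmissible.isoVD_naturality (hP _ W.property) (hP _ W'.property) hT f.hom)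
  exact ⟨CategoryTheory.Equivalence.mk (T.VRes P hV) (T.DRes P hD) η ε.symm, rfl, rfl⟩

end SigmaTriple

/-! ### `V` is a tensor functor -/

theorem Rep.isIso_of_bijective {k : Type u} {G : Type w} [CommRing k] [Group G] {X Y : Rep.{u} k G}
    (f : X ⟶ Y) (h : Function.Bijective f.hom) : IsIso f := by
  let e : X.ρ.Equiv Y.ρ := Representation.Equiv.mk (LinearEquiv.ofBijective f.hom.toLinearMap h)
    f.hom.isIntertwining'
  have h1 : f = (Rep.mkIso e).hom := by
    refine Rep.hom_ext (Representation.IntertwiningMap.ext (LinearMap.ext fun x => ?_))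
    rfl
  rw [h1]
  infer_instance

/-- The pure tensor of elements of two `φ`-modules. -/
noncomputable def PhiMod.tmul {A : Type u} [CommRing A] {σ : A →+* A} {M N : PhiMod σ} (m : M)
    (n : N) : (M ⊗ N : PhiMod σ) :=
  TensorProduct.tmul A m n

/-- The element `1` of the unit `φ`-module. -/
def PhiMod.unitOne {A : Type u} [CommRing A] (σ : A →+* A) : 𝟙_ (PhiMod σ) :=
  (1 : A)

namespace SigmaTriple

variable {F E L : Type u} {G : Type w} [CommRing F] [CommRing E] [CommRing L]
  [Algebra F E] [Algebra E L] [Algebra F L] [IsScalarTower F E L]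
  [Group G] [MulSemiringAction G L] (T : SigmaTriple F E L G)

section Mul

variable (M N P : PhiMod T.σ)

/-- The multiplication `(a ⊗ m, b ⊗ n) ↦ ab ⊗ (m ⊗ n)`. -/
noncomputable def mulL :
    (L ⊗[E] M) →ₗ[L] (L ⊗[E] N) →ₗ[L] L ⊗[E] (M ⊗ N : PhiMod T.σ) :=
  (TensorProduct.mk L (L ⊗[E] M) (L ⊗[E] N)).compr₂
    (AlgebraTensorModule.distribBaseChange E L M N).symm.toLinearMap

variable {M N P}

theorem mulL_tmul (a b : L) (m : M) (n : N) :
    T.mulL M N (a ⊗ₜ m) (b ⊗ₜ n) =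
      (a * b) ⊗ₜ[E] PhiMod.tmul m n :=
  AlgebraTensorModule.distribBaseChange_symm_tmul E L m n a b

theorem phiL_mulL (x : L ⊗[E] M) (y : L ⊗[E] N) :
    T.phiL (M ⊗ N) (T.mulL M N x y) = T.mulL M N (T.phiL M x) (T.phiL N y) := by
  induction x using TensorProduct.induction_on with
  | zero => simp only [map_zero, LinearMap.zero_apply]
  | add x x' hx hx' => simp only [map_add, LinearMap.add_apply, hx, hx']
  | tmul a m =>
    induction y using TensorProduct.induction_on with
    | zero => simp only [map_zero]
    | add y y' hy hy' => simp only [map_add, hy, hy']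
    | tmul b n =>
      rw [mulL_tmul]
      exact Eq.trans (congrArg (· ⊗ₜ[E] _) (map_mul T.σL a b)) (T.mulL_tmul _ _ _ _).symm

theorem actL_mulL (g : G) (x : L ⊗[E] M) (y : L ⊗[E] N) :
    T.actL (M ⊗ N) g (T.mulL M N x y) = T.mulL M N (T.actL M g x) (T.actL N g y) := by
  induction x using TensorProduct.induction_on with
  | zero => simp only [map_zero, LinearMap.zero_apply]
  | add x x' hx hx' => simp only [map_add, LinearMap.add_apply, hx, hx']
  | tmul a m =>
    induction y using TensorProduct.induction_on with
    | zero => simp only [map_zero]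
    | add y y' hy hy' => simp only [map_add, hy, hy']
    | tmul b n =>
      rw [mulL_tmul]
      exact Eq.trans (congrArg (· ⊗ₜ[E] _) (smul_mul' g a b)) (T.mulL_tmul _ _ _ _).symm

theorem mapL_whiskerRight_mulL (f : M ⟶ N) (x : L ⊗[E] M) (y : L ⊗[E] P) :
    T.mapL (f ▷ P) (T.mulL M P x y) = T.mulL N P (T.mapL f x) y := by
  induction x using TensorProduct.induction_on with
  | zero => simp only [map_zero, LinearMap.zero_apply]
  | add x x' hx hx' => simp only [map_add, LinearMap.add_apply, hx, hx']
  | tmul a m =>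
    induction y using TensorProduct.induction_on with
    | zero => simp only [map_zero]
    | add y y' hy hy' => simp only [map_add, hy, hy']
    | tmul b n =>
      rw [mulL_tmul]
      exact (T.mulL_tmul (M := N) (N := P) _ _ _ _).symm

theorem mapL_whiskerLeft_mulL (f : M ⟶ N) (x : L ⊗[E] P) (y : L ⊗[E] M) :
    T.mapL (P ◁ f) (T.mulL P M x y) = T.mulL P N x (T.mapL f y) := by
  induction x using TensorProduct.induction_on with
  | zero => simp only [map_zero, LinearMap.zero_apply]
  | add x x' hx hx' => simp only [map_add, LinearMap.add_apply, hx, hx']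
  | tmul a m =>
    induction y using TensorProduct.induction_on with
    | zero => simp only [map_zero]
    | add y y' hy hy' => simp only [map_add, hy, hy']
    | tmul b n =>
      rw [mulL_tmul]
      exact (T.mulL_tmul (M := P) (N := N) _ _ _ _).symm

theorem mapL_braiding_mulL (x : L ⊗[E] M) (y : L ⊗[E] N) :
    T.mapL (β_ M N).hom (T.mulL M N x y) = T.mulL N M y x := by
  induction x using TensorProduct.induction_on with
  | zero => simp only [map_zero, LinearMap.zero_apply]
  | add x x' hx hx' => simp only [map_add, LinearMap.add_apply, hx, hx']
  | tmul a m =>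
    induction y using TensorProduct.induction_on with
    | zero => simp only [map_zero, LinearMap.zero_apply]
    | add y y' hy hy' => simp only [map_add, LinearMap.add_apply, hy, hy']
    | tmul b n =>
      rw [mulL_tmul, mulL_tmul, mul_comm b a]
      rfl

theorem mapL_associator_mulL (x : L ⊗[E] M) (y : L ⊗[E] N) (z : L ⊗[E] P) :
    T.mapL (α_ M N P).hom (T.mulL (M ⊗ N) P (T.mulL M N x y) z) =
      T.mulL M (N ⊗ P) x (T.mulL N P y z) := by
  induction x using TensorProduct.induction_on with
  | zero => simp only [map_zero, LinearMap.zero_apply]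
  | add x x' hx hx' => simp only [map_add, LinearMap.add_apply, hx, hx']
  | tmul a m =>
    induction y using TensorProduct.induction_on with
    | zero => simp only [map_zero, LinearMap.zero_apply]
    | add y y' hy hy' => simp only [map_add, LinearMap.add_apply, hy, hy']
    | tmul b n =>
      induction z using TensorProduct.induction_on with
      | zero => simp only [map_zero]
      | add z z' hz hz' => simp only [map_add, hz, hz']
      | tmul c p =>
        rw [mulL_tmul, mulL_tmul, mulL_tmul, mulL_tmul, ← mul_assoc]
        rfl

theorem mapL_leftUnitor_mulL (x : L ⊗[E] M) :
    T.mapL (λ_ M).hom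
      (T.mulL (𝟙_ (PhiMod T.σ)) M ((1 : L) ⊗ₜ[E] PhiMod.unitOne T.σ) x) = x := by
  induction x using TensorProduct.induction_on with
  | zero => simp only [map_zero]
  | add x x' hx hx' => simp only [map_add, hx, hx']
  | tmul a m =>
    rw [mulL_tmul, one_mul]
    exact congrArg (a ⊗ₜ[E] ·) (one_smul E m)

theorem mapL_rightUnitor_mulL (x : L ⊗[E] M) :
    T.mapL (ρ_ M).hom
      (T.mulL M (𝟙_ (PhiMod T.σ)) x ((1 : L) ⊗ₜ[E] PhiMod.unitOne T.σ)) = x := by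
  induction x using TensorProduct.induction_on with
  | zero => simp only [map_zero, LinearMap.zero_apply]
  | add x x' hx hx' => simp only [map_add, LinearMap.add_apply, hx, hx']
  | tmul a m =>
    rw [mulL_tmul, mul_one]
    exact congrArg (a ⊗ₜ[E] ·) (one_smul E m)

variable (M N)

/-- The map `V(M) ⊗_F V(N) → L ⊗_E (M ⊗_E N)`, `x ⊗ y ↦ xy`. -/
noncomputable def tensorLin :
    T.fixed M ⊗[F] T.fixed N →ₗ[F] L ⊗[E] (M ⊗ N : PhiMod T.σ) :=
  TensorProduct.lift <| LinearMap.mk₂ F (fun x y => T.mulL M N x.1 y.1)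
    (fun x x' y => by simp only [Submodule.coe_add, map_add, LinearMap.add_apply])
    (fun c x y => by
      rw [Submodule.coe_smul, LinearMap.map_smul_of_tower, LinearMap.smul_apply])
    (fun x y y' => by simp only [Submodule.coe_add, map_add])
    (fun c x y => by rw [Submodule.coe_smul, LinearMap.map_smul_of_tower])

variable {M N}

theorem tensorLin_tmul (x : T.fixed M) (y : T.fixed N) :
    T.tensorLin M N (x ⊗ₜ y) = T.mulL M N x.1 y.1 := rfl

theorem phiL_tensorLin (z : T.fixed M ⊗[F] T.fixed N) :
    T.phiL (M ⊗ N) (T.tensorLin M N z) = T.tensorLin M N z := by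
  induction z using TensorProduct.induction_on with
  | zero => simp only [map_zero]
  | add z z' hz hz' => simp only [map_add, hz, hz']
  | tmul x y =>
    rw [tensorLin_tmul, phiL_mulL, show T.phiL M x.1 = x.1 from x.2,
      show T.phiL N y.1 = y.1 from y.2]

variable (M N)

/-- The map `V(M) ⊗_F V(N) → V(M ⊗_E N)`, `x ⊗ y ↦ xy`. -/
noncomputable def tensorRep :
    ((T.galoisRep M).tprod (T.galoisRep N)).IntertwiningMap (T.galoisRep (M ⊗ N)) where
  __ := (T.tensorLin M N).codRestrict (T.fixed (M ⊗ N)) T.phiL_tensorLin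
  isIntertwining' g := by
    refine TensorProduct.ext' fun x y => Subtype.ext ?_
    exact (T.actL_mulL g x.1 y.1).symm

/-- The map `F → L ⊗_E E`, `c ↦ c • (1 ⊗ 1)`. -/
noncomputable def unitLin : F →ₗ[F] L ⊗[E] 𝟙_ (PhiMod T.σ) :=
  LinearMap.toSpanSingleton F _ ((1 : L) ⊗ₜ[E] PhiMod.unitOne T.σ)

theorem phiL_unitLin (c : F) : T.phiL (𝟙_ (PhiMod T.σ)) (T.unitLin c) = T.unitLin c := by
  rw [unitLin, LinearMap.toSpanSingleton_apply, phiL_smul]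
  congr 1
  exact congrArg₂ (fun (a : L) (e : E) => a ⊗ₜ[E] (e : 𝟙_ (PhiMod T.σ))) (map_one T.σL)
    (map_one T.σ)

theorem actL_unitLin (g : G) (c : F) :
    T.actL (𝟙_ (PhiMod T.σ)) g (T.unitLin c) = T.unitLin c := by
  rw [unitLin, LinearMap.toSpanSingleton_apply, LinearMap.map_smul_of_tower]
  congr 1
  change (g • 1 : L) ⊗ₜ[E] PhiMod.unitOne T.σ = _
  rw [smul_one]

/-- The map `F → V(E)`, `c ↦ c • (1 ⊗ 1)`. -/
noncomputable def unitRep :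
    (Representation.trivial F G F).IntertwiningMap (T.galoisRep (𝟙_ (PhiMod T.σ))) where
  __ := T.unitLin.codRestrict (T.fixed (𝟙_ (PhiMod T.σ))) T.phiL_unitLin
  isIntertwining' g := LinearMap.ext fun c => Subtype.ext (T.actL_unitLin g c).symm

/-- The morphism `V(M) ⊗ V(N) ⟶ V(M ⊗ N)`, `x ⊗ y ↦ xy`. -/
noncomputable def tensorHomV : T.V.obj M ⊗ T.V.obj N ⟶ T.V.obj (M ⊗ N) :=
  Rep.ofHom (T.tensorRep M N)

/-- The morphism `𝟙_ ⟶ V(𝟙_)`, `c ↦ c • (1 ⊗ 1)`. -/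
noncomputable def unitHomV : 𝟙_ (Rep.{u} F G) ⟶ T.V.obj (𝟙_ (PhiMod T.σ)) :=
  Rep.ofHom T.unitRep

variable {M N}

theorem tensorHomV_natural_left (f : M ⟶ N) (P : PhiMod T.σ) :
    T.V.map f ▷ T.V.obj P ≫ T.tensorHomV N P = T.tensorHomV M P ≫ T.V.map (f ▷ P) :=
  Rep.hom_ext <| Representation.IntertwiningMap.ext <| TensorProduct.ext'
    fun (x : T.fixed M) (y : T.fixed P) => Subtype.ext (T.mapL_whiskerRight_mulL f x.1 y.1).symm

theorem tensorHomV_natural_right (P : PhiMod T.σ) (f : M ⟶ N) :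
    T.V.obj P ◁ T.V.map f ≫ T.tensorHomV P N = T.tensorHomV P M ≫ T.V.map (P ◁ f) :=
  Rep.hom_ext <| Representation.IntertwiningMap.ext <| TensorProduct.ext'
    fun (x : T.fixed P) (y : T.fixed M) => Subtype.ext (T.mapL_whiskerLeft_mulL f x.1 y.1).symm

variable (M N P)

theorem tensorHomV_braiding :
    T.tensorHomV M N ≫ T.V.map (β_ M N).hom =
      (β_ (T.V.obj M) (T.V.obj N)).hom ≫ T.tensorHomV N M :=
  Rep.hom_ext <| Representation.IntertwiningMap.ext <| TensorProduct.ext'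
    fun (x : T.fixed M) (y : T.fixed N) => Subtype.ext (T.mapL_braiding_mulL x.1 y.1)

theorem tensorHomV_associativity :
    T.tensorHomV M N ▷ T.V.obj P ≫ T.tensorHomV (M ⊗ N) P ≫ T.V.map (α_ M N P).hom =
      (α_ (T.V.obj M) (T.V.obj N) (T.V.obj P)).hom ≫
        T.V.obj M ◁ T.tensorHomV N P ≫ T.tensorHomV M (N ⊗ P) :=
  Rep.hom_ext <| Representation.IntertwiningMap.ext <| TensorProduct.ext_threefold
    fun (x : T.fixed M) (y : T.fixed N) (z : T.fixed P) =>
      Subtype.ext (T.mapL_associator_mulL x.1 y.1 z.1)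

theorem unitHomV_left :
    (λ_ (T.V.obj M)).hom = T.unitHomV ▷ T.V.obj M ≫ T.tensorHomV (𝟙_ (PhiMod T.σ)) M ≫
      T.V.map (λ_ M).hom := by
  refine Rep.hom_ext (Representation.IntertwiningMap.ext (TensorProduct.ext'
    fun (c : F) (x : T.fixed M) => Subtype.ext ?_))
  change c • x.1 = T.mapL (λ_ M).hom (T.mulL (𝟙_ (PhiMod T.σ)) M (T.unitLin c) x.1)
  rw [unitLin, LinearMap.toSpanSingleton_apply, LinearMap.map_smul_of_tower,
    LinearMap.smul_apply, LinearMap.map_smul_of_tower, mapL_leftUnitor_mulL]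

theorem unitHomV_right :
    (ρ_ (T.V.obj M)).hom = T.V.obj M ◁ T.unitHomV ≫ T.tensorHomV M (𝟙_ (PhiMod T.σ)) ≫
      T.V.map (ρ_ M).hom := by
  refine Rep.hom_ext (Representation.IntertwiningMap.ext (TensorProduct.ext'
    fun (x : T.fixed M) (c : F) => Subtype.ext ?_))
  change c • x.1 = T.mapL (ρ_ M).hom (T.mulL M (𝟙_ (PhiMod T.σ)) x.1 (T.unitLin c))
  rw [unitLin, LinearMap.toSpanSingleton_apply, LinearMap.map_smul_of_tower,
    LinearMap.map_smul_of_tower, mapL_rightUnitor_mulL]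

end Mul

/-- The lax monoidal structure `x ⊗ y ↦ xy` of `V`. -/
noncomputable instance : T.V.LaxMonoidal where
  ε := T.unitHomV
  μ := T.tensorHomV
  μ_natural_left := T.tensorHomV_natural_left
  μ_natural_right := T.tensorHomV_natural_right
  associativity := T.tensorHomV_associativity
  left_unitality := T.unitHomV_left
  right_unitality := T.unitHomV_right

/-- The tensor structure of `V` is symmetric. -/
noncomputable instance : T.V.LaxBraided where
  braided := T.tensorHomV_braiding

theorem isNaturalTensorMap_μ (M N : PhiMod T.σ) :
    T.IsNaturalTensorMap M N (Functor.LaxMonoidal.μ T.V M N) :=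
  fun _ _ => (AlgebraTensorModule.distribBaseChange E L M N).apply_symm_apply _

variable {T}

/-- Over `L`, the map `V(M) ⊗ V(N) → L ⊗_E (M ⊗ N)` becomes the tensor product of the comparison
isomorphisms of `M` and `N`. -/
theorem IsTrivial.tensorLin_bijective {M N : PhiMod T.σ} (hM : T.IsTrivial M)
    (hN : T.IsTrivial N) : Function.Bijective ((T.tensorLin M N).liftBaseChange L) := by
  let e : L ⊗[F] (T.fixed M ⊗[F] T.fixed N) ≃ₗ[L] L ⊗[E] (M ⊗ N : PhiMod T.σ) :=
    AlgebraTensorModule.distribBaseChange F L (T.fixed M) (T.fixed N) ≪≫ₗ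
      TensorProduct.congr hM.equiv hN.equiv ≪≫ₗ
        (AlgebraTensorModule.distribBaseChange E L M N).symm
  have : (T.tensorLin M N).liftBaseChange L = e.toLinearMap := by
    refine TensorProduct.AlgebraTensorModule.ext fun a z => ?_
    rw [LinearMap.liftBaseChange_tmul]
    induction z using TensorProduct.induction_on with
    | zero =>
      rw [map_zero, smul_zero, tmul_zero]
      exact (map_zero e).symm
    | add x y hx hy =>
      rw [map_add, smul_add, hx, hy, tmul_add]
      exact (map_add e _ _).symm
    | tmul x y =>
      rw [tensorLin_tmul]
      change _ = (AlgebraTensorModule.distribBaseChange E L M N).symm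
        (hM.equiv (a ⊗ₜ x) ⊗ₜ hN.equiv (1 ⊗ₜ y))
      rw [hM.equiv_tmul, hN.equiv_tmul, one_smul, ← TensorProduct.smul_tmul', map_smul]
      rfl
  rw [this]
  exact e.bijective

theorem unitLin_bijective : Function.Bijective (T.unitLin.liftBaseChange L) := by
  let e : L ⊗[F] F ≃ₗ[L] L ⊗[E] E :=
    AlgebraTensorModule.rid F L L ≪≫ₗ (AlgebraTensorModule.rid E L L).symm
  have : T.unitLin.liftBaseChange L = e.toLinearMap := by
    refine TensorProduct.AlgebraTensorModule.ext fun a c => ?_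
    rw [LinearMap.liftBaseChange_tmul, unitLin, LinearMap.toSpanSingleton_apply]
    change a • c • ((1 : L) ⊗ₜ[E] (1 : E)) = (c • a) ⊗ₜ[E] (1 : E)
    rw [TensorProduct.smul_tmul', TensorProduct.smul_tmul', smul_eq_mul, mul_smul_comm, mul_one]
  rw [this]
  exact e.bijective

variable (hT : T.IsRegular)

include hT

/-- A map from an `F`-space into the invariants which becomes bijective over `L` is a bijection
onto the invariants. -/
theorem IsRegular.codRestrict_bijective {M : PhiMod T.σ} {U : Type*} [AddCommMonoid U] [Module F U]
    (f : U →ₗ[F] L ⊗[E] M) (hf : Function.Bijective (f.liftBaseChange L))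
    (hfix : ∀ x, T.phiL M (f x) = f x) :
    Function.Bijective (f.codRestrict (T.fixed M) hfix) := by
  have := hT.nontrivial
  refine ⟨fun x y hxy => injective_of_liftBaseChange_bijective hT.isField_left f hf
    (congrArg Subtype.val hxy), fun x => ?_⟩
  obtain ⟨w, hw⟩ := (hT.datumV M).exists_eq_of_fixed hT.isField_left f hf (fun w _ => hfix w)
    (x := x.1) (fun _ => x.2)
  exact ⟨w, Subtype.ext hw⟩

/-- `M` is trivial if `L ⊗_E M` arises by base change to `L` from some space of fixed vectors. -/
theorem IsRegular.isTrivial_of_bijective {M : PhiMod T.σ} (hM : Module.Finite E M) {U : Type*}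
    [AddCommMonoid U] [Module F U] (f : U →ₗ[F] L ⊗[E] M)
    (hf : Function.Bijective (f.liftBaseChange L)) (hfix : ∀ x, T.phiL M (f x) = f x) :
    T.IsTrivial M := by
  refine hT.isTrivial_of_span hM ?_
  rw [eq_top_iff, ← LinearMap.range_eq_top.2 hf.surjective, range_liftBaseChange]
  refine Submodule.span_mono ?_
  rintro _ ⟨z, rfl⟩
  exact hfix z

theorem IsRegular.isMonoidal_isTrivial : T.IsTrivial.IsMonoidal where
  prop_unit := hT.isTrivial_of_bijective (inferInstanceAs (Module.Finite E E)) T.unitLin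
    T.unitLin_bijective T.phiL_unitLin
  prop_tensor M N hM hN := by
    have := hM.1
    have := hN.1
    exact hT.isTrivial_of_bijective (M := M ⊗ N) (inferInstanceAs (Module.Finite E (M ⊗[E] N)))
      (T.tensorLin M N) (hM.tensorLin_bijective hN) T.phiL_tensorLin

theorem IsRegular.isIso_tensorHomV {M N : PhiMod T.σ} (hM : T.IsTrivial M) (hN : T.IsTrivial N) :
    IsIso (T.tensorHomV M N) :=
  Rep.isIso_of_bijective _
    (hT.codRestrict_bijective (M := M ⊗ N) (T.tensorLin M N) (hM.tensorLin_bijective hN)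
      T.phiL_tensorLin)

theorem IsRegular.isIso_unitHomV : IsIso T.unitHomV :=
  Rep.isIso_of_bijective _
    (hT.codRestrict_bijective T.unitLin T.unitLin_bijective T.phiL_unitLin)

omit hT

variable (T)

section Res

variable (P : ObjectProperty (Rep.{u} F G)) (hV : ∀ M, T.IsTrivial M → P (T.V.obj M))
  [T.IsTrivial.IsMonoidal] [P.IsMonoidal]

/-- The restriction of `V` to `L`-trivial `φ`-modules is lax monoidal. -/
@[reducible]
noncomputable def laxMonoidalVRes : (T.VRes P hV).LaxMonoidal where
  ε := ObjectProperty.homMk (Functor.LaxMonoidal.ε T.V)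
  μ M N := ObjectProperty.homMk (Functor.LaxMonoidal.μ T.V M.obj N.obj)
  μ_natural_left f _ := ObjectProperty.hom_ext _ (Functor.LaxMonoidal.μ_natural_left T.V f.hom _)
  μ_natural_right _ f := ObjectProperty.hom_ext _ (Functor.LaxMonoidal.μ_natural_right T.V _ f.hom)
  associativity _ _ _ := ObjectProperty.hom_ext _ (Functor.LaxMonoidal.associativity T.V _ _ _)
  left_unitality _ := ObjectProperty.hom_ext _ (Functor.LaxMonoidal.left_unitality T.V _)
  right_unitality _ := ObjectProperty.hom_ext _ (Functor.LaxMonoidal.right_unitality T.V _)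

/-- `V` is a symmetric monoidal functor on `L`-trivial `φ`-modules, with the natural structure
maps. -/
theorem IsRegular.exists_braided (hT : T.IsRegular) :
    ∃ _ : (T.VRes P hV).Braided, ∀ M N : T.IsTrivial.FullSubcategory,
      T.IsNaturalTensorMap M.obj N.obj (Functor.LaxMonoidal.μ (T.VRes P hV) M N).hom := by
  let _ := T.laxMonoidalVRes P hV
  have h1 : IsIso (Functor.LaxMonoidal.ε (T.VRes P hV)) := by
    have := hT.isIso_unitHomV
    have : IsIso (P.ι.map (Functor.LaxMonoidal.ε (T.VRes P hV))) := this
    exact isIso_of_reflects_iso _ P.ι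
  have h2 (M N) : IsIso (Functor.LaxMonoidal.μ (T.VRes P hV) M N) := by
    have := hT.isIso_tensorHomV M.property N.property
    have : IsIso (P.ι.map (Functor.LaxMonoidal.μ (T.VRes P hV) M N)) := this
    exact isIso_of_reflects_iso _ P.ι
  exact ⟨{ Functor.Monoidal.ofLaxMonoidal (T.VRes P hV) with
    braided := fun M N => ObjectProperty.hom_ext _
      (Functor.LaxBraided.braided (F := T.V) M.obj N.obj) },
    fun M N => T.isNaturalTensorMap_μ M.obj N.obj⟩

end Res

end SigmaTriple

/-! ### Irreducibility over extensions without new algebraic elements -/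

/-- An irreducible polynomial over `k` remains irreducible over a field in which `k` is
algebraically closed: the coefficients of its monic factors are algebraic over `k`. -/
theorem irreducible_map_of_algebraicClosure_eq_bot {k K : Type*} [Field k] [Field K] [Algebra k K]
    (hK : algebraicClosure k K = ⊥) {p : k[X]} (hmonic : p.Monic) (hp : Irreducible p) :
    Irreducible (p.map (algebraMap k K)) := by
  have key (g : K[X]) (hg : g.Monic) (hd : g ∣ p.map (algebraMap k K)) :
      ∃ g₀ : k[X], g₀.Monic ∧ g₀.map (algebraMap k K) = g := by
    have h1 := integralClosure.mem_lifts_of_monic_of_dvd_map K hmonic hg hd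
    have h2 : g ∈ lifts (algebraMap k K) := by
      rw [Polynomial.lifts_iff_coeff_lifts] at h1 ⊢
      intro n
      obtain ⟨c, hc⟩ := h1 n
      have h3 : (c : K) ∈ algebraicClosure k K := mem_algebraicClosure_iff'.2 c.2
      rw [hK, IntermediateField.mem_bot] at h3
      rw [← hc]
      exact h3
    obtain ⟨g₀, hg₀, -, hm⟩ := Polynomial.lifts_and_degree_eq_and_monic h2 hg
    exact ⟨g₀, hm, hg₀⟩
  rw [(hmonic.map _).irreducible_iff_natDegree]
  refine ⟨fun h => hp.not_isUnit ?_, fun f g hf hg hfg => ?_⟩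
  · have : p = 1 := Polynomial.map_injective _ (algebraMap k K).injective
      (by rw [h, Polynomial.map_one])
    rw [this]
    exact isUnit_one
  · obtain ⟨f₀, hf₀, rfl⟩ := key f hf (Dvd.intro _ hfg)
    obtain ⟨g₀, hg₀, rfl⟩ := key g hg (Dvd.intro_left _ hfg)
    rw [hf₀.natDegree_map, hg₀.natDegree_map]
    refine (hmonic.irreducible_iff_natDegree.1 hp).2 f₀ g₀ hf₀ hg₀ ?_
    apply Polynomial.map_injective _ (algebraMap k K).injective
    rw [Polynomial.map_mul, hfg]

/-! ### Bases of fixed vectors -/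

section Columns

variable {L N n : Type*} [CommRing L] [AddCommGroup N] [Module L N] [Fintype n]

/-- If `A` is the matrix of the `s`-semilinear operator `Φ` on a generating family `B` and if
`A s(P) = P`, then the columns of `P` define vectors fixed by `Φ`. -/
theorem apply_sum_smul_eq_self {s : L →+* L} {Φ : N →+ N}
    (hΦ : ∀ (l : L) (x : N), Φ (l • x) = s l • Φ x) {B : n → N} {A P : Matrix n n L}
    (hA : ∀ j, Φ (B j) = ∑ i, A i j • B i) (hP : A * P.map s = P) (j : n) :
    Φ (∑ k, P k j • B k) = ∑ k, P k j • B k := by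
  calc Φ (∑ k, P k j • B k) = ∑ k, ∑ i, (s (P k j) * A i k) • B i := by
        rw [map_sum]
        refine Finset.sum_congr rfl fun k _ => ?_
        rw [hΦ, hA, Finset.smul_sum]
        exact Finset.sum_congr rfl fun i _ => smul_smul _ _ _
    _ = ∑ i, (A * P.map s) i j • B i := by
        rw [Finset.sum_comm]
        refine Finset.sum_congr rfl fun i _ => ?_
        rw [← Finset.sum_smul, Matrix.mul_apply]
        refine congrArg (· • B i) (Finset.sum_congr rfl fun k _ => ?_)
        rw [Matrix.map_apply, mul_comm]
    _ = _ := by rw [hP]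

/-- Change of basis by `P` followed by `Q`. -/
theorem sum_smul_sum_smul (P Q : Matrix n n L) (B : n → N) (j : n) :
    ∑ k, Q k j • ∑ i, P i k • B i = ∑ i, (P * Q) i j • B i := by
  calc ∑ k, Q k j • ∑ i, P i k • B i = ∑ k, ∑ i, (Q k j * P i k) • B i := by
        refine Finset.sum_congr rfl fun k _ => ?_
        rw [Finset.smul_sum]
        exact Finset.sum_congr rfl fun i _ => smul_smul _ _ _
    _ = _ := by
        rw [Finset.sum_comm]
        refine Finset.sum_congr rfl fun i _ => ?_
        rw [← Finset.sum_smul, Matrix.mul_apply]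
        exact congrArg (· • B i) (Finset.sum_congr rfl fun k _ => mul_comm _ _)

variable [DecidableEq n]

theorem sum_one_smul (B : n → N) (j : n) : ∑ i, (1 : Matrix n n L) i j • B i = B j := by
  rw [Finset.sum_eq_single j (fun i _ hi => by rw [Matrix.one_apply_ne hi, zero_smul])
    (fun h => (h (Finset.mem_univ j)).elim), Matrix.one_apply_eq, one_smul]

theorem span_sum_smul_eq_top {P : Matrix n n L} (hP : IsUnit P) {B : n → N}
    (hB : Submodule.span L (Set.range B) = ⊤) :
    Submodule.span L (Set.range fun j => ∑ k, P k j • B k) = ⊤ := by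
  obtain ⟨Q, hPQ, -⟩ := isUnit_iff_exists.1 hP
  rw [eq_top_iff, ← hB, Submodule.span_le]
  rintro _ ⟨j, rfl⟩
  have h := sum_smul_sum_smul P Q B j
  rw [hPQ, sum_one_smul] at h
  rw [← h]
  exact sum_mem fun k _ => Submodule.smul_mem _ _ (Submodule.subset_span ⟨k, rfl⟩)

end Columns

/-! ### The triple `F_q(t)_v ⊂ K(t)_v ⊂ K^sep(t)_v` -/

section Concrete

variable {Fq K Ks : Type u} [Field Fq] [Fintype Fq] [Field K] [Algebra Fq K]
  [Field Ks] [Algebra Fq Ks] [Algebra K Ks] [IsScalarTower Fq K Ks] {v : Fq[X]}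

theorem isRegular_vTriple [IsGalois K Ks] (hmonic : v.Monic) (hirr : Irreducible v)
    (hirrK : Irreducible (v.map (algebraMap Fq K))) : (vTriple v K Ks).IsRegular := by
  have hirr' : Irreducible (v.map (algebraMap Fq Fq)) := by
    rwa [Algebra.algebraMap_self, Polynomial.map_id]
  have hσ (x : Ks) (hx : ∀ _ : Unit, FiniteField.frobeniusAlgHom Fq Ks x = x) :
      x ∈ Set.range (algebraMap Fq Ks) := mem_range_algebraMap_of_pow_card_eq_self (hx ())
  have hG (x : Ks) (hx : ∀ g : Gal(Ks/K), galHom (Fq := Fq) K Ks g x = x) :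
      x ∈ Set.range (algebraMap K Ks) := (InfiniteGalois.mem_range_algebraMap_iff_fixed x).2 hx
  exact
    { nontrivial := VRat.nontrivial hirr
      isField_left := VRat.isField hmonic hirr hirr'
      isField_mid := VRat.isField hmonic hirr hirrK
      mem_range_of_σ := fun l hl => VRat.exists_map_eq_of_fixed hmonic hirr hσ fun _ => hl
      mem_range_of_smul := fun l hl => VRat.exists_map_eq_of_fixed hmonic hirr hG hl
      simple_σ := fun I hI => VRat.eq_bot_or_eq_top hmonic hirr hσ hirr' I fun _ => hI
      simple_smul := fun I hI => VRat.eq_bot_or_eq_top hmonic hirr hG hirrK I hI }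

/-- For a continuous representation `W`, there is an invertible matrix `P` over `Ks[t]_v` whose
columns, in coordinates with respect to a basis `b` of a stable lattice, are invariants of
`L ⊗ W`. -/
theorem IsContRep.exists_basis_invariant [IsGalois K Ks] (hmonic : v.Monic) (hirr : Irreducible v)
    (hirrK : Irreducible (v.map (algebraMap Fq K))) {W : Rep.{u} (VRat v Fq) Gal(Ks/K)}
    (hW : IsContRep v Gal(Ks/K) W) :
    ∃ (r : ℕ) (b : Module.Basis (Fin r) (VRat v Fq) W) (P : Matrix (Fin r) (Fin r) (VInt v Ks)),
      IsUnit P ∧ ∀ j, ∑ k, algebraMap (VInt v Ks) (VRat v Ks) (P k j) • ((1 : VRat v Ks) ⊗ₜ b k) ∈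
        (vTriple v K Ks).invariants W := by
  obtain ⟨r, b, A, hA⟩ := hW.exists_integral_basis hmonic hirr
  have hinj := VRat.algebraMap_injective (k := Fq) hirr
  have hrepr (g) (i j) : b.repr (W.ρ g (b j)) i = algebraMap _ _ (A g i j) := by
    rw [hA, b.repr_sum_self]
  have hA1 : A 1 = 1 := by
    ext i j
    apply hinj
    rw [← hrepr, map_one, Module.End.one_apply, b.repr_self, Finsupp.single_apply, Matrix.one_apply,
      apply_ite (algebraMap (VInt v Fq) (VRat v Fq)), map_one, map_zero]
    exact if_congr eq_comm rfl rfl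
  have hAmul (g h) : A (g * h) = A g * A h := by
    ext i j
    apply hinj
    rw [← hrepr, map_mul, Module.End.mul_apply, hA h, map_sum, map_sum, Finsupp.finsetSum_apply,
      Matrix.mul_apply, map_sum]
    refine Finset.sum_congr rfl fun k _ => ?_
    rw [map_smul, map_smul, Finsupp.smul_apply, hrepr, smul_eq_mul, map_mul, mul_comm]
  let f : Fq →ₐ[Fq] Ks := IsScalarTower.toAlgHom Fq Fq Ks
  let A' (g) : Matrix (Fin r) (Fin r) (VInt v Ks) := (A g).map (VInt.map v f)
  have hfix (g h) : (A' h).map (VInt.mapRing v (galHom K Ks g)) = A' h := by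
    ext i j
    change VInt.map v (galHom K Ks g) (VInt.map v f (A h i j)) = VInt.map v f (A h i j)
    rw [← AlgHom.comp_apply, ← VInt.map_comp]
    congr 2
    exact Subsingleton.elim _ _
  -- a matrix representation over `F_q[t]_v` is a cocycle, because `G` acts trivially on its entries
  obtain ⟨P, hP, hAP⟩ := exists_galois_fixed_matrix hmonic hirr hirrK A'
    (by
      change (A 1).map (VInt.map v f) = 1
      rw [hA1, Matrix.map_one _ (map_zero _) (map_one _)])
    (fun g h => by
      rw [hfix]
      change (A (g * h)).map (VInt.map v f) = _
      rw [hAmul, Matrix.map_mul])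
    (fun m => by
      have h1 (i j) : ∀ᶠ g in nhds (1 : Gal(Ks/K)), VInt.unif v Fq ^ m ∣ A g i j - A 1 i j := by
        have h2 := (hW.continuous_repr hirr b i (b j)).tendsto 1
        have h3 : {x | ∃ a, algebraMap (VInt v Fq) (VRat v Fq) (VInt.unif v Fq ^ m * a) =
            x - b.repr (W.ρ 1 (b j)) i} ∈ nhds (b.repr (W.ρ 1 (b j)) i) := by
          have := VRat.isTopologicalRing (k := Fq) hirr
          refine ((VRat.isOpen_range_algebraMap m).preimage
            (continuous_id.sub continuous_const)).mem_nhds ⟨0, ?_⟩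
          simp
        filter_upwards [h2 h3] with g hg
        obtain ⟨a, ha : _ = b.repr (W.ρ g (b j)) i - b.repr (W.ρ 1 (b j)) i⟩ := hg
        refine ⟨a, hinj ?_⟩
        rw [ha, hrepr, hrepr, map_sub]
      have h2 : ∀ᶠ g in nhds (1 : Gal(Ks/K)), ∀ i j,
          VInt.unif v Fq ^ m ∣ A g i j - A 1 i j :=
        Filter.eventually_all.2 fun i => Filter.eventually_all.2 fun j => h1 i j
      filter_upwards [h2] with g hg
      ext i j
      rw [Matrix.map_apply, ← sub_eq_zero,
        ← Matrix.map_one (VInt.proj v Ks m) (map_zero _) (map_one _), Matrix.map_apply, ← map_sub,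
        VInt.proj_eq_zero_iff]
      have h3 := map_dvd (VInt.map v f) (hg i j)
      rw [map_pow, VInt.map_unif, map_sub, hA1] at h3
      have h4 : VInt.map v f ((1 : Matrix (Fin r) (Fin r) (VInt v Fq)) i j) =
          (1 : Matrix (Fin r) (Fin r) (VInt v Ks)) i j := by
        rw [← Matrix.map_one (VInt.map v f) (map_zero _) (map_one _)]
        rfl
      rw [h4] at h3
      exact h3)
  refine ⟨r, b, P, hP, fun j g => ?_⟩
  refine apply_sum_smul_eq_self (Φ := ((vTriple v K Ks).diagAct W g).toAddMonoidHom)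
    (s := MulSemiringAction.toRingHom Gal(Ks/K) (VRat v Ks) g)
    ((vTriple v K Ks).diagAct_smul_left W g)
    (A := (A' g).map (algebraMap (VInt v Ks) (VRat v Ks)))
    (P := P.map (algebraMap (VInt v Ks) (VRat v Ks)))
    (B := fun k => (1 : VRat v Ks) ⊗ₜ b k) (fun j => ?_) ?_ j
  · change (g • (1 : VRat v Ks)) ⊗ₜ W.ρ g (b j) = _
    rw [smul_one, hA, tmul_sum]
    refine Finset.sum_congr rfl fun i _ => ?_
    rw [tmul_smul, ← algebraMap_smul (VRat v Ks)]
    exact congrArg (· • _) (VRat.map_algebraMap v f _)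
  · have h1 : (P.map (algebraMap (VInt v Ks) (VRat v Ks))).map
        (MulSemiringAction.toRingHom Gal(Ks/K) (VRat v Ks) g) =
        (P.map (VInt.mapRing v (galHom K Ks g))).map (algebraMap (VInt v Ks) (VRat v Ks)) := by
      ext i j
      exact VRat.map_algebraMap v (galHom K Ks g) _
    rw [h1, ← Matrix.map_mul, hAP]

theorem span_tmul_range_eq_top {R L M ι : Type*} [CommRing R] [CommRing L] [Algebra R L]
    [AddCommGroup M] [Module R M] {m : ι → M} (hm : Submodule.span R (Set.range m) = ⊤) :
    Submodule.span L (Set.range fun i => (1 : L) ⊗ₜ[R] m i) = ⊤ := by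
  have h := Submodule.baseChange_span (R := R) (M := M) L (Set.range m)
  rw [hm, Submodule.baseChange_top, ← Set.range_comp] at h
  exact h.symm

theorem IsContRep.isAdmissible [IsGalois K Ks] (hmonic : v.Monic) (hirr : Irreducible v)
    (hirrK : Irreducible (v.map (algebraMap Fq K))) {W : Rep.{u} (VRat v Fq) Gal(Ks/K)}
    (hW : IsContRep v Gal(Ks/K) W) : (vTriple v K Ks).IsAdmissible W := by
  obtain ⟨r, b, P, hP, hmem⟩ := hW.exists_basis_invariant hmonic hirr hirrK
  refine ⟨hW.1, ?_⟩
  have h := span_sum_smul_eq_top (hP.map (algebraMap (VInt v Ks) (VRat v Ks)).mapMatrix)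
    (span_tmul_range_eq_top (L := VRat v Ks) b.span_eq)
  rw [eq_top_iff, ← h]
  refine Submodule.span_mono ?_
  rintro _ ⟨j, rfl⟩
  exact hmem j

/-- The representation `V(M)` attached to a trivial `φ`-module is continuous, because the
Galois group acts continuously on the coordinates in `L`. -/
theorem isContRep_V [IsGalois K Ks] (hirr : Irreducible v) (hT : (vTriple v K Ks).IsRegular)
    {M : PhiMod (vTriple v K Ks).σ} (hM : (vTriple v K Ks).IsTrivial M) :
    IsContRep v Gal(Ks/K) ((vTriple v K Ks).V.obj M) := by
  have := hM.finite_fixed hT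
  have := Module.free_of_isField (M := (vTriple v K Ks).fixed M) hT.isField_left
  have := hT.nontrivial
  have := VRat.nontrivial (k := Fq) hirr
  have := VRat.isTopologicalRing (k := Ks) hirr
  let b := Module.finBasis (VRat v Fq) ((vTriple v K Ks).fixed M)
  let B := (b.baseChange (VRat v Ks)).map hM.equiv
  have hB (w : (vTriple v K Ks).fixed M) (i) :
      B.repr w.1 i = algebraMap (VRat v Fq) (VRat v Ks) (b.repr w i) := by
    have h : hM.equiv.symm w.1 = 1 ⊗ₜ w := by
      apply hM.equiv.injective
      rw [LinearEquiv.apply_symm_apply, hM.equiv_tmul, one_smul]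
    rw [Module.Basis.map_repr, LinearEquiv.trans_apply, h, Module.Basis.baseChange_repr_tmul,
      Algebra.smul_def, mul_one]
  have hcont (x : VRat v Ks ⊗[VRat v K] M) (i) :
      Continuous fun g : Gal(Ks/K) => B.repr ((vTriple v K Ks).actL M g x) i := by
    induction x using TensorProduct.induction_on with
    | zero => simpa only [map_zero, Finsupp.zero_apply] using continuous_const
    | add x y hx hy =>
      exact (hx.add hy).congr fun g => by rw [map_add, map_add, Finsupp.add_apply, Pi.add_apply]
    | tmul a m =>
      have h (g : Gal(Ks/K)) : (vTriple v K Ks).actL M g (a ⊗ₜ m) =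
          (g • a) • ((1 : VRat v Ks) ⊗ₜ[VRat v K] m) := by
        rw [TensorProduct.smul_tmul', smul_eq_mul, mul_one]
        rfl
      simp only [h, map_smul, Finsupp.smul_apply, smul_eq_mul]
      exact (VRat.continuous_smul_const hirr a).mul continuous_const
  refine isContRep_of_continuous_repr (W := (vTriple v K Ks).V.obj M) hirr b fun i j => ?_
  -- the coordinates of fixed vectors belong to `F`, whose topology is induced by that of `L`
  rw [(VRat.isInducing_map hirr (IsScalarTower.toAlgHom Fq Fq Ks)).continuous_iff]
  refine (hcont (b j).1 i).congr fun g => ?_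
  exact hB ((vTriple v K Ks).galoisRep M g (b j)) i

omit [Fintype Fq] in
theorem isMonoidal_isContRep {G : Type u} [Group G] [TopologicalSpace G] (hmonic : v.Monic)
    (hirr : Irreducible v) : (IsContRep v G).IsMonoidal := by
  have hirr' : Irreducible (v.map (algebraMap Fq Fq)) := by
    rwa [Algebra.algebraMap_self, Polynomial.map_id]
  have hF := VRat.isField hmonic hirr hirr'
  have := VRat.nontrivial (k := Fq) hirr
  have := VRat.isTopologicalRing (k := Fq) hirr
  refine { prop_unit := ?_, prop_tensor := fun W W' hW hW' => ?_ }
  · exact isContRep_of_continuous_repr (W := 𝟙_ (Rep.{u} (VRat v Fq) G)) hirr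
      (Module.Basis.singleton Unit (VRat v Fq)) fun i j =>
        (continuous_const (y := (Module.Basis.singleton Unit (VRat v Fq)).repr
          (Module.Basis.singleton Unit (VRat v Fq) j) i)).congr fun _ => rfl
  · have := Module.free_of_isField (M := W) hF
    have := Module.free_of_isField (M := W') hF
    have := hW.1
    have := hW'.1
    let b := Module.finBasis (VRat v Fq) W
    let b' := Module.finBasis (VRat v Fq) W'
    refine isContRep_of_continuous_repr (W := (W ⊗ W' : Rep.{u} (VRat v Fq) G)) hirr
      (b.tensorProduct b') fun i j => ?_
    refine ((hW.continuous_repr hirr b i.1 (b j.1)).mul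
      (hW'.continuous_repr hirr b' i.2 (b' j.2))).congr fun g => ?_
    have h : (W ⊗ W' : Rep.{u} (VRat v Fq) G).ρ g (b.tensorProduct b' j) =
        W.ρ g (b j.1) ⊗ₜ W'.ρ g (b' j.2) := by
      rw [Module.Basis.tensorProduct_apply']
      rfl
    rw [h]
    refine Eq.trans ?_ (Module.Basis.tensorProduct_repr_tmul_apply b b' (W.ρ g (b j.1))
      (W'.ρ g (b' j.2)) i.1 i.2).symm
    exact mul_comm _ _

end Concrete

/-! ### Étale models -/

section Etale

variable {A : Type u} [CommRing A] {σ : A →+* A} (M : PhiMod σ) {n : Type*} [Fintype n]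
  (b : Module.Basis n A M)

theorem PhiMod.φ_sum_smul (c : n → A) :
    M.φ (∑ j, c j • b j) = ∑ j, σ (c j) • M.φ (b j) := by
  rw [map_sum]
  exact Finset.sum_congr rfl fun j _ => M.φ.map_smulₛₗ _ _

variable {C : Matrix n n A} (hC : ∀ j, M.φ (b j) = ∑ i, C i j • b i)

include hC

theorem PhiMod.sum_smul_φ (c : n → A) :
    ∑ j, c j • M.φ (b j) = ∑ i, C.mulVec c i • b i := by
  calc ∑ j, c j • M.φ (b j) = ∑ j, ∑ i, (c j * C i j) • b i := by
        refine Finset.sum_congr rfl fun j _ => ?_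
        rw [hC, Finset.smul_sum]
        exact Finset.sum_congr rfl fun i _ => smul_smul _ _ _
    _ = _ := by
        rw [Finset.sum_comm]
        refine Finset.sum_congr rfl fun i _ => ?_
        rw [← Finset.sum_smul]
        exact congrArg (· • b i) (Finset.sum_congr rfl fun j _ => mul_comm _ _)

variable [DecidableEq n]

/-- If the linearization of `φ` is surjective, then the matrix of `φ` is invertible. -/
theorem PhiMod.isUnit_of_surjective_linearization (hs : Function.Surjective M.linearization) :
    IsUnit C := by
  have h (z : Twist σ ⊗[A] M) :
      M.linearization z ∈ Submodule.span A (Set.range fun j => M.φ (b j)) := by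
    induction z using TensorProduct.induction_on with
    | zero => rw [map_zero]; exact zero_mem _
    | add x y hx hy => rw [map_add]; exact add_mem hx hy
    | tmul a x =>
      refine Submodule.smul_mem _ (show A from a) ?_
      rw [← b.sum_repr x]
      change M.φ _ ∈ _
      rw [M.φ_sum_smul b]
      exact sum_mem fun j _ => Submodule.smul_mem _ _ (Submodule.subset_span ⟨j, rfl⟩)
  have h1 (j) : ∃ c : n → A, ∑ i, c i • M.φ (b i) = b j := by
    obtain ⟨z, hz⟩ := hs (b j)
    exact (Submodule.mem_span_range_iff_exists_fun A).1 (hz ▸ h z)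
  choose D hD using h1
  refine IsUnit.of_mul_eq_one (Matrix.of fun i j => D j i) ?_
  ext i j
  have h2 := congrArg (fun x => b.repr x i) (hD j)
  rw [M.sum_smul_φ b hC] at h2
  simp only [b.repr_sum_self, b.repr_self, Finsupp.single_apply] at h2
  rw [Matrix.one_apply, if_congr (eq_comm (a := i)) rfl rfl, ← h2]
  rfl

/-- A free `φ`-module is étale if the matrix of `φ` is invertible. -/
theorem PhiMod.isEtale_of_isUnit (hu : IsUnit C) : M.IsEtale := by
  have h1 (c : n → A) : M.linearization (∑ j, (show Twist σ from c j) ⊗ₜ b j) =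
      ∑ i, C.mulVec c i • b i := by
    rw [map_sum, ← M.sum_smul_φ b hC]
    exact Finset.sum_congr rfl fun j _ => M.linearization_tmul (c j) (b j)
  have h2 (z : Twist σ ⊗[A] M) : ∃ c : n → A, ∑ j, (show Twist σ from c j) ⊗ₜ b j = z := by
    refine ⟨fun j => (b.baseChange (Twist σ)).repr z j, ?_⟩
    conv_rhs => rw [← (b.baseChange (Twist σ)).sum_repr z]
    refine Finset.sum_congr rfl fun j _ => ?_
    rw [Module.Basis.baseChange_apply, TensorProduct.smul_tmul', smul_eq_mul, mul_one]
  obtain ⟨D, hCD, hDC⟩ := isUnit_iff_exists.1 hu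
  refine ⟨Module.Finite.of_basis b, (injective_iff_map_eq_zero _).2 fun z hz => ?_, fun y => ?_⟩
  · obtain ⟨c, rfl⟩ := h2 z
    rw [h1] at hz
    have h3 : C.mulVec c = 0 := funext fun i => by
      have := congrArg (fun x => b.repr x i) hz
      simpa only [b.repr_sum_self, map_zero, Finsupp.zero_apply, Pi.zero_apply] using this
    have h4 : c = 0 := by
      rw [← Matrix.one_mulVec c, ← hDC, ← Matrix.mulVec_mulVec, h3, Matrix.mulVec_zero]
    rw [h4]
    exact Finset.sum_eq_zero fun j _ => TensorProduct.zero_tmul _ _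
  · refine ⟨∑ j, (show Twist σ from D.mulVec (b.repr y) j) ⊗ₜ b j, ?_⟩
    rw [h1, Matrix.mulVec_mulVec, hCD, Matrix.one_mulVec, b.sum_repr]

end Etale

/-- Vectors over a field which become a basis over a ring extension form a basis. -/
theorem exists_basis_of_baseChange_basis {R L M n : Type*} [CommRing R] [CommRing L] [Algebra R L]
    [Nontrivial L] [AddCommGroup M] [Module R M] [Fintype n] (hR : IsField R) {m : n → M}
    (B : Module.Basis n L (L ⊗[R] M)) (hB : ∀ i, B i = 1 ⊗ₜ m i) :
    ∃ b : Module.Basis n R M, ∀ i, b i = m i := by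
  let _ : Field R := hR.toField
  have : Module.Finite L (L ⊗[R] M) := Module.Finite.of_basis B
  have : Module.Finite R M := finite_of_baseChange_finite this
  have hli : LinearIndependent R m := by
    refine LinearIndependent.of_comp (TensorProduct.mk R L M 1) ?_
    have h : (TensorProduct.mk R L M 1 ∘ m) = B := funext fun i => (hB i).symm
    rw [h]
    refine B.linearIndependent.restrict_scalars fun x y hxy => (algebraMap R L).injective ?_
    simpa only [Algebra.algebraMap_eq_smul_one] using hxy
  have hcard : Fintype.card n = Module.finrank R M := by
    rw [← Module.finrank_baseChange (R := L), Module.finrank_eq_card_basis B]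
  exact ⟨Module.Basis.mk hli (hli.span_eq_top_of_card_eq_finrank' hcard).ge,
    fun i => Module.Basis.mk_apply _ _ i⟩

/-- An element of `k[t]_v` which becomes invertible in `k'[t]_v` is invertible: its inverse in the
field `k(t)_v` is integral over `k'`. -/
theorem VInt.isUnit_of_isUnit_map {Fq k k' : Type u} [Field Fq] {v : Fq[X]} [Field k] [Algebra Fq k]
    [Field k'] [Algebra Fq k'] (hmonic : v.Monic) (hirr : Irreducible v)
    (hk : Irreducible (v.map (algebraMap Fq k))) (f : k →ₐ[Fq] k') {d : VInt v k}
    (hd : IsUnit (VInt.map v f d)) : IsUnit d := by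
  obtain ⟨u, hu, -⟩ := isUnit_iff_exists.1 hd
  have hF := VRat.isField hmonic hirr hk
  have hinj := VRat.algebraMap_injective (k := k) hirr
  have h0 : algebraMap (VInt v k) (VRat v k) d ≠ 0 := by
    rw [Ne, map_eq_zero_iff _ hinj]
    rintro rfl
    have := VInt.nontrivial (k := k') hirr
    rw [map_zero] at hd
    exact not_isUnit_zero hd
  obtain ⟨e, he⟩ := hF.mul_inv_cancel h0
  have h1 : VRat.map v f e = algebraMap _ _ u := by
    calc VRat.map v f e
        = VRat.map v f e * (algebraMap _ _ (VInt.map v f d) * algebraMap _ _ u) := by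
          rw [← map_mul, hu, map_one, mul_one]
      _ = VRat.map v f (algebraMap _ _ d * e) * algebraMap _ _ u := by
          rw [map_mul, VRat.map_algebraMap]
          ring
      _ = _ := by rw [he, map_one, one_mul]
  obtain ⟨y, hy, -⟩ := VRat.mem_range_of_map_mem_range hirr f h1
  refine IsUnit.of_mul_eq_one y (hinj ?_)
  rw [map_mul, hy, he, map_one]

section Concrete

variable {Fq K Ks : Type u} [Field Fq] [Fintype Fq] [Field K] [Algebra Fq K]
  [Field Ks] [Algebra Fq Ks] [Algebra K Ks] [IsScalarTower Fq K Ks] {v : Fq[X]}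

/-- In a basis of the étale model, the matrix of `φ` is invertible over `K[t]_v`, and Lang's theorem
provides a basis of fixed vectors over `Ks[t]_v`. -/
theorem isTrivial_of_hasEtaleModel [IsSepClosed Ks] (hmonic : v.Monic) (hirr : Irreducible v)
    (hirrK : Irreducible (v.map (algebraMap Fq K))) (hT : (vTriple v K Ks).IsRegular)
    {M : PhiMod (vTriple v K Ks).σ}
    (h : M.HasEtaleModel (VInt.sigma v K) (VRat.sigma_algebraMap v K)) :
    (vTriple v K Ks).IsTrivial M := by
  let _ : Module (VInt v K) M := Module.compHom M (algebraMap (VInt v K) (VRat v K))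
  have hsmul (c : VInt v K) (x : M) : c • x = algebraMap (VInt v K) (VRat v K) c • x := rfl
  have : IsScalarTower (VInt v K) (VRat v K) M := ⟨fun b e x => by
    rw [Algebra.smul_def, mul_smul]
    rfl⟩
  obtain ⟨M₀, hM₀, ⟨hfin, hbij⟩, hbase⟩ := h
  obtain ⟨r, ⟨b⟩⟩ := VInt.exists_basis_submodule hmonic hirr hirrK M₀ hfin
  have hspan : Submodule.span (VRat v K) (Set.range fun j => (b j : M)) = ⊤ := by
    rw [eq_top_iff]
    rintro x -
    refine hbase.inductionOn x _ (zero_mem _) (fun y => ?_)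
      (fun e y hy => Submodule.smul_mem _ e hy) fun y z hy hz => add_mem hy hz
    rw [← b.sum_repr y, map_sum]
    refine sum_mem fun j _ => ?_
    rw [map_smul, ← algebraMap_smul (VRat v K)]
    exact Submodule.smul_mem _ _ (Submodule.subset_span ⟨j, rfl⟩)
  let φ₀ (x : M₀) : M₀ := ⟨M.φ x, hM₀ x x.2⟩
  let C : Matrix (Fin r) (Fin r) (VInt v K) := Matrix.of fun i j => b.repr (φ₀ (b j)) i
  have hC (j) : φ₀ (b j) = ∑ i, C i j • b i := (b.sum_repr _).symm
  have hu : IsUnit C := PhiMod.isUnit_of_surjective_linearization _ b hC hbij.2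
  let f := IsScalarTower.toAlgHom Fq K Ks
  obtain ⟨P, hP, hCP⟩ := exists_frobenius_fixed_matrix hmonic hirr (C.map (VInt.map v f))
    (hu.map (VInt.map v f).toRingHom.mapMatrix)
  classical
  refine hT.isTrivial_of_span ⟨⟨Finset.univ.image fun j => (b j : M), by
    rw [Finset.coe_image, Finset.coe_univ, Set.image_univ, hspan]⟩⟩ ?_
  rw [eq_top_iff, ← span_sum_smul_eq_top
    (hP.map (algebraMap (VInt v Ks) (VRat v Ks)).mapMatrix)
    (span_tmul_range_eq_top (L := VRat v Ks) hspan)]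
  refine Submodule.span_mono ?_
  rintro _ ⟨j, rfl⟩
  refine apply_sum_smul_eq_self (Φ := ((vTriple v K Ks).phiL M).toAddMonoidHom)
    (s := (VRat.sigma v Ks : VRat v Ks →+* VRat v Ks))
    ((vTriple v K Ks).phiL_smul_left M)
    (A := (C.map (VInt.map v f)).map (algebraMap (VInt v Ks) (VRat v Ks)))
    (P := P.map (algebraMap (VInt v Ks) (VRat v Ks)))
    (B := fun k => (1 : VRat v Ks) ⊗ₜ (b k : M)) (fun j => ?_) ?_ j
  · have h1 := congrArg Subtype.val (hC j)
    change M.φ (b j) = M₀.subtype (∑ i, C i j • b i) at h1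
    change (VRat.sigma v Ks (1 : VRat v Ks)) ⊗ₜ M.φ (b j) = _
    rw [map_one, h1, map_sum, tmul_sum]
    refine Finset.sum_congr rfl fun i _ => ?_
    rw [map_smul, hsmul, tmul_smul, ← algebraMap_smul (VRat v Ks)]
    exact congrArg (· • _) (VRat.map_algebraMap v f _)
  · have h1 : (P.map (algebraMap (VInt v Ks) (VRat v Ks))).map
        (VRat.sigma v Ks : VRat v Ks →+* VRat v Ks) =
        (P.map (VInt.sigma v Ks)).map (algebraMap (VInt v Ks) (VRat v Ks)) := by
      ext i j
      exact VRat.sigma_algebraMap v Ks _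
    rw [h1, ← Matrix.map_mul, hCP]

/-- In `L ⊗ V(M) = L ⊗ M`, a Galois-invariant basis of the form `P e`, with `e` a basis of a stable
lattice in `V(M)` and `P` an invertible matrix over `Ks[t]_v`, comes from a basis of `M`, in which
the matrix of `φ` is `P⁻¹ σ(P)`. -/
theorem hasEtaleModel_of_isTrivial [IsGalois K Ks] (hmonic : v.Monic) (hirr : Irreducible v)
    (hirrK : Irreducible (v.map (algebraMap Fq K))) (hT : (vTriple v K Ks).IsRegular)
    {M : PhiMod (vTriple v K Ks).σ} (hM : (vTriple v K Ks).IsTrivial M) :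
    M.HasEtaleModel (VInt.sigma v K) (VRat.sigma_algebraMap v K) := by
  have := hT.nontrivial
  let _ : Module (VInt v K) M := Module.compHom M (algebraMap (VInt v K) (VRat v K))
  have hsmul (c : VInt v K) (x : M) : c • x = algebraMap (VInt v K) (VRat v K) c • x := rfl
  have : IsScalarTower (VInt v K) (VRat v K) M := ⟨fun b e x => by
    rw [Algebra.smul_def, mul_smul]
    rfl⟩
  let f := IsScalarTower.toAlgHom Fq K Ks
  obtain ⟨r, b, P, hP, hmem⟩ := (isContRep_V hirr hT hM).exists_basis_invariant hmonic hirr hirrK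
  let e : Module.Basis (Fin r) (VRat v Fq) ((vTriple v K Ks).fixed M) := b
  obtain ⟨Q, hPQ, hQP⟩ := isUnit_iff_exists.1 hP
  let α := algebraMap (VInt v Ks) (VRat v Ks)
  let B := (e.baseChange (VRat v Ks)).map hM.equiv
  have hB (k) : B k = (e k).1 := by
    rw [Module.Basis.map_apply, Module.Basis.baseChange_apply, hM.equiv_tmul, one_smul]
  choose m hm using fun j => (hM.linDV hT).surjective ⟨_, hmem j⟩
  have hm' (j) : (1 : VRat v Ks) ⊗ₜ m j = ∑ k, α (P k j) • B k := by
    have h1 : hM.toDVLin (m j) = ∑ k, α (P k j) • ((1 : VRat v Ks) ⊗ₜ[VRat v Fq] e k) :=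
      congrArg Subtype.val (hm j)
    rw [← hM.equiv_toDVLin, h1, map_sum]
    refine Finset.sum_congr rfl fun k _ => ?_
    rw [map_smul, hM.equiv_tmul, one_smul, hB]
  have hdet : IsUnit (P.map α).det :=
    (Matrix.isUnit_iff_isUnit_det _).1 (hP.map α.mapMatrix)
  let B' := B.map (Matrix.toLinearEquiv B (P.map α) hdet)
  have hB' (j) : B' j = 1 ⊗ₜ m j := by
    rw [hm', Module.Basis.map_apply]
    exact Matrix.toLin_self B B (P.map α) j
  obtain ⟨b₁, hb₁⟩ := exists_basis_of_baseChange_basis hT.isField_mid B' hB'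
  let c : Matrix (Fin r) (Fin r) (VRat v K) := Matrix.of fun i j => b₁.repr (M.φ (m j)) i
  have hc (j) : M.φ (m j) = ∑ i, c i j • m i := by
    conv_lhs => rw [← b₁.sum_repr (M.φ (m j))]
    exact Finset.sum_congr rfl fun i _ => by rw [hb₁]; rfl
  let C' := Q * P.map (VInt.sigma v Ks)
  have hC' : IsUnit C' :=
    (isUnit_iff_exists.2 ⟨P, hQP, hPQ⟩).mul (hP.map (VInt.sigma v Ks).mapMatrix)
  -- compare coordinates of `1 ⊗ φ(m j)` with respect to the basis `B` of fixed vectors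
  have hPc : P.map α * c.map (VRat.map v f) = (P.map (VInt.sigma v Ks)).map α := by
    ext k j
    have h1 : (vTriple v K Ks).phiL M ((1 : VRat v Ks) ⊗ₜ m j) =
        ∑ k, α (VInt.sigma v Ks (P k j)) • B k := by
      rw [hm', map_sum]
      refine Finset.sum_congr rfl fun k _ => ?_
      rw [SigmaTriple.phiL_smul_left, hB, show (vTriple v K Ks).phiL M (e k).1 = (e k).1 from
        (e k).2]
      exact congrArg (· • _) (VRat.sigma_algebraMap v Ks (P k j))
    have h2 : (vTriple v K Ks).phiL M ((1 : VRat v Ks) ⊗ₜ m j) =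
        ∑ k, (P.map α * c.map (VRat.map v f)) k j • B k := by
      refine Eq.trans ?_ (sum_smul_sum_smul (P.map α) (c.map (VRat.map v f)) B j)
      change (VRat.sigma v Ks (1 : VRat v Ks)) ⊗ₜ M.φ (m j) = _
      rw [map_one, hc, tmul_sum]
      refine Finset.sum_congr rfl fun i _ => ?_
      rw [tmul_smul, ← algebraMap_smul (VRat v Ks), hm']
      rfl
    have h3 := congrArg (fun x => B.repr x k) (h2.symm.trans h1)
    simp only [B.repr_sum_self] at h3
    exact h3
  have hcC' (i j) : VRat.map v f (c i j) = α (C' i j) := by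
    have h1 : c.map (VRat.map v f) = C'.map α := by
      rw [Matrix.map_mul, ← hPc, ← Matrix.mul_assoc, ← Matrix.map_mul, hQP,
        Matrix.map_one α (map_zero α) (map_one α), Matrix.one_mul]
    exact congrFun (congrFun h1 i) j
  choose C hCc hCC' using fun i j => VRat.mem_range_of_map_mem_range hirr f (hcC' i j)
  have hCu : IsUnit (Matrix.of C) := by
    rw [Matrix.isUnit_iff_isUnit_det]
    refine VInt.isUnit_of_isUnit_map hmonic hirr hirrK f ?_
    rw [AlgHom.map_det, ← Matrix.isUnit_iff_isUnit_det]
    convert hC'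
    ext i j
    exact hCC' i j
  have hφ (j) : M.φ (m j) = ∑ i, C i j • m i := by
    rw [hc]
    exact Finset.sum_congr rfl fun i _ => by rw [hsmul, hCc]
  have hφsmul (a : VInt v K) (x : M) : M.φ (a • x) = VInt.sigma v K a • M.φ x := by
    rw [hsmul, LinearMap.map_smulₛₗ, hsmul]
    exact congrArg (· • _) (VRat.sigma_algebraMap v K a)
  have hli : LinearIndependent (VInt v K) m := by
    have h1 : LinearIndependent (VRat v K) m := by
      have := b₁.linearIndependent
      rwa [show (b₁ : Fin r → M) = m from funext hb₁] at this
    refine h1.restrict_scalars fun x y hxy => VRat.algebraMap_injective hirr ?_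
    simpa only [Algebra.algebraMap_eq_smul_one] using hxy
  let M₀ : Submodule (VInt v K) M := Submodule.span _ (Set.range m)
  have hM₀ (x) (hx : x ∈ M₀) : M.φ x ∈ M₀ := by
    refine Submodule.span_induction ?_ ?_ ?_ ?_ hx
    · rintro _ ⟨j, rfl⟩
      rw [hφ]
      exact sum_mem fun i _ => Submodule.smul_mem _ _ (Submodule.subset_span ⟨i, rfl⟩)
    · rw [map_zero]
      exact zero_mem _
    · intro x y _ _ hx hy
      rw [map_add]
      exact add_mem hx hy
    · intro a x _ hx
      rw [hφsmul]
      exact Submodule.smul_mem _ _ hx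
  let b₀ : Module.Basis (Fin r) (VInt v K) M₀ := Module.Basis.span hli
  have hb₀ (j) : (b₀ j : M) = m j := congrArg Subtype.val (Module.Basis.span_apply hli j)
  refine ⟨M₀, hM₀, ?_, ?_⟩
  · refine PhiMod.isEtale_of_isUnit _ b₀ (C := Matrix.of C) (fun j => Subtype.ext ?_) hCu
    change M.φ (b₀ j) = M₀.subtype (∑ i, C i j • b₀ i)
    rw [hb₀, hφ, map_sum]
    refine Finset.sum_congr rfl fun i _ => ?_
    rw [map_smul, Submodule.subtype_apply, hb₀]
  · have h1 : Function.Bijective (M₀.subtype.liftBaseChange (VRat v K)) := by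
      refine ⟨liftBaseChange_injective_of_linearIndependent _ b₀ ?_, LinearMap.range_eq_top.1 ?_⟩
      · have h2 : (fun i => M₀.subtype (b₀ i)) = b₁ := funext fun i => by
          rw [hb₁]
          exact hb₀ i
        rw [h2]
        exact b₁.linearIndependent
      · rw [range_liftBaseChange, eq_top_iff, ← b₁.span_eq]
        refine Submodule.span_mono ?_
        rintro _ ⟨j, rfl⟩
        exact ⟨b₀ j, by rw [hb₁]; exact hb₀ j⟩
    exact h1

end Concrete

theorem mainTheorem5 {Fq K Ks : Type u} [Field Fq] [Fintype Fq] [Field K] [Algebra Fq K]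
    [Field Ks] [Algebra Fq Ks] [Algebra K Ks] [IsScalarTower Fq K Ks] [IsSepClosure K Ks]
    (hK : algebraicClosure Fq K = ⊥) (v : Fq[X]) (hmonic : v.Monic) (hirr : Irreducible v) :
    (∀ M : PhiMod (vTriple v K Ks).σ, (vTriple v K Ks).IsTrivial M ↔
      M.HasEtaleModel (VInt.sigma v K) (VRat.sigma_algebraMap v K)) ∧
    ∃ hD : ∀ W : Rep.{u} (VRat v Fq) Gal(Ks/K), IsContRep v Gal(Ks/K) W →
        (vTriple v K Ks).IsTrivial ((vTriple v K Ks).D.obj W),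
    ∃ hV : ∀ M : PhiMod (vTriple v K Ks).σ, (vTriple v K Ks).IsTrivial M →
        IsContRep v Gal(Ks/K) ((vTriple v K Ks).V.obj M),
    ∃ (_ : (vTriple v K Ks).IsTrivial.IsMonoidal) (_ : (IsContRep v Gal(Ks/K)).IsMonoidal),
    (∃ e : (vTriple v K Ks).IsTrivial.FullSubcategory ≌
        (IsContRep v Gal(Ks/K)).FullSubcategory,
      e.functor = (vTriple v K Ks).VRes (IsContRep v Gal(Ks/K)) hV ∧
      e.inverse = (vTriple v K Ks).DRes (IsContRep v Gal(Ks/K)) hD) ∧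
    ∃ _ : ((vTriple v K Ks).VRes (IsContRep v Gal(Ks/K)) hV).Braided,
      ∀ M N : (vTriple v K Ks).IsTrivial.FullSubcategory,
        (vTriple v K Ks).IsNaturalTensorMap M.obj N.obj
          (Functor.LaxMonoidal.μ ((vTriple v K Ks).VRes (IsContRep v Gal(Ks/K)) hV) M N).hom := by
  have : IsGalois K Ks := IsSepClosure.isGalois
  have : IsSepClosed Ks := IsSepClosure.sep_closed K
  have hirrK := irreducible_map_of_algebraicClosure_eq_bot hK hmonic hirr
  have hT := isRegular_vTriple (Ks := Ks) hmonic hirr hirrK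
  have hP (W : Rep.{u} (VRat v Fq) Gal(Ks/K)) (hW : IsContRep v Gal(Ks/K) W) :
      (vTriple v K Ks).IsAdmissible W := hW.isAdmissible hmonic hirr hirrK
  have hD (W : Rep.{u} (VRat v Fq) Gal(Ks/K)) (hW : IsContRep v Gal(Ks/K) W) :
      (vTriple v K Ks).IsTrivial ((vTriple v K Ks).D.obj W) := (hP W hW).isTrivial_D hT
  have hV (M : PhiMod (vTriple v K Ks).σ) (hM : (vTriple v K Ks).IsTrivial M) :
      IsContRep v Gal(Ks/K) ((vTriple v K Ks).V.obj M) := isContRep_V hirr hT hM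
  have hmonM := hT.isMonoidal_isTrivial
  have hmonW : (IsContRep v Gal(Ks/K)).IsMonoidal := isMonoidal_isContRep hmonic hirr
  exact ⟨fun M => ⟨hasEtaleModel_of_isTrivial hmonic hirr hirrK hT,
    isTrivial_of_hasEtaleModel hmonic hirr hirrK hT⟩, hD, hV, hmonM, hmonW,
    hT.exists_equivalence _ hP hV hD,
    SigmaTriple.IsRegular.exists_braided _ _ hV hT⟩
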